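/- Let $M$ be a closed smooth manifold and let $h,k\ge 0$ be integers with $\dim M=2h+2k+1$. Let $(\alpha_t,\eta_t)$, $t\in[0,1]$, be a smooth family of contact-symplectic pairs of type $(h,k)$ on $M$: $\alpha_t$ is a $1$-form and $\eta_t$ a closed $2$-form, both depending smoothly on $(t,x)\in[0,1]\times M$, such that $\alpha_t\wedge(d\alpha_t)^h\wedge\eta_t^k$ is a volume form, $(d\alpha_t)^{h+1}=0$ and $\eta_t^{k+1}=0$. Assume that the kernel foliations $\mathcal F=\ker(\eta_t)$ and $\mathcal G=\ker(\alpha_t\wedge(d\alpha_t)^h)$ are independent of $t\in[0,1]$. A form $\gamma$ is called basic for $\mathcal F$ if $i_X\gamma=0$ and $L_X\gamma=0$ for all smooth vector fields $X$ tangent to $\mathcal F$; $H^*_b(\mathcal F)$ is the cohomology of the complex of smooth basic forms. Then there exist an isotopy $\varphi_t$ of $M$, $t\in[0,1]$ (diffeomorphisms, smooth in $(t,x)$, $\varphi_0=\mathrm{id}$), and nowhere vanishing functions $f_t$, smooth in $(t,x)$, with $\varphi_t^*\eta_t=\eta_0$ and $\varphi_t^*\alpha_t=f_t\alpha_0$ for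 all $t\in[0,1]$, if and only if the basic cohomology class $[\eta_t]\in H^2_b(\mathcal F)$ is constant as the class of a smooth family, i.e. there is a family $\gamma_t$, $t\in[0,1]$, of $1$-forms basic for $\mathcal F$ and smooth in $(t,x)$ such that $\eta_t-\eta_0=d\gamma_t$ for all $t\in[0,1]$. -/

import Mathlib

open scoped Manifold ContDiff

noncomputable section

namespace ContactSymplectic

/-! ### Alternating forms on a vector space -/

section Linear

variable {V : Type*} [AddCommGroup V] [Module ℝ V]

/-- The wedge product of real-valued alternating forms (signed sum over shuffles). -/
def wedge {k l : ℕ} (a : V [⋀^Fin k]→ₗ[ℝ] ℝ) (b : V [⋀^Fin l]→ₗ[ℝ] ℝ) :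
    V [⋀^Fin (k + l)]→ₗ[ℝ] ℝ :=
  ((LinearMap.mul' ℝ ℝ).compAlternatingMap (a.domCoprod b)).domDomCongr finSumFinEquiv

/-- The `r`-th exterior power `b ∧ ⋯ ∧ b` of a two-form; the zeroth power is the constant `1`. -/
def wedgePow (b : V [⋀^Fin 2]→ₗ[ℝ] ℝ) : (r : ℕ) → V [⋀^Fin (2 * r)]→ₗ[ℝ] ℝ
  | 0 => AlternatingMap.constOfIsEmpty ℝ V (Fin 0) (1 : ℝ)
  | r + 1 => wedge (wedgePow b r) b

/-- The kernel of an alternating form `a`: the vectors `v` with `i_v a = 0`, that is, `a` vanishes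
as soon as one of its arguments is `v`. -/
def kernel {k : ℕ} (a : V [⋀^Fin k]→ₗ[ℝ] ℝ) : Submodule ℝ V where
  carrier := {v | ∀ (w : Fin k → V) (i : Fin k), a (Function.update w i v) = 0}
  add_mem' := by
    intro u v hu hv w i
    rw [a.map_update_add, hu w i, hv w i, add_zero]
  zero_mem' := by
    intro w i
    exact a.map_update_zero w i
  smul_mem' := by
    intro c v hv w i
    rw [a.map_update_smul, hv w i, smul_zero]

end Linear

/-! ### Differential forms on a manifold -/

section Manifold

variable {n : ℕ} {M : Type*} [TopologicalSpace M] [ChartedSpace (EuclideanSpace ℝ (Fin n)) M]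

variable (n M) in
/-- A (not necessarily smooth) differential `k`-form on the `n`-dimensional manifold `M`. -/
abbrev DForm (k : ℕ) : Type _ :=
  (x : M) → TangentSpace (𝓡 n) x [⋀^Fin k]→L[ℝ] ℝ

variable (n M) in
/-- A (not necessarily smooth) vector field on the `n`-dimensional manifold `M`. -/
abbrev VField : Type _ := (x : M) → TangentSpace (𝓡 n) x

variable (n M) in
/-- A (not necessarily smooth) field of tangent subspaces on the `n`-dimensional manifold `M`. -/
abbrev Distrib : Type _ := (x : M) → Submodule ℝ (TangentSpace (𝓡 n) x)

/-- The expression of the form `θ` in the preferred chart around `c`: the pullback of `θ` under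
the inverse of the chart. -/
def chartRep {k : ℕ} (c : M) (θ : DForm n M k) :
    EuclideanSpace ℝ (Fin n) → EuclideanSpace ℝ (Fin n) [⋀^Fin k]→L[ℝ] ℝ :=
  fun y =>
    ContinuousAlternatingMap.compContinuousLinearMap (θ ((extChartAt (𝓡 n) c).symm y))
      (mfderiv 𝓘(ℝ, EuclideanSpace ℝ (Fin n)) (𝓡 n) (extChartAt (𝓡 n) c).symm y :
        EuclideanSpace ℝ (Fin n) →L[ℝ] TangentSpace (𝓡 n) ((extChartAt (𝓡 n) c).symm y))

/-- The family of `k`-forms `θ t`, `t ∈ [0,1]`, is smooth on `[0,1] × M`. -/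
def SmoothFamily {k : ℕ} (θ : ℝ → DForm n M k) : Prop :=
  ∀ c : M, ContDiffOn ℝ ∞
    (fun p : ℝ × EuclideanSpace ℝ (Fin n) => chartRep c (θ p.1) p.2)
    (Set.Icc (0 : ℝ) 1 ×ˢ (extChartAt (𝓡 n) c).target)

/-- The exterior derivative: at `x`, it is computed in the preferred chart around `x`. -/
def extD {k : ℕ} (θ : DForm n M k) : DForm n M (k + 1) := fun x =>
  ContinuousAlternatingMap.compContinuousLinearMap
    (extDeriv (chartRep x θ) (extChartAt (𝓡 n) x x))
    (mfderiv (𝓡 n) 𝓘(ℝ, EuclideanSpace ℝ (Fin n)) (extChartAt (𝓡 n) x) x :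
      TangentSpace (𝓡 n) x →L[ℝ] EuclideanSpace ℝ (Fin n))

/-- The pullback `φ^* θ`. -/
def pullback {k : ℕ} (φ : M → M) (θ : DForm n M k) : DForm n M k := fun x =>
  (θ (φ x)).compContinuousLinearMap (mfderiv (𝓡 n) (𝓡 n) φ x)

/-- The interior product `i_X θ`. -/
def interiorProd {k : ℕ} (X : VField n M) (θ : DForm n M (k + 1)) : DForm n M k := fun x =>
  { (θ x).toAlternatingMap.curryLeft (X x) with
    cont := (θ x).cont.comp (continuous_const.finCons continuous_id) }

/-- The Lie derivative `L_X θ = d (i_X θ) + i_X (d θ)` of a form of positive degree. -/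
def lieD {k : ℕ} (X : VField n M) (θ : DForm n M (k + 1)) : DForm n M (k + 1) := fun x =>
  extD (interiorProd X θ) x + interiorProd X (extD θ) x

section Basic

variable [IsManifold (𝓡 n) ∞ M]

/-- The vector field `X` is smooth and tangent to the distribution `F`. -/
def IsSmoothTangentField (F : Distrib n M) (X : VField n M) : Prop :=
  ContMDiff (𝓡 n) (𝓡 n).tangent ∞ (fun x => (⟨x, X x⟩ : TangentBundle (𝓡 n) M)) ∧
    ∀ x, X x ∈ F x

/-- The form `θ` is basic for the foliation tangent to `F`: `i_X θ = 0` and `L_X θ = 0` for all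
smooth vector fields `X` tangent to `F`. -/
def IsBasic {k : ℕ} (F : Distrib n M) (θ : DForm n M (k + 1)) : Prop :=
  ∀ X : VField n M, IsSmoothTangentField F X →
    (∀ x, interiorProd X θ x = 0) ∧ ∀ x, lieD X θ x = 0

/-- The class in `H²_b(F)` of the smooth family of closed two-forms `η t`, `t ∈ [0,1]`, basic for
`F`, is constant, as the class of a smooth family: the differences `η t - η 0` are the
differentials of a family of basic one-forms which is smooth on `[0,1] × M`. -/
def HasConstantBasicClass (F : Distrib n M) (η : ℝ → DForm n M 2) : Prop :=
  ∃ γ : ℝ → DForm n M 1, SmoothFamily γ ∧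
    ∀ t ∈ Set.Icc (0 : ℝ) 1, IsBasic F (γ t) ∧ ∀ x, η t x - η 0 x = extD (γ t) x

end Basic

/-! ### Contact-symplectic pairs and isotopies -/

/-- The value at `x` of the form `α ∧ (dα)^h`. -/
def contactForm (α : DForm n M 1) (h : ℕ) (x : M) :
    TangentSpace (𝓡 n) x [⋀^Fin (1 + 2 * h)]→ₗ[ℝ] ℝ :=
  wedge (α x).toAlternatingMap (wedgePow (extD α x).toAlternatingMap h)

/-- `(α, η)` is a contact-symplectic pair of type `(h, k)` on the `n`-dimensional manifold `M`:
`η` is closed, `α ∧ (dα)^h ∧ η^k` is a volume form (a nowhere vanishing form of top degree),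
`(dα)^(h+1) = 0` and `η^(k+1) = 0`. -/
structure IsContactSymplecticPair (h k : ℕ) (α : DForm n M 1) (η : DForm n M 2) : Prop where
  closed : ∀ x, extD η x = 0
  dim_eq : n = 1 + 2 * h + 2 * k
  volume_ne_zero : ∀ x,
    wedge (contactForm α h x) (wedgePow (η x).toAlternatingMap k) ≠ 0
  dα_pow : ∀ x, wedgePow (extD α x).toAlternatingMap (h + 1) = 0
  η_pow : ∀ x, wedgePow (η x).toAlternatingMap (k + 1) = 0

/-- `φ t`, `t ∈ [0,1]`, is an isotopy: a family of diffeomorphisms which is smooth on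
`[0,1] × M` and starts at the identity. -/
structure IsIsotopy (φ : ℝ → M ≃ₘ⟮𝓡 n, 𝓡 n⟯ M) : Prop where
  smooth : ContMDiffOn (𝓘(ℝ, ℝ).prod (𝓡 n)) (𝓡 n) ∞
    (fun p : ℝ × M => φ p.1 p.2) (Set.Icc (0 : ℝ) 1 ×ˢ Set.univ)
  zero : ∀ x, φ 0 x = x

/-- The family of functions `f t`, `t ∈ [0,1]`, is smooth on `[0,1] × M`. -/
def SmoothFunctionFamily (n : ℕ) {M : Type*} [TopologicalSpace M]
    [ChartedSpace (EuclideanSpace ℝ (Fin n)) M] (f : ℝ → M → ℝ) : Prop :=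
  ContMDiffOn (𝓘(ℝ, ℝ).prod (𝓡 n)) 𝓘(ℝ, ℝ) ∞
    (fun p : ℝ × M => f p.1 p.2) (Set.Icc (0 : ℝ) 1 ×ˢ Set.univ)

end Manifold

end ContactSymplectic

end

/-! Both directions rest on the formula d/dt φ_t^*θ_t = φ_t^*(θ̇_t + L_{X_t} θ_t) for the flow φ_t
of a time-dependent field X_t (`hasDerivWithinAt_pullback`).

From the isotopy to the class (`hasConstantBasicClass_of_isotopy`): an isotopy is the flow of a
smooth field X_t (`IsIsotopy.exists_field`). As η_t is closed and φ_t^*η_t is constant, η̇_t =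
-d(i_{X_t} η_t). Let γ_t be the time primitive of -i_{X_t} η_t with γ_0 = 0; then dγ_t = η_t - η_0.
It is basic because F is the kernel of every η_s: for Y tangent to F, i_Y kills each i_{X_s} η_s,
hence γ_t, and L_Y γ_t = i_Y dγ_t = i_Y(η_t - η_0) = 0.

From the class to the isotopy (`exists_isotopy_of_hasConstantBasicClass`): Moser's method.
Pointwise, a dimension count gives G = ker α ∩ ker dα of dimension 2k, F = ker η of dimension 2h+1
and TM = G ⊕ F. It also gives a Reeb vector R in ker dα ∩ ker η with α(R) = 1, and the bilinear form
dα + α⊗α + η is nondegenerate (`IsLinearPair.dims`, `IsLinearPair.exists_reeb`,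
`IsLinearPair.nondegenerate`). Define X_t by pairing it with this form to get -γ̇ - α̇ + α̇(R)α.
Since γ̇ vanishes on F and α̇ vanishes on G (G being fixed and contained in every ker α_s), this
single equation splits into α(X) = 0, i_X η = -γ̇ and i_X dα = -α̇ + α̇(R)α (`IsLinearPair.moser`).
The flow then satisfies d/dt φ_t^*η_t = 0 and d/dt φ_t^*α_t = φ_t^*(α̇_t(R_t) α_t). The latter is a
scalar linear equation, so φ_t^*α_t stays proportional to α_0.

The analytic work lies in smoothness on [0,1] × M up to the end times. Flows are constructed in a
vector space and carried to M by an embedding (`IsFlow.contDiffOn`, `exists_isotopy`). Fields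
defined by a nondegenerate linear equation are smooth because matrix inversion is
(`exists_field_solution`). This also extends each vector of F to a smooth field tangent to F
(`exists_tangent_field`), which turns basicness, tested on fields, into a pointwise condition. -/

noncomputable section

namespace ContactSymplectic

/-! ### Kernels of alternating forms and powers of a two-form -/

section LinearAlgebra

variable {V : Type*} [AddCommGroup V] [Module ℝ V]

/-- The wedge sums over classes of permutations modulo those preserving the two blocks. Multiplying
by k! l! turns this into a sum over all permutations, which can be treated term by term. -/
lemma wedge_apply {k l : ℕ} (a : V [⋀^Fin k]→ₗ[ℝ] ℝ) (b : V [⋀^Fin l]→ₗ[ℝ] ℝ)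
    (w : Fin (k + l) → V) :
    ((k.factorial * l.factorial : ℕ) : ℝ) * wedge a b w =
      ∑ σ : Equiv.Perm (Fin k ⊕ Fin l), (Equiv.Perm.sign σ : ℝ) *
        (a (fun i => w (finSumFinEquiv (σ (Sum.inl i)))) *
          b (fun i => w (finSumFinEquiv (σ (Sum.inr i))))) := by
  have h := MultilinearMap.domCoprod_alternization_eq a b
  have h2 := congrArg (fun q => (LinearMap.mul' ℝ ℝ).compAlternatingMap q (w ∘ finSumFinEquiv)) h
  simp only [Fintype.card_fin] at h2
  have h3 : ((k.factorial * l.factorial : ℕ) : ℝ) * wedge a b w =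
      (LinearMap.mul' ℝ ℝ).compAlternatingMap ((k.factorial * l.factorial) • a.domCoprod b)
        (w ∘ finSumFinEquiv) := by
    simp only [wedge, AlternatingMap.domDomCongr_apply, LinearMap.compAlternatingMap_apply,
      AlternatingMap.smul_apply, map_nsmul]
    rw [nsmul_eq_mul]
  rw [h3, ← h2]
  simp only [LinearMap.compAlternatingMap_apply, MultilinearMap.alternatization_apply, map_sum,
    Units.smul_def, map_zsmul]
  refine Finset.sum_congr rfl fun σ _ => ?_
  rw [zsmul_eq_mul]
  simp

lemma apply_eq_zero_of_mem_kernel {k : ℕ} {a : V [⋀^Fin k]→ₗ[ℝ] ℝ} {w : Fin k → V} {i : Fin k}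
    (h : w i ∈ kernel a) : a w = 0 := by
  have := h w i
  rwa [Function.update_eq_self] at this

lemma mem_kernel_two {b : V [⋀^Fin 2]→ₗ[ℝ] ℝ} {v : V} :
    v ∈ kernel b ↔ ∀ w, b ![v, w] = 0 := by
  constructor
  · intro h w
    exact apply_eq_zero_of_mem_kernel (i := 0) (by simpa using h)
  · intro h w i
    fin_cases i
    · have := h (w 1)
      convert this using 2
      ext j; fin_cases j <;> simp
    · have := h (w 0)
      rw [← neg_eq_zero, ← b.map_swap (v := ![v, w 0]) (i := 0) (j := 1) (by simp)] at this
      convert this using 2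
      ext j; fin_cases j <;> simp

/-- In every permutation term the given vector is an argument of one of the two factors, which
therefore vanishes. -/
lemma kernel_inf_le_kernel_wedge {k l : ℕ} (a : V [⋀^Fin k]→ₗ[ℝ] ℝ) (b : V [⋀^Fin l]→ₗ[ℝ] ℝ) :
    kernel a ⊓ kernel b ≤ kernel (wedge a b) := by
  rintro v ⟨ha, hb⟩ w i
  have hpos : ((k.factorial * l.factorial : ℕ) : ℝ) ≠ 0 := by positivity
  refine (mul_eq_zero.1 ((wedge_apply a b _).trans ?_)).resolve_left hpos
  refine Finset.sum_eq_zero fun σ _ => ?_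
  obtain ⟨s, hs⟩ : ∃ s, finSumFinEquiv (σ s) = i :=
    ⟨σ.symm (finSumFinEquiv.symm i), by simp⟩
  rcases s with s | s
  · rw [apply_eq_zero_of_mem_kernel (a := a) (i := s)]
    · simp
    · simpa [hs] using ha
  · rw [apply_eq_zero_of_mem_kernel (a := b) (i := s)]
    · simp
    · simpa [hs] using hb

lemma kernel_le_kernel_wedgePow (b : V [⋀^Fin 2]→ₗ[ℝ] ℝ) (r : ℕ) :
    kernel b ≤ kernel (wedgePow b r) := by
  induction r with
  | zero => intro v _ w i; exact i.elim0
  | succ r ih => exact (le_inf ih le_rfl).trans (kernel_inf_le_kernel_wedge _ _)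

/-- Complete a nonzero kernel vector to a basis. In top degree a form is determined by its values on
injective choices of basis vectors, and such choices exhaust the basis, so each contains the kernel
vector. -/
lemma kernel_eq_bot_of_ne_zero [FiniteDimensional ℝ V] {k : ℕ} {a : V [⋀^Fin k]→ₗ[ℝ] ℝ}
    (hk : Module.finrank ℝ V = k) (ha : a ≠ 0) : kernel a = ⊥ := by
  rw [eq_bot_iff]
  intro v hv
  by_contra hv0
  have hv0 : v ≠ 0 := hv0
  have hli : LinearIndepOn ℝ id ({v} : Set V) := LinearIndepOn.singleton (v := id) hv0
  set b := Module.Basis.extend hli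
  obtain ⟨i, hi⟩ : ∃ i, b i = v := by
    refine ⟨⟨v, hli.subset_extend _ rfl⟩, ?_⟩
    simp [b]
  have : Fintype (hli.extend (Set.subset_univ _)) := FiniteDimensional.fintypeBasisIndex b
  have hcard : Fintype.card (hli.extend (Set.subset_univ _)) = k := by
    rw [← hk, Module.finrank_eq_card_basis b]
  let e := (Fintype.equivFinOfCardEq hcard)
  apply ha
  refine Module.Basis.ext_alternating (b.reindex e) fun f hf => ?_
  have hs : Function.Surjective f := Finite.surjective_of_injective hf
  obtain ⟨j, hj⟩ := hs (e i)
  simpa using apply_eq_zero_of_mem_kernel (a := a) (i := j)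
    (w := fun i => (b.reindex e) (f i)) (by simpa [hj, hi] using hv)

/-- The equivalence enumerating `2 r` indices as `r` pairs. -/
def pairIndex (r : ℕ) : Fin r × Fin 2 ≃ Fin (2 * r) :=
  finProdFinEquiv.trans (finCongr (mul_comm r 2))

@[simp] lemma pairIndex_val (r : ℕ) (p : Fin r × Fin 2) :
    (pairIndex r p : ℕ) = p.2 + 2 * p.1 := by simp [pairIndex]

/-- The product of the values of a two-form on `r` consecutive pairs of vectors. -/
def pairProd (b : V [⋀^Fin 2]→ₗ[ℝ] ℝ) : (r : ℕ) → MultilinearMap ℝ (fun _ : Fin (2 * r) => V) ℝ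
  | 0 => (AlternatingMap.constOfIsEmpty ℝ V (Fin 0) (1 : ℝ) : MultilinearMap ℝ (fun _ : Fin 0 => V) ℝ)
  | r + 1 => ((LinearMap.mul' ℝ ℝ).compMultilinearMap
      ((pairProd b r).domCoprod (b : MultilinearMap ℝ (fun _ : Fin 2 => V) ℝ))).domDomCongr
        finSumFinEquiv

lemma pairProd_apply (b : V [⋀^Fin 2]→ₗ[ℝ] ℝ) (r : ℕ) (w : Fin (2 * r) → V) :
    pairProd b r w = ∏ i : Fin r, b ![w (pairIndex r (i, 0)), w (pairIndex r (i, 1))] := by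
  induction r with
  | zero => simp [pairProd]
  | succ r ih =>
    rw [Fin.prod_univ_castSucc]
    simp only [pairProd, MultilinearMap.domDomCongr_apply, LinearMap.compMultilinearMap_apply,
      MultilinearMap.domCoprod_apply, LinearMap.mul'_apply]
    rw [ih]
    have hb : (b fun i₂ => w (finSumFinEquiv (Sum.inr i₂))) =
        b ![w (pairIndex (r + 1) (Fin.last r, 0)), w (pairIndex (r + 1) (Fin.last r, 1))] := by
      congr 1
      ext j
      fin_cases j
      all_goals
        refine congrArg w (Fin.ext ?_)
        simp <;> omega
    refine congrArg₂ (· * ·) (Finset.prod_congr rfl fun i _ => ?_) hb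
    congr 2

/-- Alternatization turns tensor products into wedges, and the alternatization of an already
alternating two-form is twice that form; hence one factor 2 per copy of `b`. -/
lemma wedgePow_eq (b : V [⋀^Fin 2]→ₗ[ℝ] ℝ) (r : ℕ) :
    (2 : ℝ) ^ r • wedgePow b r = MultilinearMap.alternatization (pairProd b r) := by
  induction r with
  | zero =>
    ext w
    simp [wedgePow, pairProd, MultilinearMap.alternatization_apply]
  | succ r ih =>
    have hb : MultilinearMap.alternatization (b : MultilinearMap ℝ (fun _ : Fin 2 => V) ℝ)
        = (2 : ℝ) • b := by
      rw [AlternatingMap.coe_alternatization]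
      simp [← Nat.cast_smul_eq_nsmul ℝ]
    have h := MultilinearMap.domCoprod_alternization (pairProd b r)
      (b : MultilinearMap ℝ (fun _ : Fin 2 => V) ℝ)
    rw [← ih, hb, ← AlternatingMap.domCoprod'_apply, TensorProduct.smul_tmul_smul, map_smul,
      AlternatingMap.domCoprod'_apply, ← pow_succ] at h
    ext w
    have h2 := congrArg
      (fun q => (LinearMap.mul' ℝ ℝ).compAlternatingMap q (w ∘ finSumFinEquiv)) h
    simp only [LinearMap.compAlternatingMap_apply, AlternatingMap.smul_apply, map_smul] at h2
    have h3 : (wedgePow b (r + 1)) w =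
      (LinearMap.mul' ℝ ℝ) ((wedgePow b r).domCoprod b (w ∘ finSumFinEquiv)) := rfl
    rw [AlternatingMap.smul_apply, h3, ← h2]
    simp only [MultilinearMap.alternatization_apply, map_sum, pairProd, Units.smul_def, map_zsmul]
    refine Fintype.sum_equiv (Equiv.permCongr finSumFinEquiv) _ _ fun σ => ?_
    rw [Equiv.Perm.sign_permCongr]
    simp [Function.comp_def]

/-- A nonzero term comes from a permutation that maps pairs to pairs. Such a σ permutes the r pairs
as blocks by some π, and swaps or not inside pair i, by τ i. The block permutation acts alike on
both members of the pairs, so it is even and sign σ = ∏ sign (τ i). The product of the β-values is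
the same number, so each term is a square; the identity contributes 1. -/
lemma sign_prod_pos (r : ℕ) (β : Fin r × Fin 2 → Fin r × Fin 2 → ℝ)
    (h0 : ∀ p q, p.1 ≠ q.1 ∨ p.2 = q.2 → β p q = 0)
    (h1 : ∀ i, β (i, 0) (i, 1) = 1) (h2 : ∀ i, β (i, 1) (i, 0) = -1) :
    0 < ∑ σ : Equiv.Perm (Fin r × Fin 2), (Equiv.Perm.sign σ : ℝ) *
      ∏ i, β (σ (i, 0)) (σ (i, 1)) := by
  refine Finset.sum_pos' (fun σ _ => ?_) ⟨1, Finset.mem_univ _, by simp [h1]⟩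
  by_cases hz : ∃ i, β (σ (i, 0)) (σ (i, 1)) = 0
  · obtain ⟨i, hi⟩ := hz
    rw [Finset.prod_eq_zero (Finset.mem_univ i) hi, mul_zero]
  push Not at hz
  have hne : ∀ i, (σ (i, 0)).1 = (σ (i, 1)).1 ∧ (σ (i, 0)).2 ≠ (σ (i, 1)).2 := by
    intro i
    by_contra hcon
    exact hz i (h0 _ _ (by tauto))
  set p : Fin r → Fin r := fun i => (σ (i, 0)).1
  have hp1 : ∀ q, (σ q).1 = p q.1 := by
    rintro ⟨i, j⟩
    fin_cases j
    · rfl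
    · exact (hne i).1.symm
  have hpbij : Function.Bijective p := by
    rw [Fintype.bijective_iff_surjective_and_card]
    refine ⟨fun i => ⟨(σ.symm (i, 0)).1, ?_⟩, rfl⟩
    rw [← hp1]; simp
  set π : Equiv.Perm (Fin r) := Equiv.ofBijective p hpbij
  set τ : Fin r → Equiv.Perm (Fin 2) := fun i => if (σ (i, 0)).2 = 0 then 1 else Equiv.swap 0 1
  have hτ : ∀ i j, (σ (i, j)).2 = τ i j := by
    intro i j
    have := (hne i).2
    simp only [τ]
    generalize h00 : (σ (i, 0)).2 = u at *
    generalize h11 : (σ (i, 1)).2 = u' at *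
    fin_cases j
    · change (σ (i, 0)).2 = _
      rw [h00]; fin_cases u <;> simp
    · change (σ (i, 1)).2 = _
      rw [h11]; fin_cases u <;> fin_cases u' <;> simp at *
  have hσ : σ = (Equiv.prodCongrLeft (fun _ : Fin 2 => π)) * (Equiv.prodCongrRight τ) := by
    ext q : 1
    refine Prod.ext ?_ ?_
    · rw [hp1]; rfl
    · obtain ⟨i, j⟩ := q
      rw [hτ]; rfl
  have hβ : ∀ i, β (σ (i, 0)) (σ (i, 1)) = (Equiv.Perm.sign (τ i) : ℝ) := by
    intro i
    have ha := hτ i 0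
    have hb := hτ i 1
    have hc := hp1 (i, 0)
    have hd := hp1 (i, 1)
    rw [show σ (i, 0) = (p i, τ i 0) from Prod.ext hc ha,
      show σ (i, 1) = (p i, τ i 1) from Prod.ext hd hb]
    by_cases h : (σ (i, 0)).2 = 0 <;> simp [τ, h, h1, h2]
  have hs : (Equiv.Perm.sign σ : ℝ) = ∏ i, (Equiv.Perm.sign (τ i) : ℝ) := by
    rw [hσ, Equiv.Perm.sign_mul, Equiv.Perm.sign_prodCongrLeft, Equiv.Perm.sign_prodCongrRight]
    simp
  rw [Finset.prod_congr rfl fun i _ => hβ i, hs]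
  exact mul_self_nonneg _

lemma wedgePow_ne_zero_of_symplectic (b : V [⋀^Fin 2]→ₗ[ℝ] ℝ) (r : ℕ)
    (e : Fin r × Fin 2 → V) (h0 : ∀ p q, p.1 ≠ q.1 ∨ p.2 = q.2 → b ![e p, e q] = 0)
    (h1 : ∀ i, b ![e (i, 0), e (i, 1)] = 1) (h2 : ∀ i, b ![e (i, 1), e (i, 0)] = -1) :
    wedgePow b r ≠ 0 := by
  intro hzero
  have h := congrArg (fun q => q (e ∘ (pairIndex r).symm)) (wedgePow_eq b r)
  simp only [hzero, smul_zero, AlternatingMap.zero_apply, MultilinearMap.alternatization_apply,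
    MultilinearMap.domDomCongr_apply, pairProd_apply] at h
  refine (sign_prod_pos r (fun p q => b ![e p, e q]) h0 h1 h2).ne ?_
  rw [h]
  refine (Fintype.sum_equiv (Equiv.permCongr (pairIndex r)) _ _ fun σ => ?_).symm
  simp [Units.smul_def, Equiv.Perm.sign_permCongr]

end LinearAlgebra

/-! ### Rank of a two-form and the pointwise structure of a pair -/

section LinearAlgebra

variable {V : Type*} [AddCommGroup V] [Module ℝ V]

lemma update_pair_zero {W : Type*} (u v w : W) : Function.update ![u, v] 0 w = ![w, v] := by
  ext i; fin_cases i <;> simp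

lemma update_pair_one {W : Type*} (u v w : W) : Function.update ![u, v] 1 w = ![u, w] := by
  ext i; fin_cases i <;> simp

lemma update_single {W : Type*} (u w : W) : Function.update ![u] 0 w = ![w] := by
  ext i; fin_cases i; simp

/-- The bilinear form underlying an alternating two-form. -/
def bilin (b : V [⋀^Fin 2]→ₗ[ℝ] ℝ) : V →ₗ[ℝ] V →ₗ[ℝ] ℝ :=
  LinearMap.mk₂ ℝ (fun v w => b ![v, w])
    (fun u v w => by simpa only [update_pair_zero] using b.map_update_add ![u, w] 0 u v)
    (fun c u w => by simpa only [update_pair_zero] using b.map_update_smul ![u, w] 0 c u)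
    (fun u v w => by simpa only [update_pair_one] using b.map_update_add ![u, v] 1 v w)
    (fun c u w => by simpa only [update_pair_one] using b.map_update_smul ![u, w] 1 c w)

@[simp] lemma bilin_apply (b : V [⋀^Fin 2]→ₗ[ℝ] ℝ) (v w : V) : bilin b v w = b ![v, w] := rfl

lemma two_form_swap (b : V [⋀^Fin 2]→ₗ[ℝ] ℝ) (v w : V) : b ![v, w] = - b ![w, v] := by
  rw [← b.map_swap (v := ![w, v]) (i := 0) (j := 1) (by simp)]
  congr 1
  ext j; fin_cases j <;> simp

lemma two_form_self (b : V [⋀^Fin 2]→ₗ[ℝ] ℝ) (v : V) : b ![v, v] = 0 :=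
  b.map_eq_zero_of_eq ![v, v] (i := 0) (j := 1) rfl (by simp)

lemma mem_kernel_two_right {b : V [⋀^Fin 2]→ₗ[ℝ] ℝ} {v : V} (h : v ∈ kernel b) (w : V) :
    b ![w, v] = 0 := by
  rw [two_form_swap, mem_kernel_two.1 h, neg_zero]

/-- Symplectic Gram–Schmidt. The orthogonal of r ≤ s pairs has codimension at most 2r, so by the
dimension hypothesis it contains some x outside the kernel. Choose z with b(x, z) ≠ 0, remove its
components along the earlier pairs, and rescale. -/
lemma exists_symplectic_family [FiniteDimensional ℝ V] (b : V [⋀^Fin 2]→ₗ[ℝ] ℝ) (s : ℕ)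
    (hs : Module.finrank ℝ (kernel b) + 2 * s < Module.finrank ℝ V) (r : ℕ) (hr : r ≤ s + 1) :
    ∃ e : Fin r × Fin 2 → V, (∀ p q, p.1 ≠ q.1 ∨ p.2 = q.2 → b ![e p, e q] = 0) ∧
      (∀ i, b ![e (i, 0), e (i, 1)] = 1) ∧ (∀ i, b ![e (i, 1), e (i, 0)] = -1) := by
  induction r with
  | zero => exact ⟨fun p => p.1.elim0, fun p => p.1.elim0, fun p => p.elim0, fun p => p.elim0⟩
  | succ r ih =>
    obtain ⟨e, h0, h1, h2⟩ := ih (by omega)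
    set ψ : V →ₗ[ℝ] (Fin r × Fin 2 → ℝ) := LinearMap.pi fun p => bilin b (e p)
    have hdim : Module.finrank ℝ (kernel b) < Module.finrank ℝ (LinearMap.ker ψ) := by
      have h := ψ.finrank_range_add_finrank_ker
      have h' : Module.finrank ℝ (LinearMap.range ψ) ≤ 2 * r := by
        refine (Submodule.finrank_le _).trans ?_
        simp [mul_comm]
      omega
    obtain ⟨x, hxW, hxk⟩ : ∃ x ∈ LinearMap.ker ψ, x ∉ kernel b := by
      by_contra! hcon
      exact (Submodule.finrank_mono hcon).not_gt hdim
    have hx : ∀ p, b ![e p, x] = 0 := fun p => congrFun (LinearMap.mem_ker.1 hxW) p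
    have hx' : ∀ p, b ![x, e p] = 0 := fun p => by rw [two_form_swap, hx, neg_zero]
    obtain ⟨z, hz⟩ : ∃ z, b ![x, z] ≠ 0 := by
      by_contra! hcon
      exact hxk (mem_kernel_two.2 hcon)
    set y : V := z - ∑ i, (b ![e (i, 0), z] • e (i, 1) - b ![e (i, 1), z] • e (i, 0)) with hy
    have hexp : ∀ u, b ![u, y] = b ![u, z] -
        ∑ i, (b ![e (i, 0), z] * b ![u, e (i, 1)] - b ![e (i, 1), z] * b ![u, e (i, 0)]) := by
      intro u
      rw [hy, ← bilin_apply, map_sub, map_sum]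
      simp [map_sub, map_smul]
    have hey : ∀ p, b ![e p, y] = 0 := by
      rintro ⟨i, j⟩
      rw [hexp, Finset.sum_eq_single i]
      · fin_cases j
        · simp [h1, h0 (i, 0) (i, 0) (Or.inr rfl)]
        · simp [h2, h0 (i, 1) (i, 1) (Or.inr rfl)]
      · intro i' _ hne
        rw [h0 _ _ (Or.inl hne.symm), h0 _ _ (Or.inl hne.symm)]; simp
      · simp
    have hxy : b ![x, y] = b ![x, z] := by
      rw [hexp]; simp [hx']
    set y' : V := (b ![x, z])⁻¹ • y
    have hey' : ∀ p, b ![e p, y'] = 0 := fun p => by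
      rw [← bilin_apply, map_smul, bilin_apply, hey, smul_zero]
    have hey'' : ∀ p, b ![y', e p] = 0 := fun p => by rw [two_form_swap, hey', neg_zero]
    have hxy' : b ![x, y'] = 1 := by
      rw [← bilin_apply, map_smul, bilin_apply, hxy, smul_eq_mul, inv_mul_cancel₀ hz]
    have hxy'' : b ![y', x] = -1 := by rw [two_form_swap, hxy']
    refine ⟨fun p => Fin.lastCases (motive := fun _ => V) (![x, y'] p.2)
      (fun i => e (i, p.2)) p.1, ?_, ?_, ?_⟩
    · rintro ⟨i, j⟩ ⟨i', j'⟩ h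
      induction i using Fin.lastCases with
      | last =>
        induction i' using Fin.lastCases with
        | last =>
          have : j = j' := by simpa using h
          subst this
          exact two_form_self _ _
        | cast i' =>
          fin_cases j <;> simp [hx', hey'']
      | cast i =>
        induction i' using Fin.lastCases with
        | last => fin_cases j' <;> simp [hx, hey']
        | cast i' => simpa using h0 (i, j) (i', j') (by simpa using h)
    · intro i
      induction i using Fin.lastCases with
      | last => simpa using hxy'
      | cast i => simpa using h1 i
    · intro i
      induction i using Fin.lastCases with
      | last => simpa using hxy''
      | cast i => simpa using h2 i

lemma finrank_le_of_wedgePow_eq_zero [FiniteDimensional ℝ V] (b : V [⋀^Fin 2]→ₗ[ℝ] ℝ) (s : ℕ)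
    (h : wedgePow b (s + 1) = 0) :
    Module.finrank ℝ V ≤ Module.finrank ℝ (kernel b) + 2 * s := by
  by_contra! hlt
  obtain ⟨e, h0, h1, h2⟩ := exists_symplectic_family b s hlt (s + 1) le_rfl
  exact wedgePow_ne_zero_of_symplectic b (s + 1) e h0 h1 h2 h

lemma mem_kernel_one {a : V [⋀^Fin 1]→ₗ[ℝ] ℝ} {v : V} : v ∈ kernel a ↔ a ![v] = 0 := by
  constructor
  · intro h
    exact apply_eq_zero_of_mem_kernel (i := 0) (by simpa using h)
  · intro h w i
    convert h using 2
    ext j; fin_cases i; fin_cases j; simp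

/-- The linear functional underlying a one-form. -/
def lin (a : V [⋀^Fin 1]→ₗ[ℝ] ℝ) : V →ₗ[ℝ] ℝ where
  toFun v := a ![v]
  map_add' u v := by simpa only [update_single] using a.map_update_add ![u] 0 u v
  map_smul' c u := by simpa only [update_single, RingHom.id_apply] using a.map_update_smul ![u] 0 c u

@[simp] lemma lin_apply (a : V [⋀^Fin 1]→ₗ[ℝ] ℝ) (v : V) : lin a v = a ![v] := rfl

lemma ker_lin (a : V [⋀^Fin 1]→ₗ[ℝ] ℝ) : LinearMap.ker (lin a) = kernel a := by
  ext v; rw [mem_kernel_one]; rfl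

/-- The pointwise linear data of a contact-symplectic pair: a one-form `a` and two-forms `κ`
(playing the role of `da`) and `η` with `a ∧ κ^h ∧ η^k ≠ 0`, `κ^(h+1) = 0` and `η^(k+1) = 0`. -/
structure IsLinearPair (h k : ℕ) (a : V [⋀^Fin 1]→ₗ[ℝ] ℝ) (κ η : V [⋀^Fin 2]→ₗ[ℝ] ℝ) : Prop where
  dim_eq : Module.finrank ℝ V = 1 + 2 * h + 2 * k
  volume_ne_zero : wedge (wedge a (wedgePow κ h)) (wedgePow η k) ≠ 0
  κ_pow : wedgePow κ (h + 1) = 0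
  η_pow : wedgePow η (k + 1) = 0

namespace IsLinearPair

variable [FiniteDimensional ℝ V] {h k : ℕ} {a : V [⋀^Fin 1]→ₗ[ℝ] ℝ} {κ η : V [⋀^Fin 2]→ₗ[ℝ] ℝ}

lemma contact_inf (H : IsLinearPair h k a κ η) :
    kernel (wedge a (wedgePow κ h)) ⊓ kernel η = ⊥ := by
  rw [eq_bot_iff, ← kernel_eq_bot_of_ne_zero H.dim_eq H.volume_ne_zero]
  exact (inf_le_inf_left _ (kernel_le_kernel_wedgePow _ _)).trans (kernel_inf_le_kernel_wedge _ _)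

omit [FiniteDimensional ℝ V] in
lemma inf_le_contact (a : V [⋀^Fin 1]→ₗ[ℝ] ℝ) (κ : V [⋀^Fin 2]→ₗ[ℝ] ℝ) (h : ℕ) :
    kernel a ⊓ kernel κ ≤ kernel (wedge a (wedgePow κ h)) :=
  (inf_le_inf_left _ (kernel_le_kernel_wedgePow _ _)).trans (kernel_inf_le_kernel_wedge _ _)

lemma finrank_ker_lin (a : V [⋀^Fin 1]→ₗ[ℝ] ℝ) :
    Module.finrank ℝ V ≤ Module.finrank ℝ (kernel a) + 1 := by
  have := (lin a).finrank_range_add_finrank_ker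
  rw [ker_lin] at this
  have h1 : Module.finrank ℝ (LinearMap.range (lin a)) ≤ 1 :=
    (Submodule.finrank_le _).trans (by simp)
  omega

/-- The vanishing powers give dim ker κ ≥ 2k+1 and dim ker η ≥ 2h+1, whence dim (ker a ∩ ker κ) ≥
2k. This intersection lies in the kernel of a ∧ κ^h, which meets ker η trivially and so has
dimension at most 2k. The estimates close up. -/
lemma dims (H : IsLinearPair h k a κ η) :
    Module.finrank ℝ (kernel (wedge a (wedgePow κ h))) = 2 * k ∧
      Module.finrank ℝ (kernel η) = 2 * h + 1 ∧
      2 * k ≤ Module.finrank ℝ ↥(kernel a ⊓ kernel κ) ∧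
      2 * k + 1 ≤ Module.finrank ℝ (kernel κ) := by
  have h1 := finrank_le_of_wedgePow_eq_zero κ h H.κ_pow
  have h2 := finrank_le_of_wedgePow_eq_zero η k H.η_pow
  have h3 := finrank_ker_lin a
  have h4 := Submodule.finrank_sup_add_finrank_inf_eq (kernel a) (kernel κ)
  have h5 := Submodule.finrank_sup_add_finrank_inf_eq (kernel (wedge a (wedgePow κ h))) (kernel η)
  rw [H.contact_inf, finrank_bot] at h5
  have h6 := Submodule.finrank_mono (inf_le_contact a κ h)
  have h7 := Submodule.finrank_le (kernel a ⊔ kernel κ)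
  have h8 := Submodule.finrank_le (kernel (wedge a (wedgePow κ h)) ⊔ kernel η)
  have h9 := H.dim_eq
  omega

lemma contact_eq (H : IsLinearPair h k a κ η) :
    kernel (wedge a (wedgePow κ h)) = kernel a ⊓ kernel κ := by
  obtain ⟨h1, -, h3, -⟩ := H.dims
  exact (Submodule.eq_of_le_of_finrank_le (inf_le_contact a κ h) (h1.le.trans h3)).symm

lemma exists_add (H : IsLinearPair h k a κ η) (v : V) :
    ∃ g ∈ kernel (wedge a (wedgePow κ h)), ∃ f ∈ kernel η, g + f = v := by
  obtain ⟨h1, h2, -, -⟩ := H.dims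
  have h5 := Submodule.finrank_sup_add_finrank_inf_eq (kernel (wedge a (wedgePow κ h))) (kernel η)
  rw [H.contact_inf, finrank_bot] at h5
  have : kernel (wedge a (wedgePow κ h)) ⊔ kernel η = ⊤ := by
    apply Submodule.eq_top_of_finrank_eq
    have := H.dim_eq
    omega
  exact Submodule.mem_sup.1 (this ▸ Submodule.mem_top)

/-- By dimension some r in ker κ has a(r) ≠ 0. Its component in the kernel of a ∧ κ^h lies in ker a
∩ ker κ, so its component in ker η is still in ker κ with the same value of a; normalise that
component. -/
lemma exists_reeb (H : IsLinearPair h k a κ η) :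
    ∃ R, a ![R] = 1 ∧ R ∈ kernel κ ∧ R ∈ kernel η := by
  obtain ⟨h1, -, -, h4⟩ := H.dims
  obtain ⟨r, hrκ, hra⟩ : ∃ r ∈ kernel κ, r ∉ kernel a := by
    by_contra! hcon
    have h5 : kernel κ ≤ kernel (wedge a (wedgePow κ h)) := by
      rw [H.contact_eq]; exact le_inf hcon le_rfl
    have := Submodule.finrank_mono h5
    omega
  obtain ⟨g, hg, f, hf, rfl⟩ := H.exists_add r
  rw [H.contact_eq] at hg
  have hfκ : f ∈ kernel κ := by simpa using Submodule.sub_mem _ hrκ hg.2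
  have hfa : f ∉ kernel a := fun hfa => hra (Submodule.add_mem _ hg.1 hfa)
  rw [mem_kernel_one] at hfa
  refine ⟨(a ![f])⁻¹ • f, ?_, Submodule.smul_mem _ _ hfκ, Submodule.smul_mem _ _ hf⟩
  rw [← lin_apply, map_smul, lin_apply, smul_eq_mul, inv_mul_cancel₀ hfa]

/-- Testing v against itself leaves a(v)² = 0. Write v = g + f in the splitting G ⊕ F: then κ only
sees f and η only sees g. Testing against F kills i_f κ, so f lies in both kernels; then i_g η = 0
and g does too. -/
lemma nondegenerate (H : IsLinearPair h k a κ η) {v : V}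
    (hv : ∀ w, κ ![v, w] + a ![v] * a ![w] + η ![v, w] = 0) : v = 0 := by
  have hav : a ![v] = 0 := by
    have := hv v
    rw [two_form_self, two_form_self] at this
    simpa using this
  obtain ⟨g, hg, f, hf, rfl⟩ := H.exists_add v
  have hg' := hg
  rw [H.contact_eq] at hg'
  have hfa : a ![f] = 0 := by
    rw [← lin_apply, map_add, lin_apply, lin_apply, mem_kernel_one.1 hg'.1, zero_add] at hav
    exact hav
  have key : ∀ w, κ ![f, w] + η ![g, w] = 0 := by
    intro w
    have := hv w
    rw [hav, zero_mul, add_zero, ← bilin_apply, ← bilin_apply, map_add, map_add] at this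
    simpa [mem_kernel_two.1 hg'.2, mem_kernel_two.1 hf] using this
  have hfκ : ∀ w, κ ![f, w] = 0 := by
    intro w
    obtain ⟨g', hg'', f', hf', rfl⟩ := H.exists_add w
    rw [H.contact_eq] at hg''
    have := key f'
    rw [mem_kernel_two_right hf', add_zero] at this
    rw [← bilin_apply, map_add, bilin_apply, bilin_apply, this,
      mem_kernel_two_right hg''.2, zero_add]
  have hf0 : f = 0 := by
    have : f ∈ kernel (wedge a (wedgePow κ h)) ⊓ kernel η :=
      ⟨by rw [H.contact_eq]; exact ⟨mem_kernel_one.2 hfa, mem_kernel_two.2 hfκ⟩, hf⟩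
    rwa [H.contact_inf] at this
  have hg0 : g = 0 := by
    have : g ∈ kernel (wedge a (wedgePow κ h)) ⊓ kernel η :=
      ⟨hg, mem_kernel_two.2 fun w => by simpa [hfκ] using key w⟩
    rwa [H.contact_inf] at this
  rw [hf0, hg0, add_zero]

/-- The solution of the Moser equation: a vector `X` dual to `-c - b + b(R) a` with respect to
`κ + a ⊗ a + η`, where `b` vanishes on the kernel of `a ∧ κ^h` and `c` on the kernel of `η`. -/
lemma moser (H : IsLinearPair h k a κ η) {b c : V →ₗ[ℝ] ℝ} {R X : V} (hRa : a ![R] = 1)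
    (hRκ : R ∈ kernel κ) (hRη : R ∈ kernel η)
    (hb : ∀ g ∈ kernel (wedge a (wedgePow κ h)), b g = 0) (hc : ∀ f ∈ kernel η, c f = 0)
    (hX : ∀ w, κ ![X, w] + a ![X] * a ![w] + η ![X, w] = - c w - b w + b R * a ![w]) :
    a ![X] = 0 ∧ (∀ w, η ![X, w] = - c w) ∧ ∀ w, κ ![X, w] = - b w + b R * a ![w] := by
  -- At R the two-forms and c vanish, and the coefficient `b R` is chosen so that the remaining
  -- right-hand side cancels.
  have hXa : a ![X] = 0 := by
    have := hX R
    rw [mem_kernel_two_right hRκ, mem_kernel_two_right hRη, hRa, hc R hRη] at this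
    linarith
  -- On ker η the equation loses its η and c terms; on the contact kernel both sides of the claim
  -- vanish.
  have hκ : ∀ w, κ ![X, w] = - b w + b R * a ![w] := by
    intro w
    obtain ⟨g, hg, f, hf, rfl⟩ := H.exists_add w
    have hg' := hg
    rw [H.contact_eq] at hg'
    have h1 := hX f
    rw [mem_kernel_two_right hf, hXa, hc f hf] at h1
    rw [← bilin_apply, map_add, bilin_apply, bilin_apply, mem_kernel_two_right hg'.2, map_add,
      hb g hg, ← lin_apply, map_add, lin_apply, lin_apply, mem_kernel_one.1 hg'.1]
    linarith
  refine ⟨hXa, fun w => ?_, hκ⟩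
  have := hX w
  rw [hκ, hXa] at this
  linarith

end IsLinearPair

end LinearAlgebra

/-! ### Partial derivatives on [0,1] × E, up to the end times -/

section PartialDerivatives

open Set Filter Topology

/-- The unit time interval. -/
abbrev timeI : Set ℝ := Icc (0 : ℝ) 1

variable {E F : Type*} [NormedAddCommGroup E] [NormedSpace ℝ E] [NormedAddCommGroup F]
  [NormedSpace ℝ F]

/-- The derivative in the space variable of a function of time and space. -/
def dx (g : ℝ × E → F) (p : ℝ × E) : E →L[ℝ] F := fderiv ℝ (fun y => g (p.1, y)) p.2

/-- The derivative in the time variable, within `[0,1]`, of a function of time and space. -/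
def dt (g : ℝ × E → F) (p : ℝ × E) : F := derivWithin (fun t => g (t, p.2)) timeI p.1

lemma uniqueDiffOn_timeI : UniqueDiffOn ℝ timeI := uniqueDiffOn_Icc zero_lt_one

variable (E) in
/-- The product of the unit time interval and the space `E`. -/
abbrev strip : Set (ℝ × E) := timeI ×ˢ univ

variable {g : ℝ × E → F} {p : ℝ × E}

lemma uniqueDiffOn_strip : UniqueDiffOn ℝ (strip E) := uniqueDiffOn_timeI.prod uniqueDiffOn_univ

omit [NormedSpace ℝ E] in
lemma mem_closure_interior_strip (hp : p ∈ strip E) : p ∈ closure (interior (strip E)) := by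
  rw [interior_prod_eq, closure_prod_eq, interior_univ, interior_Icc,
    closure_Ioo (zero_ne_one' ℝ)]
  exact ⟨hp.1, subset_closure hp.2⟩

lemma hasFDerivAt_slice (hg : DifferentiableWithinAt ℝ g (strip E) p) (hp : p ∈ strip E) :
    HasFDerivAt (fun y => g (p.1, y))
      ((fderivWithin ℝ g (strip E) p).comp (ContinuousLinearMap.inr ℝ ℝ E)) p.2 := by
  have h1 : HasFDerivWithinAt g (fderivWithin ℝ g (strip E) p) (strip E) (p.1, p.2) :=
    hg.hasFDerivWithinAt
  exact hasFDerivWithinAt_univ.1 (h1.comp p.2 (hasFDerivAt_prodMk_right p.1 p.2).hasFDerivWithinAt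
    (fun y hy => ⟨hp.1, hy⟩))

lemma dx_eq (hg : DifferentiableWithinAt ℝ g (strip E) p) (hp : p ∈ strip E) :
    dx g p = (fderivWithin ℝ g (strip E) p).comp (ContinuousLinearMap.inr ℝ ℝ E) :=
  (hasFDerivAt_slice hg hp).fderiv

lemma hasFDerivAt_dx (hg : DifferentiableWithinAt ℝ g (strip E) p) (hp : p ∈ strip E) :
    HasFDerivAt (fun y => g (p.1, y)) (dx g p) p.2 :=
  (hasFDerivAt_slice hg hp).differentiableAt.hasFDerivAt

lemma hasDerivWithinAt_slice (hg : DifferentiableWithinAt ℝ g (strip E) p) :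
    HasDerivWithinAt (fun t => g (t, p.2)) (fderivWithin ℝ g (strip E) p (1, 0)) timeI p.1 := by
  have h1 : HasFDerivWithinAt g (fderivWithin ℝ g (strip E) p) (strip E) (p.1, p.2) :=
    hg.hasFDerivWithinAt
  have h2 : HasDerivWithinAt (fun t : ℝ => (t, p.2)) ((1 : ℝ), (0 : E)) timeI p.1 :=
    ((hasDerivAt_id p.1).prodMk (hasDerivAt_const _ _)).hasDerivWithinAt
  exact h1.comp_hasDerivWithinAt p.1 h2 fun y (hy : y ∈ timeI) => mk_mem_prod hy (mem_univ _)

lemma dt_eq (hg : DifferentiableWithinAt ℝ g (strip E) p) (hp : p ∈ strip E) :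
    dt g p = fderivWithin ℝ g (strip E) p (1, 0) :=
  (hasDerivWithinAt_slice hg).derivWithin (uniqueDiffOn_timeI _ hp.1)

lemma hasDerivWithinAt_dt (hg : DifferentiableWithinAt ℝ g (strip E) p) :
    HasDerivWithinAt (fun t => g (t, p.2)) (dt g p) timeI p.1 :=
  (hasDerivWithinAt_slice hg).differentiableWithinAt.hasDerivWithinAt

lemma fderivWithin_strip_apply (hg : DifferentiableWithinAt ℝ g (strip E) p) (hp : p ∈ strip E)
    (s : ℝ) (w : E) : fderivWithin ℝ g (strip E) p (s, w) = s • dt g p + dx g p w := by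
  rw [dt_eq hg hp, dx_eq hg hp, ← map_smul, ContinuousLinearMap.comp_apply, ← map_add]
  simp

/-- Smoothness at a point of a function defined on `[0,1] × E`. -/
abbrev SmoothAt (g : ℝ × E → F) (p : ℝ × E) : Prop := ContDiffWithinAt ℝ ∞ g (strip E) p

lemma SmoothAt.differentiableWithinAt (hg : SmoothAt g p) :
    DifferentiableWithinAt ℝ g (strip E) p := ContDiffWithinAt.differentiableWithinAt hg (by simp)

lemma SmoothAt.eventually_differentiable (hg : SmoothAt g p) (hp : p ∈ strip E) :
    ∀ᶠ q in 𝓝[strip E] p, DifferentiableWithinAt ℝ g (strip E) q := by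
  have h1 : ContDiffWithinAt ℝ 1 g (strip E) p := ContDiffWithinAt.of_le hg (mod_cast le_top)
  have h2 := h1.eventually (by simp)
  rw [insert_eq_of_mem hp] at h2
  filter_upwards [h2] with q hq
  exact hq.differentiableWithinAt (by simp)

lemma SmoothAt.fderivWithin (hg : SmoothAt g p) (hp : p ∈ strip E) :
    ContDiffWithinAt ℝ ∞ (fderivWithin ℝ g (strip E)) (strip E) p :=
  ContDiffWithinAt.fderivWithin_right hg uniqueDiffOn_strip (by simp) hp

lemma SmoothAt.eventually_dx_eq (hg : SmoothAt g p) (hp : p ∈ strip E) :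
    ∀ᶠ q in 𝓝[strip E] p,
      dx g q = (_root_.fderivWithin ℝ g (strip E) q).comp (ContinuousLinearMap.inr ℝ ℝ E) := by
  filter_upwards [hg.eventually_differentiable hp, self_mem_nhdsWithin] with q hq hqS
  exact dx_eq hq hqS

lemma SmoothAt.eventually_dt_eq (hg : SmoothAt g p) (hp : p ∈ strip E) :
    ∀ᶠ q in 𝓝[strip E] p, dt g q = _root_.fderivWithin ℝ g (strip E) q (1, 0) := by
  filter_upwards [hg.eventually_differentiable hp, self_mem_nhdsWithin] with q hq hqS
  exact dt_eq hq hqS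

lemma SmoothAt.dx (hg : SmoothAt g p) (hp : p ∈ strip E) : SmoothAt (dx g) p :=
  ContDiffWithinAt.congr_of_eventuallyEq
    (ContDiffWithinAt.clm_comp (hg.fderivWithin hp) contDiffWithinAt_const)
    (hg.eventually_dx_eq hp) (dx_eq hg.differentiableWithinAt hp)

lemma SmoothAt.dt (hg : SmoothAt g p) (hp : p ∈ strip E) : SmoothAt (dt g) p :=
  ContDiffWithinAt.congr_of_eventuallyEq
    (ContDiffWithinAt.clm_apply (hg.fderivWithin hp) contDiffWithinAt_const)
    (hg.eventually_dt_eq hp) (dt_eq hg.differentiableWithinAt hp)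

lemma minSmoothness_two_le : minSmoothness ℝ 2 ≤ (∞ : WithTop ℕ∞) := by
  rw [minSmoothness_of_isRCLikeNormedField]
  exact WithTop.coe_le_coe.2 le_top

/-- Mixed partial derivatives commute. -/
lemma SmoothAt.hasDerivWithinAt_dx (hg : SmoothAt g p) (hp : p ∈ strip E) :
    HasDerivWithinAt (fun t => ContactSymplectic.dx g (t, p.2))
      (ContactSymplectic.dx (ContactSymplectic.dt g) p) timeI p.1 := by
  have hd := hg.differentiableWithinAt
  have hS := uniqueDiffOn_strip (E := E) p hp
  -- The second derivative within the strip is symmetric even at end times, because the strip lies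
  -- in the closure of its interior.
  have hsym := ContDiffWithinAt.isSymmSndFDerivWithinAt hg minSmoothness_two_le uniqueDiffOn_strip
    (mem_closure_interior_strip hp) hp
  have h1 := hasDerivWithinAt_dt (hg.dx hp).differentiableWithinAt
  refine h1.congr_deriv ?_
  ext w
  have hGp := ((hg.fderivWithin hp).differentiableWithinAt (by simp)).hasFDerivWithinAt
  have e1 := (((ContinuousLinearMap.compL ℝ E (ℝ × E) F).flip
    (ContinuousLinearMap.inr ℝ ℝ E)).hasFDerivAt.comp_hasFDerivWithinAt p hGp).congr_of_eventuallyEq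
      (hg.eventually_dx_eq hp) (dx_eq hd hp)
  have e2 := ((ContinuousLinearMap.apply ℝ F ((1 : ℝ), (0 : E))).hasFDerivAt.comp_hasFDerivWithinAt
    p hGp).congr_of_eventuallyEq (hg.eventually_dt_eq hp) (dt_eq hd hp)
  rw [dt_eq (hg.dx hp).differentiableWithinAt hp, e1.fderivWithin hS,
    dx_eq (hg.dt hp).differentiableWithinAt hp, e2.fderivWithin hS]
  exact hsym _ _

lemma contDiffOn_dx (hg : ContDiffOn ℝ ∞ g (strip E)) : ContDiffOn ℝ ∞ (dx g) (strip E) :=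
  fun p hp => SmoothAt.dx (hg p hp) hp

/-- On products of `[0,1]` with open sets, smoothness amounts to smoothness at each point. -/
lemma contDiffOn_iff_smoothAt {U : Set E} (hU : IsOpen U) :
    ContDiffOn ℝ ∞ g (timeI ×ˢ U) ↔ ∀ p ∈ timeI ×ˢ U, SmoothAt g p := by
  refine ⟨fun h p hp => ?_, fun h p hp => (h p hp).mono (prod_mono_right (subset_univ _))⟩
  refine (h p hp).mono_of_mem_nhdsWithin ?_
  obtain ⟨t, y⟩ := p
  rw [nhdsWithin_prod_eq, nhdsWithin_univ]
  exact prod_mem_prod self_mem_nhdsWithin (hU.mem_nhds hp.2)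

end PartialDerivatives

/-! ### Existence, uniqueness and continuity of flows in a vector space -/

section Flow

open Set Filter Topology

variable {E F : Type*} [NormedAddCommGroup E] [NormedSpace ℝ E] [FiniteDimensional ℝ E]
  [NormedAddCommGroup F] [NormedSpace ℝ F]

/-- A function smooth on `[0,1] × E` whose support in `E` is bounded uniformly in time. -/
structure IsCompactField (v : ℝ × E → F) : Prop where
  smooth : ContDiffOn ℝ ∞ v (timeI ×ˢ univ)
  support : ∃ R : ℝ, ∀ t ∈ timeI, ∀ x, R ≤ ‖x‖ → v (t, x) = 0

namespace IsCompactField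

variable {v : ℝ × E → F}

lemma exists_bound (hv : IsCompactField v) : ∃ L : NNReal, ∀ t ∈ timeI, ∀ x, ‖v (t, x)‖ ≤ L := by
  obtain ⟨R, hR⟩ := hv.support
  have hK : IsCompact (timeI ×ˢ Metric.closedBall (0 : E) R) :=
    isCompact_Icc.prod (isCompact_closedBall _ _)
  obtain ⟨C, hC⟩ := hK.exists_bound_of_continuousOn
    (hv.smooth.continuousOn.mono (prod_mono_right (subset_univ _)))
  refine ⟨C.toNNReal, fun t ht x => ?_⟩
  by_cases hx : ‖x‖ ≤ R
  · exact (hC (t, x) ⟨ht, by simpa using hx⟩).trans (Real.le_coe_toNNReal C)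
  · rw [hR t ht x (not_le.1 hx).le]; simp

omit [FiniteDimensional ℝ E] in
lemma dx (hv : IsCompactField v) : IsCompactField (dx v) := by
  refine ⟨contDiffOn_dx hv.smooth, ?_⟩
  obtain ⟨R, hR⟩ := hv.support
  refine ⟨R + 1, fun t ht x hx => ?_⟩
  have : (fun y => v (t, y)) =ᶠ[𝓝 x] fun _ => 0 := by
    filter_upwards [(continuous_norm.isOpen_preimage _ isOpen_Ioi).mem_nhds
      (show R < ‖x‖ by linarith)] with y hy
    exact hR t ht y (le_of_lt hy)
  simp only [ContactSymplectic.dx]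
  rw [this.fderiv_eq]; simp

omit [FiniteDimensional ℝ E] in
lemma hasFDerivAt (hv : IsCompactField v) {t : ℝ} (ht : t ∈ timeI) (x : E) :
    HasFDerivAt (fun y => v (t, y)) (ContactSymplectic.dx v (t, x)) x :=
  hasFDerivAt_dx (p := (t, x)) (hv.smooth.differentiableOn (by simp) _ ⟨ht, mem_univ _⟩)
    ⟨ht, mem_univ _⟩

lemma exists_lipschitz (hv : IsCompactField v) :
    ∃ K : NNReal, (∀ t ∈ timeI, ∀ x, ‖ContactSymplectic.dx v (t, x)‖ ≤ K) ∧
      ∀ t ∈ timeI, LipschitzWith K (fun x => v (t, x)) := by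
  obtain ⟨K, hK⟩ := hv.dx.exists_bound
  refine ⟨K, hK, fun t ht => lipschitzWith_of_nnnorm_fderiv_le
    (fun x => (hv.hasFDerivAt ht x).differentiableAt) fun x => ?_⟩
  rw [(hv.hasFDerivAt ht x).fderiv]
  exact hK t ht x

/-- The spatial derivative is itself a compactly supported smooth field, hence Lipschitz in x
uniformly in time; the mean value inequality gives the quadratic remainder. -/
lemma exists_taylor (hv : IsCompactField v) :
    ∃ C : NNReal, ∀ t ∈ timeI, ∀ x y,
      ‖v (t, y) - v (t, x) - ContactSymplectic.dx v (t, x) (y - x)‖ ≤ C * ‖y - x‖ ^ 2 := by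
  obtain ⟨C, -, hC⟩ := hv.dx.exists_lipschitz
  refine ⟨C, fun t ht x y => ?_⟩
  have h := (convex_closedBall x ‖y - x‖).norm_image_sub_le_of_norm_hasFDerivWithin_le'
    (f := fun y => v (t, y)) (f' := fun z => ContactSymplectic.dx v (t, z))
    (φ := ContactSymplectic.dx v (t, x)) (C := C * ‖y - x‖) (x := x) (y := y)
    (fun z _ => (hv.hasFDerivAt ht z).hasFDerivWithinAt) (fun z hz => ?_)
    (by simp) (by simp [dist_eq_norm])
  · rw [pow_two, ← mul_assoc]; exact h
  · have := (hC t ht).norm_sub_le z x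
    refine this.trans ?_
    gcongr
    simpa [dist_eq_norm] using hz

end IsCompactField

/-- `Φ` is the flow of the time-dependent vector field `v` on `[0,1]`, started at time `0`. -/
structure IsFlow (v : ℝ × E → E) (Φ : ℝ × E → E) : Prop where
  init : ∀ x, Φ (0, x) = x
  deriv : ∀ x, ∀ t ∈ timeI, HasDerivWithinAt (fun t => Φ (t, x)) (v (t, Φ (t, x))) timeI t

lemma hasDerivWithinAt_Ici {f : ℝ → F} {f' : F} {t : ℝ} (ht : t ∈ Ico (0 : ℝ) 1)
    (h : HasDerivWithinAt f f' timeI t) : HasDerivWithinAt f f' (Ici t) t :=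
  h.mono_of_mem_nhdsWithin (Icc_mem_nhdsGE_of_mem ht)

namespace IsCompactField

variable {v Φ : ℝ × E → E}

lemma exists_solution (hv : IsCompactField v) {t₀ : ℝ} (ht₀ : t₀ ∈ timeI) (x : E) :
    ∃ f : ℝ → E, f t₀ = x ∧ ∀ t ∈ timeI, HasDerivWithinAt f (v (t, f t)) timeI t := by
  obtain ⟨L, hL⟩ := hv.exists_bound
  obtain ⟨K, -, hK⟩ := hv.exists_lipschitz
  -- The field is bounded by L and the time interval has length 1, so a ball of radius L contains
  -- the trajectory during all of [0,1].
  have h : IsPicardLindelof (fun t y => v (t, y)) (tmin := 0) (tmax := 1) ⟨t₀, ht₀⟩ x L 0 L K :=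
    { lipschitzOnWith := fun t ht => (hK t ht).lipschitzOnWith
      continuousOn := fun y _ => hv.smooth.continuousOn.comp (by fun_prop)
        (fun t ht => ⟨ht, mem_univ _⟩)
      norm_le := fun t ht y _ => hL t ht y
      mul_max_le := by
        have : max (1 - t₀) (t₀ - 0) ≤ 1 := max_le (by linarith [ht₀.1]) (by linarith [ht₀.2])
        simpa using mul_le_mul_of_nonneg_left this L.coe_nonneg }
  exact h.exists_eq_forall_mem_Icc_hasDerivWithinAt₀

lemma exists_isFlow (hv : IsCompactField v) : ∃ Φ, IsFlow v Φ := by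
  choose f hf using hv.exists_solution (t₀ := 0) (by simp)
  exact ⟨fun p => f p.2 p.1, fun x => (hf x).1, fun x t ht => (hf x).2 t ht⟩

/-- Stated with right derivatives on subintervals, since the invariance of the embedded manifold
compares solutions that start at a later time. -/
lemma eqOn_of_deriv (hv : IsCompactField v) {f g : ℝ → E} {a b : ℝ} (ha : 0 ≤ a) (hb : b ≤ 1)
    (hf : ContinuousOn f (Icc a b)) (hg : ContinuousOn g (Icc a b))
    (hf' : ∀ t ∈ Ico a b, HasDerivWithinAt f (v (t, f t)) (Ici t) t)
    (hg' : ∀ t ∈ Ico a b, HasDerivWithinAt g (v (t, g t)) (Ici t) t) (hab : f a = g a) :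
    EqOn f g (Icc a b) := by
  obtain ⟨K, -, hK⟩ := hv.exists_lipschitz
  exact ODE_solution_unique_of_mem_Icc_right (v := fun t y => v (t, y)) (s := fun _ => univ)
    (fun t ht => (hK t ⟨ha.trans ht.1, ht.2.le.trans hb⟩).lipschitzOnWith) hf hf'
    (fun _ _ => mem_univ _) hg hg' (fun _ _ => mem_univ _) hab

end IsCompactField

namespace IsFlow

variable {v Φ : ℝ × E → E}

omit [FiniteDimensional ℝ E] in
lemma continuousOn_slice (hΦ : IsFlow v Φ) (x : E) : ContinuousOn (fun t => Φ (t, x)) timeI :=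
  fun t ht => (hΦ.deriv x t ht).continuousWithinAt

lemma eqOn (hv : IsCompactField v) (hΦ : IsFlow v Φ) {f : ℝ → E}
    (hf : ∀ t ∈ timeI, HasDerivWithinAt f (v (t, f t)) timeI t) :
    ∀ t ∈ timeI, f t = Φ (t, f 0) :=
  hv.eqOn_of_deriv le_rfl le_rfl (fun t ht => (hf t ht).continuousWithinAt)
    (hΦ.continuousOn_slice _) (fun t ht => hasDerivWithinAt_Ici ht (hf t ⟨ht.1, ht.2.le⟩))
    (fun t ht => hasDerivWithinAt_Ici ht (hΦ.deriv _ t ⟨ht.1, ht.2.le⟩)) (hΦ.init _).symm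

lemma exists_dist_le (hv : IsCompactField v) (hΦ : IsFlow v Φ) :
    ∃ C : NNReal, ∀ t ∈ timeI, LipschitzWith C (fun x => Φ (t, x)) := by
  obtain ⟨K, -, hK⟩ := hv.exists_lipschitz
  refine ⟨(Real.exp K).toNNReal, fun t ht => LipschitzWith.of_dist_le_mul fun x y => ?_⟩
  have := dist_le_of_trajectories_ODE_of_mem (v := fun t y => v (t, y)) (s := fun _ => univ)
    (fun t ht => (hK t ⟨ht.1, ht.2.le⟩).lipschitzOnWith) (hΦ.continuousOn_slice x)
    (fun t ht => hasDerivWithinAt_Ici ht (hΦ.deriv _ t ⟨ht.1, ht.2.le⟩))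
    (fun _ _ => mem_univ _) (hΦ.continuousOn_slice y)
    (fun t ht => hasDerivWithinAt_Ici ht (hΦ.deriv _ t ⟨ht.1, ht.2.le⟩))
    (fun _ _ => mem_univ _) (by rw [hΦ.init, hΦ.init]) t ht
  refine this.trans ?_
  rw [mul_comm, Real.coe_toNNReal _ (Real.exp_pos _).le]
  gcongr
  have h1 := ht.2
  have h2 : (0 : ℝ) ≤ K := K.2
  nlinarith

lemma continuousOn (hv : IsCompactField v) (hΦ : IsFlow v Φ) :
    ContinuousOn Φ (timeI ×ˢ univ) := by
  obtain ⟨C, hC⟩ := hΦ.exists_dist_le hv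
  have := continuousOn_prod_of_continuousOn_lipschitzOnWith' (s := timeI) (t := (univ : Set E)) Φ C
    (fun t ht => (hC t ht).lipschitzOnWith) (fun x _ => hΦ.continuousOn_slice x)
  exact this

end IsFlow

end Flow

/-! ### Smooth dependence of the flow on time and initial value -/

section FlowSmooth

open Set Filter Topology

variable {E : Type*} [NormedAddCommGroup E] [NormedSpace ℝ E] [FiniteDimensional ℝ E]

/-- A globally defined, compactly supported modification of the system formed by a vector field
and its first variation. -/
lemma exists_variational_flow {v Φ : ℝ × E → E} (hv : IsCompactField v) (hΦ : IsFlow v Φ) :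
    ∃ v' Ψ : ℝ × (E × (E →L[ℝ] E)) → E × (E →L[ℝ] E), IsCompactField v' ∧ IsFlow v' Ψ ∧
      ∀ x, ∀ t ∈ timeI, HasDerivWithinAt
        (fun t => (Ψ (t, (x, ContinuousLinearMap.id ℝ E))).2)
        ((dx v (t, Φ (t, x))).comp (Ψ (t, (x, ContinuousLinearMap.id ℝ E))).2) timeI t := by
  obtain ⟨K, hK, -⟩ := hv.exists_lipschitz
  obtain ⟨R, hR⟩ := hv.support
  obtain ⟨R', hR'⟩ := hv.dx.support
  -- The first variation is linear in the matrix variable, hence unbounded, so it is cut off. The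
  -- inner radius exp K is the Gronwall bound for the matrix, so the cutoff equals 1 along the
  -- solutions that matter.
  let χ : ContDiffBump (0 : E →L[ℝ] E) :=
    { rIn := Real.exp K, rOut := Real.exp K + 1, rIn_pos := Real.exp_pos _,
      rIn_lt_rOut := by linarith }
  set v' : ℝ × (E × (E →L[ℝ] E)) → E × (E →L[ℝ] E) := fun p =>
    χ p.2.2 • (v (p.1, p.2.1), (dx v (p.1, p.2.1)).comp p.2.2) with hv'
  have hfield : IsCompactField v' := by
    refine ⟨?_, max (Real.exp K + 1) (max R R'), fun t ht x hx => ?_⟩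
    · have hm : MapsTo (fun p : ℝ × (E × (E →L[ℝ] E)) => (p.1, p.2.1)) (timeI ×ˢ univ)
        (timeI ×ˢ univ) := fun p hp => ⟨hp.1, mem_univ _⟩
      have hc : ContDiffOn ℝ ∞ (fun p : ℝ × (E × (E →L[ℝ] E)) => (p.1, p.2.1))
        (timeI ×ˢ univ) := by fun_prop
      have h1 := hv.smooth.comp hc hm
      have h2 := hv.dx.smooth.comp hc hm
      have h3 : ContDiffOn ℝ ∞ (fun p : ℝ × (E × (E →L[ℝ] E)) => χ p.2.2) (timeI ×ˢ univ) :=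
        (χ.contDiff.comp (by fun_prop)).contDiffOn
      exact h3.smul (h1.prodMk (h2.clm_comp (by fun_prop)))
    · simp only [hv']
      rw [Prod.norm_def] at hx
      rcases le_max_iff.1 hx with hx | hx
      · rw [hR t ht _ (((le_max_left _ _).trans (le_max_right _ _)).trans hx),
          hR' t ht _ (((le_max_right _ _).trans (le_max_right _ _)).trans hx)]
        simp
      · rw [χ.zero_of_le_dist, zero_smul]
        simpa using (le_max_left _ _).trans hx
  obtain ⟨Ψ, hΨ⟩ := hfield.exists_isFlow
  refine ⟨v', Ψ, hfield, hΨ, fun x => ?_⟩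
  set z : ℝ → E × (E →L[ℝ] E) := fun t => Ψ (t, (x, ContinuousLinearMap.id ℝ E)) with hz
  have hz0 : z 0 = (x, ContinuousLinearMap.id ℝ E) := hΨ.init _
  have hz' : ∀ t ∈ timeI, HasDerivWithinAt z (v' (t, z t)) timeI t := hΨ.deriv _
  have hA' : ∀ t ∈ timeI, HasDerivWithinAt (fun t => (z t).2)
      (χ (z t).2 • (dx v (t, (z t).1)).comp (z t).2) timeI t := fun t ht =>
    ((ContinuousLinearMap.snd ℝ E (E →L[ℝ] E)).hasFDerivAt.comp_hasDerivWithinAt t (hz' t ht))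
  have hx' : ∀ t ∈ timeI, HasDerivWithinAt (fun t => (z t).1)
      (χ (z t).2 • v (t, (z t).1)) timeI t := fun t ht =>
    ((ContinuousLinearMap.fst ℝ E (E →L[ℝ] E)).hasFDerivAt.comp_hasDerivWithinAt t (hz' t ht))
  -- The bound does not presuppose χ = 1: as 0 ≤ χ ≤ 1, the truncated equation already satisfies the
  -- Gronwall estimate.
  have hbound : ∀ t ∈ timeI, ‖(z t).2‖ ≤ Real.exp K := by
    intro t ht
    have := norm_le_gronwallBound_of_norm_deriv_right_le (f := fun t => (z t).2) (δ := 1) (K := K)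
      (ε := 0) (a := 0) (b := 1) (fun t ht => (hA' t ht).continuousWithinAt)
      (fun t ht => hasDerivWithinAt_Ici ht (hA' t ⟨ht.1, ht.2.le⟩))
      (by rw [hz0]; exact ContinuousLinearMap.norm_id_le) (fun t ht => ?_) t ht
    · refine this.trans ?_
      rw [gronwallBound_ε0, one_mul, Real.exp_le_exp]
      have h1 := ht.2
      have h2 : (0 : ℝ) ≤ K := K.2
      nlinarith
    · rw [norm_smul, add_zero, Real.norm_of_nonneg χ.nonneg]
      calc χ (z t).2 * ‖(dx v (t, (z t).1)).comp (z t).2‖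
          ≤ 1 * (‖dx v (t, (z t).1)‖ * ‖(z t).2‖) :=
            mul_le_mul χ.le_one (ContinuousLinearMap.opNorm_comp_le _ _) (norm_nonneg _)
              zero_le_one
        _ ≤ K * ‖(z t).2‖ := by
            rw [one_mul]
            exact mul_le_mul_of_nonneg_right (hK t ⟨ht.1, ht.2.le⟩ _) (norm_nonneg _)
  have hχ : ∀ t ∈ timeI, χ (z t).2 = 1 := fun t ht =>
    χ.one_of_mem_closedBall (by simpa using hbound t ht)
  have hzΦ : ∀ t ∈ timeI, (z t).1 = Φ (t, x) := by
    have := hΦ.eqOn hv (f := fun t => (z t).1) (fun t ht => by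
      have := hx' t ht
      rwa [hχ t ht, one_smul] at this)
    simpa [hz0] using this
  intro t ht
  have := hA' t ht
  rwa [hχ t ht, one_smul, hzΦ t ht] at this

lemma gronwallBound_zero_mul (K ε x : ℝ) :
    gronwallBound 0 K ε x = ε * gronwallBound 0 K 1 x := by
  by_cases hK : K = 0
  · subst hK; simp [gronwallBound_K0]
  · simp only [gronwallBound_of_K_ne_0 hK]; ring

/-- The flow is differentiable in the initial value, to second order uniformly in time. -/
lemma IsFlow.exists_quadratic_bound {v Φ : ℝ × E → E} (hv : IsCompactField v) (hΦ : IsFlow v Φ)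
    {A : ℝ × E → E →L[ℝ] E} (hA0 : ∀ x, A (0, x) = ContinuousLinearMap.id ℝ E)
    (hA : ∀ x, ∀ t ∈ timeI, HasDerivWithinAt (fun t => A (t, x))
      ((dx v (t, Φ (t, x))).comp (A (t, x))) timeI t) :
    ∃ C : ℝ, 0 ≤ C ∧ ∀ t ∈ timeI, ∀ x y,
      ‖Φ (t, y) - Φ (t, x) - A (t, x) (y - x)‖ ≤ C * ‖y - x‖ ^ 2 := by
  obtain ⟨K, hK, -⟩ := hv.exists_lipschitz
  obtain ⟨C, hC⟩ := hv.exists_taylor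
  obtain ⟨D, hD⟩ := hΦ.exists_dist_le hv
  refine ⟨C * D ^ 2 * gronwallBound 0 K 1 1, mul_nonneg (by positivity) ?_,
    fun t ht x y => ?_⟩
  · have := gronwallBound_mono (δ := 0) (ε := 1) (K := K) le_rfl zero_le_one K.coe_nonneg zero_le_one
    rwa [gronwallBound_x0] at this
  have hd : ∀ t ∈ timeI, HasDerivWithinAt (fun t => Φ (t, y) - Φ (t, x) - A (t, x) (y - x))
      (v (t, Φ (t, y)) - v (t, Φ (t, x)) - (dx v (t, Φ (t, x))) (A (t, x) (y - x))) timeI t := by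
    intro t ht
    refine ((hΦ.deriv y t ht).sub (hΦ.deriv x t ht)).sub ?_
    exact (ContinuousLinearMap.apply ℝ E (y - x)).hasFDerivAt.comp_hasDerivWithinAt t (hA x t ht)
  have := norm_le_gronwallBound_of_norm_deriv_right_le
    (f := fun t => Φ (t, y) - Φ (t, x) - A (t, x) (y - x)) (δ := 0) (K := K)
    (ε := C * D ^ 2 * ‖y - x‖ ^ 2) (a := 0) (b := 1)
    (fun t ht => (hd t ht).continuousWithinAt)
    (fun t ht => hasDerivWithinAt_Ici ht (hd t ⟨ht.1, ht.2.le⟩))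
    (by simp [hΦ.init, hA0]) (fun t ht => ?_) t ht
  · refine (this.trans (gronwallBound_mono le_rfl (by positivity) K.coe_nonneg
      (by linarith [ht.2] : t - 0 ≤ 1))).trans ?_
    rw [gronwallBound_zero_mul]
    exact le_of_eq (by ring)
  · have ht' : t ∈ timeI := ⟨ht.1, ht.2.le⟩
    set r := Φ (t, y) - Φ (t, x) - A (t, x) (y - x) with hr
    -- The error r of the linearisation satisfies r' = dv·r + Taylor remainder. The remainder is at
    -- most C |Φ(t,y) - Φ(t,x)|² ≤ C D² |y - x|², which is where the constant comes from.
    have e : v (t, Φ (t, y)) - v (t, Φ (t, x)) - (dx v (t, Φ (t, x))) (A (t, x) (y - x)) =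
        dx v (t, Φ (t, x)) r + (v (t, Φ (t, y)) - v (t, Φ (t, x)) -
          dx v (t, Φ (t, x)) (Φ (t, y) - Φ (t, x))) := by
      rw [hr, map_sub _ (Φ (t, y) - Φ (t, x))]; abel
    rw [e]
    refine (norm_add_le _ _).trans (add_le_add ?_ ?_)
    · exact ((dx v (t, Φ (t, x))).le_opNorm r).trans
        (mul_le_mul_of_nonneg_right (hK t ht' _) (norm_nonneg _))
    · refine (hC t ht' _ _).trans ?_
      rw [mul_assoc, ← mul_pow]
      gcongr
      exact (hD t ht').norm_sub_le y x

/-- Split Φ into its value at the fixed initial point, differentiable in time, and the increment in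
the initial point. The quadratic bound is uniform in time and A is continuous in time, so the
increment is A(t,x)(y - x) up to a little-o in both variables jointly. -/
lemma IsFlow.hasFDerivWithinAt {v Φ : ℝ × E → E} (hv : IsCompactField v) (hΦ : IsFlow v Φ)
    {A : ℝ × E → E →L[ℝ] E} (hA0 : ∀ x, A (0, x) = ContinuousLinearMap.id ℝ E)
    (hA : ∀ x, ∀ t ∈ timeI, HasDerivWithinAt (fun t => A (t, x))
      ((dx v (t, Φ (t, x))).comp (A (t, x))) timeI t) {p : ℝ × E} (hp : p ∈ timeI ×ˢ (univ : Set E)) :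
    HasFDerivWithinAt Φ ((ContinuousLinearMap.fst ℝ ℝ E).smulRight (v (p.1, Φ p)) +
      (A p).comp (ContinuousLinearMap.snd ℝ ℝ E)) (timeI ×ˢ univ) p := by
  obtain ⟨t, x⟩ := p
  obtain ⟨C, hC0, hC⟩ := hΦ.exists_quadratic_bound hv hA0 hA
  have h1 : HasFDerivWithinAt (fun p : ℝ × E => Φ (p.1, x))
      ((ContinuousLinearMap.fst ℝ ℝ E).smulRight (v (t, Φ (t, x)))) (timeI ×ˢ univ) (t, x) := by
    have ha : HasFDerivWithinAt (fun s => Φ (s, x)) _ timeI ((t, x) : ℝ × E).1 :=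
      (hΦ.deriv x t hp.1).hasFDerivWithinAt
    refine (ha.comp (t, x) (hasFDerivWithinAt_fst (s := timeI ×ˢ (univ : Set E)))
      (fun q hq => hq.1)).congr_fderiv ?_
    ext <;> simp
  have h2 : HasFDerivWithinAt (fun p : ℝ × E => Φ p - Φ (p.1, x))
      ((A (t, x)).comp (ContinuousLinearMap.snd ℝ ℝ E)) (timeI ×ˢ univ) (t, x) := by
    rw [hasFDerivWithinAt_iff_isLittleO, Asymptotics.isLittleO_iff]
    intro ε hε
    have hcont : ContinuousWithinAt (fun p : ℝ × E => C * ‖p.2 - x‖ + ‖A (p.1, x) - A (t, x)‖)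
        (timeI ×ˢ univ) (t, x) := by
      have hA1 : ContinuousWithinAt (fun p : ℝ × E => A (p.1, x)) (timeI ×ˢ univ) (t, x) :=
        ContinuousWithinAt.comp (g := fun s => A (s, x)) (f := Prod.fst) (t := timeI)
          (hA x t hp.1).continuousWithinAt continuous_fst.continuousWithinAt (fun q hq => hq.1)
      exact ContinuousWithinAt.add (by fun_prop) (hA1.sub continuousWithinAt_const).norm
    have hev := hcont.eventually (p := fun r => r < ε) (by simpa using gt_mem_nhds hε)
    filter_upwards [hev, self_mem_nhdsWithin] with p hp1 hpS
    simp only [sub_self, sub_zero, ContinuousLinearMap.comp_apply, ContinuousLinearMap.coe_snd',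
      Prod.snd_sub]
    have e : Φ p - Φ (p.1, x) - A (t, x) (p.2 - x) =
        (Φ (p.1, p.2) - Φ (p.1, x) - A (p.1, x) (p.2 - x)) +
          (A (p.1, x) - A (t, x)) (p.2 - x) := by
      simp
    rw [e]
    have hle : ‖p.2 - x‖ ≤ ‖p - (t, x)‖ := norm_snd_le (p - (t, x))
    calc _ ≤ C * ‖p.2 - x‖ ^ 2 + ‖A (p.1, x) - A (t, x)‖ * ‖p.2 - x‖ :=
          (norm_add_le _ _).trans (add_le_add (hC _ hpS.1 _ _) (ContinuousLinearMap.le_opNorm _ _))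
      _ = (C * ‖p.2 - x‖ + ‖A (p.1, x) - A (t, x)‖) * ‖p.2 - x‖ := by ring
      _ ≤ ε * ‖p - (t, x)‖ := by gcongr
  exact (h1.add h2).congr (fun p _ => by simp) (by simp)

/-- The flow of a smooth, compactly supported, time-dependent vector field is smooth. -/
theorem IsFlow.contDiffOn {v Φ : ℝ × E → E} (hv : IsCompactField v) (hΦ : IsFlow v Φ) :
    ContDiffOn ℝ ∞ Φ (timeI ×ˢ univ) := by
  rw [contDiffOn_infty]
  intro k
  -- The space must vary: the derivative of the flow is a component of the flow of the first
  -- variation, which lives on `E × (E →L[ℝ] E)`.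
  induction k generalizing E with
  | zero => exact contDiffOn_zero.2 (hΦ.continuousOn hv)
  | succ k ih =>
    obtain ⟨v', Ψ, hv', hΨ, hder⟩ := exists_variational_flow hv hΦ
    have hk := ih hv hΦ
    have hk' := ih hv' hΨ
    have hc : ContDiffOn ℝ k (fun p : ℝ × E => (Ψ (p.1, (p.2, ContinuousLinearMap.id ℝ E))).2)
        (timeI ×ˢ univ) :=
      contDiff_snd.comp_contDiffOn
        (hk'.comp (f := fun p : ℝ × E => (p.1, (p.2, ContinuousLinearMap.id ℝ E)))
          (by fun_prop) (fun p hp => ⟨hp.1, mem_univ _⟩))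
    push_cast
    rw [contDiffOn_succ_iff_hasFDerivWithinAt_of_uniqueDiffOn uniqueDiffOn_strip]
    refine ⟨by simp, _, ?_, fun p hp => hΦ.hasFDerivWithinAt hv
      (A := fun p => (Ψ (p.1, (p.2, ContinuousLinearMap.id ℝ E))).2)
      (fun x => by rw [hΨ.init]) hder hp⟩
    refine ContDiffOn.add ?_ (hc.clm_comp contDiffOn_const)
    have hvk : ContDiffOn ℝ k v (timeI ×ˢ univ) := hv.smooth.of_le (mod_cast le_top)
    have := hvk.comp (f := fun p : ℝ × E => (p.1, Φ p)) (contDiff_fst.contDiffOn.prodMk hk)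
      (fun p hp => ⟨hp.1, mem_univ _⟩)
    exact contDiffOn_const.smulRight this

end FlowSmooth

/-! ### Derivatives of charts and time-dependent fields in charts -/

section Charts

open Set Filter Topology

/-- The model Euclidean space. -/
abbrev Euc (n : ℕ) : Type := EuclideanSpace ℝ (Fin n)

variable {n : ℕ} {M : Type*} [TopologicalSpace M] [ChartedSpace (Euc n) M]

/-- The derivative of the preferred chart around `c`. -/
def chartDeriv (c x : M) : TangentSpace (𝓡 n) x →L[ℝ] Euc n :=
  mfderiv (𝓡 n) 𝓘(ℝ, Euc n) (extChartAt (𝓡 n) c) x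

/-- The derivative of the inverse of the preferred chart around `c`. -/
def chartSymmDeriv (c : M) (y : Euc n) :
    Euc n →L[ℝ] TangentSpace (𝓡 n) ((extChartAt (𝓡 n) c).symm y) :=
  mfderiv 𝓘(ℝ, Euc n) (𝓡 n) (extChartAt (𝓡 n) c).symm y

lemma chartRep_apply {k : ℕ} (c : M) (θ : DForm n M k) (y : Euc n) (w : Fin k → Euc n) :
    chartRep c θ y w = θ ((extChartAt (𝓡 n) c).symm y) (fun i => chartSymmDeriv c y (w i)) := rfl

variable [IsManifold (𝓡 n) ∞ M]

instance : IsManifold (𝓡 n) 1 M := IsManifold.of_le (n := ∞) (mod_cast le_top)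

variable {c : M} {y : Euc n}

omit [IsManifold (𝓡 n) ∞ M] in
lemma isOpen_chart_target (c : M) : IsOpen (extChartAt (𝓡 n) c).target := isOpen_extChartAt_target c

lemma hasMFDerivAt_chart {x : M} (hx : x ∈ (extChartAt (𝓡 n) c).source) :
    HasMFDerivAt (𝓡 n) 𝓘(ℝ, Euc n) (extChartAt (𝓡 n) c) x (chartDeriv c x) :=
  (mdifferentiableAt_extChartAt (by simpa using hx)).hasMFDerivAt

lemma hasMFDerivAt_chart_symm (hy : y ∈ (extChartAt (𝓡 n) c).target) :
    HasMFDerivAt 𝓘(ℝ, Euc n) (𝓡 n) (extChartAt (𝓡 n) c).symm y (chartSymmDeriv c y) := by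
  have h := mdifferentiableWithinAt_extChartAt_symm (I := 𝓡 n) hy
  rw [ModelWithCorners.range_eq_univ, mdifferentiableWithinAt_univ] at h
  exact h.hasMFDerivAt

lemma chartDeriv_chartSymmDeriv (hy : y ∈ (extChartAt (𝓡 n) c).target) (w : Euc n) :
    chartDeriv c ((extChartAt (𝓡 n) c).symm y) (chartSymmDeriv c y w) = w := by
  have h := mfderiv_extChartAt_comp_mfderivWithin_extChartAt_symm (I := 𝓡 n) hy
  rw [ModelWithCorners.range_eq_univ, mfderivWithin_univ] at h
  exact DFunLike.congr_fun h w

lemma chartSymmDeriv_chartDeriv (hy : y ∈ (extChartAt (𝓡 n) c).target)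
    (w : TangentSpace (𝓡 n) ((extChartAt (𝓡 n) c).symm y)) :
    chartSymmDeriv c y (chartDeriv c ((extChartAt (𝓡 n) c).symm y) w) = w := by
  have h := mfderivWithin_extChartAt_symm_comp_mfderiv_extChartAt (I := 𝓡 n) hy
  rw [ModelWithCorners.range_eq_univ, mfderivWithin_univ] at h
  exact DFunLike.congr_fun h w

omit [IsManifold (𝓡 n) ∞ M] in
lemma exists_chart_symm_eq {x : M} (hx : x ∈ (extChartAt (𝓡 n) c).source) :
    ∃ y ∈ (extChartAt (𝓡 n) c).target, (extChartAt (𝓡 n) c).symm y = x :=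
  ⟨_, (extChartAt (𝓡 n) c).map_source hx, (extChartAt (𝓡 n) c).left_inv hx⟩

lemma chartDeriv_injective {x : M} (hx : x ∈ (extChartAt (𝓡 n) c).source) :
    Function.Injective (chartDeriv (n := n) c x) := by
  obtain ⟨y, hy, rfl⟩ := exists_chart_symm_eq hx
  exact Function.LeftInverse.injective (chartSymmDeriv_chartDeriv hy)

/-- The expression in the preferred chart around `c` of a time-dependent vector field. -/
def fieldRep (c : M) (X : ℝ → VField n M) (p : ℝ × Euc n) : Euc n :=
  chartDeriv c ((extChartAt (𝓡 n) c).symm p.2) (X p.1 ((extChartAt (𝓡 n) c).symm p.2))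

lemma chartSymmDeriv_fieldRep (hy : y ∈ (extChartAt (𝓡 n) c).target) (X : ℝ → VField n M) (t : ℝ) :
    chartSymmDeriv c y (fieldRep c X (t, y)) = X t ((extChartAt (𝓡 n) c).symm y) :=
  chartSymmDeriv_chartDeriv hy _

/-- The time-dependent vector field `X` is smooth on `[0,1] × M`. -/
def SmoothField (X : ℝ → VField n M) : Prop :=
  ∀ c : M, ContDiffOn ℝ ∞ (fieldRep c X) (timeI ×ˢ (extChartAt (𝓡 n) c).target)

/-- The curve `u` is an integral curve of the time-dependent vector field `X` on `[0,1]`. -/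
def IsFlowLine (X : ℝ → VField n M) (u : ℝ → M) : Prop :=
  ∀ t ∈ timeI, HasMFDerivWithinAt 𝓘(ℝ, ℝ) (𝓡 n) u timeI t
    ((1 : ℝ →L[ℝ] ℝ).smulRight (X t (u t)))

end Charts

/-! ### Embedding a compact manifold and extending fields -/

section Embedding

open Set Filter Topology

variable {n : ℕ} {M : Type*} [TopologicalSpace M] [ChartedSpace (Euc n) M]
  [IsManifold (𝓡 n) ∞ M] {ι : Type*} [Fintype ι]
  (f : SmoothBumpCovering ι (𝓡 n) M)

/-- The target of the embedding defined by a bump covering. -/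
abbrev EmbTarget (ι : Type*) (n : ℕ) : Type _ := ι → Euc n × ℝ

/-- The embedding of a compact manifold into a vector space defined by a bump covering. -/
def bumpEmbedding (x : M) : EmbTarget ι n := fun i => (f i x • extChartAt (𝓡 n) (f.c i) x, f i x)

lemma contMDiff_bumpEmbedding [T2Space M] :
    ContMDiff (𝓡 n) 𝓘(ℝ, EmbTarget ι n) ∞ (bumpEmbedding f) :=
  contMDiff_pi_space.2 fun i =>
    ((f i).contMDiff_smul contMDiffOn_extChartAt).prodMk_space (f i).contMDiff

/-- The coordinates in the `i`-th chart, recovered from the point of the embedding space. -/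
def embCoord (i : ι) (z : EmbTarget ι n) : Euc n := (z i).2⁻¹ • (z i).1

/-- The open set on which the `i`-th chart provides a retraction onto the manifold. -/
def embDomain (i : ι) : Set (EmbTarget ι n) :=
  {z | (z i).2 ≠ 0} ∩ {z | embCoord i z ∈ (extChartAt (𝓡 n) (f.c i)).target}

lemma contDiffAt_embCoord {i : ι} {z : EmbTarget ι n} (hz : (z i).2 ≠ 0) :
    ContDiffAt ℝ ∞ (embCoord (n := n) i) z := by
  unfold embCoord
  have h : ContDiffAt ℝ ∞ (fun z : EmbTarget ι n => z i) z := by fun_prop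
  exact ContDiffAt.smul (ContDiffAt.inv (contDiffAt_snd.comp z h) hz) (contDiffAt_fst.comp z h)

omit [IsManifold (𝓡 n) ∞ M] in
lemma isOpen_embDomain (i : ι) : IsOpen (embDomain f i) := by
  have h1 : IsOpen {z : EmbTarget ι n | (z i).2 ≠ 0} :=
    isOpen_ne_fun (by fun_prop) continuous_const
  refine ContinuousOn.isOpen_inter_preimage (f := embCoord (n := n) i) ?_ h1
    (isOpen_chart_target (f.c i))
  exact fun z hz => (contDiffAt_embCoord hz).continuousAt.continuousWithinAt

omit [IsManifold (𝓡 n) ∞ M] [Fintype ι] in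
lemma embCoord_embedding {x : M} {i : ι} (h : bumpEmbedding f x ∈ embDomain f i) :
    x ∈ (extChartAt (𝓡 n) (f.c i)).source ∧
      embCoord i (bumpEmbedding f x) = extChartAt (𝓡 n) (f.c i) x := by
  have h1 : f i x ≠ 0 := h.1
  constructor
  · rw [extChartAt_source]
    exact (f i).support_subset_source h1
  · change (f i x)⁻¹ • f i x • extChartAt (𝓡 n) _ x = _
    rw [smul_smul, inv_mul_cancel₀ h1, one_smul]

omit [IsManifold (𝓡 n) ∞ M] [Fintype ι] in
lemma embedding_mem_domain_ind (x : M) :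
    bumpEmbedding f x ∈ embDomain f (f.ind x (mem_univ x)) := by
  have h1 : f (f.ind x (mem_univ x)) x = 1 := f.apply_ind x (mem_univ x)
  constructor
  · change f (f.ind x (mem_univ x)) x ≠ 0
    rw [h1]
    exact one_ne_zero
  · change (f (f.ind x (mem_univ x)) x)⁻¹ • f (f.ind x (mem_univ x)) x •
      extChartAt (𝓡 n) (f.c (f.ind x (mem_univ x))) x ∈
        (extChartAt (𝓡 n) (f.c (f.ind x (mem_univ x)))).target
    rw [h1, inv_one, one_smul, one_smul]
    exact (extChartAt (𝓡 n) _).map_source (f.mem_extChartAt_ind_source x (mem_univ x))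

omit [IsManifold (𝓡 n) ∞ M] [Fintype ι] in
lemma bumpEmbedding_injective : Function.Injective (bumpEmbedding f) := by
  intro x y h
  have hx := embedding_mem_domain_ind f x
  obtain ⟨h1, h2⟩ := embCoord_embedding f hx
  rw [h] at hx h2
  obtain ⟨h3, h4⟩ := embCoord_embedding f hx
  exact (extChartAt (𝓡 n) _).injOn h1 h3 (h2.symm.trans h4)

/-- The embedding, read in the `i`-th chart. -/
def embRep (c : M) : Euc n → EmbTarget ι n := bumpEmbedding f ∘ (extChartAt (𝓡 n) c).symm

lemma contDiffOn_embRep [T2Space M] (c : M) :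
    ContDiffOn ℝ ∞ (embRep f c) (extChartAt (𝓡 n) c).target := by
  rw [← contMDiffOn_iff_contDiffOn]
  exact (contMDiff_bumpEmbedding f).comp_contMDiffOn (contMDiffOn_extChartAt_symm c)

/-- The derivative of the embedding. -/
def embDeriv (x : M) : TangentSpace (𝓡 n) x →L[ℝ] EmbTarget ι n :=
  mfderiv (𝓡 n) 𝓘(ℝ, EmbTarget ι n) (bumpEmbedding f) x

lemma hasMFDerivAt_emb [T2Space M] (x : M) :
    HasMFDerivAt (𝓡 n) 𝓘(ℝ, EmbTarget ι n) (bumpEmbedding f) x (embDeriv f x) :=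
  ((contMDiff_bumpEmbedding f).mdifferentiableAt (by simp)).hasMFDerivAt

lemma hasFDerivAt_embRep [T2Space M] {c : M} {y : Euc n} (hy : y ∈ (extChartAt (𝓡 n) c).target) :
    HasFDerivAt (embRep f c) ((embDeriv f ((extChartAt (𝓡 n) c).symm y)).comp (chartSymmDeriv c y))
      y := by
  exact hasMFDerivAt_iff_hasFDerivAt.1
    ((hasMFDerivAt_emb f _).comp y (hasMFDerivAt_chart_symm hy))

/-- Where the bump function is nonzero, the coordinate map `embCoord` composed with the embedding is
a chart, whose derivative is injective. -/
lemma embDeriv_injective [T2Space M] (x : M) : Function.Injective (embDeriv f x) := by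
  set i := f.ind x (mem_univ x)
  have hx : bumpEmbedding f x ∈ embDomain f i := embedding_mem_domain_ind f x
  have h1 := ((contDiffAt_embCoord hx.1).differentiableAt (by simp)).hasFDerivAt
  have h2 : HasMFDerivAt (𝓡 n) 𝓘(ℝ, Euc n) (embCoord i ∘ bumpEmbedding f) x _ :=
    h1.hasMFDerivAt.comp x (hasMFDerivAt_emb f x)
  have hsrc := (embCoord_embedding f hx).1
  have h3 : embCoord i ∘ bumpEmbedding f =ᶠ[𝓝 x] extChartAt (𝓡 n) (f.c i) := by
    filter_upwards [(contMDiff_bumpEmbedding f).continuous.continuousAt.preimage_mem_nhds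
      ((isOpen_embDomain f i).mem_nhds hx)] with z hz
    exact (embCoord_embedding f hz).2
  have h4 := hasMFDerivAt_unique (h2.congr_of_eventuallyEq h3.symm) (hasMFDerivAt_chart hsrc)
  have h5 := chartDeriv_injective (n := n) hsrc
  rw [← h4] at h5
  exact Function.Injective.of_comp (f := fderiv ℝ (embCoord i) (bumpEmbedding f x)) h5

lemma isClosedEmbedding_emb [T2Space M] [CompactSpace M] : IsClosedEmbedding (bumpEmbedding f) :=
  (contMDiff_bumpEmbedding f).continuous.isClosedEmbedding (bumpEmbedding_injective f)

/-- A smooth time-dependent vector field extends to the embedding space, as a vector field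
with bounded support. -/
lemma exists_extended_field [T2Space M] [CompactSpace M] {X : ℝ → VField n M} (hX : SmoothField X) :
    ∃ v : ℝ × EmbTarget ι n → EmbTarget ι n, IsCompactField v ∧
      ∀ t ∈ timeI, ∀ x, v (t, bumpEmbedding f x) = embDeriv f x (X t x) := by
  obtain ⟨R, hR⟩ := (isCompact_range (contMDiff_bumpEmbedding f).continuous).isBounded.subset_closedBall 0
  obtain ⟨τ, hτ⟩ := SmoothPartitionOfUnity.exists_isSubordinate 𝓘(ℝ, EmbTarget ι n)
    (isClosedEmbedding_emb f).isClosed_range (embDomain f) (isOpen_embDomain f) (by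
      rintro _ ⟨x, rfl⟩
      exact mem_iUnion.2 ⟨_, embedding_mem_domain_ind f x⟩)
  let χ : ContDiffBump (0 : EmbTarget ι n) :=
    { rIn := |R| + 1, rOut := |R| + 2, rIn_pos := by positivity, rIn_lt_rOut := by linarith }
  -- Over `embDomain f i` the field is read off through the i-th coordinates and pushed forward by
  -- the embedding. On the embedded manifold every such extension equals the pushed field, so a
  -- partition of unity may average them.
  set w : ι → ℝ × EmbTarget ι n → EmbTarget ι n := fun i p =>
    fderiv ℝ (embRep f (f.c i)) (embCoord i p.2) (fieldRep (f.c i) X (p.1, embCoord i p.2)) with hw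
  have hwsm : ∀ i, ContDiffOn ℝ ∞ (w i) (timeI ×ˢ embDomain f i) := by
    intro i
    have hcoord : ContDiffOn ℝ ∞ (fun p : ℝ × EmbTarget ι n => embCoord i p.2)
        (timeI ×ˢ embDomain f i) := fun p hp =>
      ((contDiffAt_embCoord hp.2.1).comp p contDiffAt_snd).contDiffWithinAt
    refine ContDiffOn.clm_apply ?_ ?_
    · exact ((contDiffOn_embRep f (f.c i)).fderiv_of_isOpen (isOpen_chart_target _)
        (m := ∞) (by simp)).comp hcoord fun p hp => hp.2.2
    · exact (hX (f.c i)).comp (contDiffOn_fst.prodMk hcoord) fun p hp => ⟨hp.1, hp.2.2⟩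
  have hwval : ∀ i, ∀ t, ∀ x, bumpEmbedding f x ∈ embDomain f i →
      w i (t, bumpEmbedding f x) = embDeriv f x (X t x) := by
    intro i t x hx
    obtain ⟨h1, h2⟩ := embCoord_embedding f hx
    obtain ⟨y, hy, rfl⟩ := exists_chart_symm_eq h1
    rw [(extChartAt (𝓡 n) (f.c i)).right_inv hy] at h2
    simp only [hw, h2]
    rw [(hasFDerivAt_embRep f hy).fderiv]
    exact congrArg _ (chartSymmDeriv_fieldRep hy X t)
  refine ⟨fun p => χ p.2 • ∑ i, τ i p.2 • w i p, ⟨?_, |R| + 2, fun t _ z hz => ?_⟩, ?_⟩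
  · refine ContDiffOn.smul (χ.contDiff.comp contDiff_snd).contDiffOn ?_
    refine ContDiffOn.sum fun i _ => ?_
    rintro ⟨t, z⟩ ⟨ht, -⟩
    by_cases hz : z ∈ embDomain f i
    · have hnhds : timeI ×ˢ embDomain f i ∈ 𝓝[timeI ×ˢ univ] (t, z) := by
        rw [nhdsWithin_prod_eq, nhdsWithin_univ]
        exact prod_mem_prod self_mem_nhdsWithin ((isOpen_embDomain f i).mem_nhds hz)
      have hτsm : ContDiffWithinAt ℝ ∞ (fun p : ℝ × EmbTarget ι n => τ i p.2) (timeI ×ˢ univ)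
        (t, z) := (((τ i).contMDiff.contDiff).comp contDiff_snd).contDiffAt.contDiffWithinAt
      exact hτsm.smul ((hwsm i (t, z) ⟨ht, hz⟩).mono_of_mem_nhdsWithin hnhds)
    · have hz' : z ∉ tsupport (τ i) := fun h => hz (hτ i h)
      have h0 : (fun p : ℝ × EmbTarget ι n => τ i p.2 • w i p) =ᶠ[𝓝 (t, z)] fun _ => 0 := by
        have := ((continuous_snd (X := ℝ)).continuousAt (x := (t, z))).eventually
          (notMem_tsupport_iff_eventuallyEq.1 hz')
        filter_upwards [this] with p hp
        rw [hp]; simp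
      exact (contDiffAt_const.congr_of_eventuallyEq h0).contDiffWithinAt
  · dsimp only
    rw [χ.zero_of_le_dist (by simpa using hz), zero_smul]
  · intro t _ x
    have h1 : χ (bumpEmbedding f x) = 1 := by
      refine χ.one_of_mem_closedBall (Metric.closedBall_subset_closedBall ?_ (hR (mem_range_self x)))
      show R ≤ |R| + 1
      linarith [le_abs_self R]
    dsimp only
    rw [h1, one_smul]
    have h2 : ∀ i, τ i (bumpEmbedding f x) • w i (t, bumpEmbedding f x) =
        τ i (bumpEmbedding f x) • embDeriv f x (X t x) := by
      intro i
      by_cases h0 : τ i (bumpEmbedding f x) = 0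
      · rw [h0, zero_smul, zero_smul]
      · rw [hwval i t x (hτ i (subset_tsupport _ h0))]
    rw [Finset.sum_congr rfl fun i _ => h2 i, ← Finset.sum_smul]
    have h3 := τ.sum_eq_one (mem_range_self x : bumpEmbedding f x ∈ _)
    rw [finsum_eq_sum_of_fintype] at h3
    rw [h3, one_smul]

end Embedding

/-! ### Flows on compact manifolds -/

section ManifoldFlow

open Set Filter Topology

variable {n : ℕ} {M : Type*} [TopologicalSpace M] [ChartedSpace (Euc n) M]
  [IsManifold (𝓡 n) ∞ M] {ι : Type*} [Fintype ι]
  (f : SmoothBumpCovering ι (𝓡 n) M) {X : ℝ → VField n M}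
  {v Φ : ℝ × EmbTarget ι n → EmbTarget ι n}

omit [IsManifold (𝓡 n) ∞ M] in
lemma hasDerivWithinAt_comp_of_mfderiv {F : Type*} [NormedAddCommGroup F] [NormedSpace ℝ F]
    {g : M → F} {u : ℝ → M} {s : Set ℝ} {t : ℝ} {g' : TangentSpace (𝓡 n) (u t) →L[ℝ] F}
    {L : ℝ →L[ℝ] TangentSpace (𝓡 n) (u t)}
    (hg : HasMFDerivAt (𝓡 n) 𝓘(ℝ, F) g (u t) g')
    (hu : HasMFDerivWithinAt 𝓘(ℝ, ℝ) (𝓡 n) u s t L) :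
    HasDerivWithinAt (fun t => g (u t)) (g' (L 1)) s t := by
  have h : HasFDerivWithinAt (fun t => g (u t)) (g'.comp L : ℝ →L[ℝ] F) s t :=
    hasMFDerivWithinAt_iff_hasFDerivWithinAt.1 (hg.comp_hasMFDerivWithinAt t hu)
  exact h.hasDerivWithinAt

omit [IsManifold (𝓡 n) ∞ M] in
lemma smulRight_one_apply {x : M} (V : TangentSpace (𝓡 n) x) :
    ((1 : ℝ →L[ℝ] ℝ).smulRight V) 1 = V := by
  change (1 : ℝ) • V = V
  exact one_smul _ _

omit [IsManifold (𝓡 n) ∞ M] in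
lemma clm_ext_one {x : M} {L L' : ℝ →L[ℝ] TangentSpace (𝓡 n) x} (h : L 1 = L' 1) : L = L' := by
  ext
  exact h

lemma IsFlowLine.embedding_eq [T2Space M] (hv : IsCompactField v) (hΦ : IsFlow v Φ)
    (hvX : ∀ t ∈ timeI, ∀ x, v (t, bumpEmbedding f x) = embDeriv f x (X t x))
    {u : ℝ → M} (hu : IsFlowLine X u) :
    ∀ t ∈ timeI, bumpEmbedding f (u t) = Φ (t, bumpEmbedding f (u 0)) := by
  refine hΦ.eqOn hv (f := fun t => bumpEmbedding f (u t)) fun t ht => ?_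
  have h := hasDerivWithinAt_comp_of_mfderiv (hasMFDerivAt_emb f (u t)) (hu t ht)
  rwa [smulRight_one_apply, ← hvX t ht] at h

/-- Solve the equation inside a chart with a cut-off field. While the solution stays where the
cutoff is 1, its image under the embedding solves the ambient equation, so by uniqueness it is the
ambient trajectory. -/
lemma exists_mem_range_after [T2Space M] (hv : IsCompactField v) (hΦ : IsFlow v Φ)
    (hX : SmoothField X)
    (hvX : ∀ t ∈ timeI, ∀ x, v (t, bumpEmbedding f x) = embDeriv f x (X t x))
    {z : EmbTarget ι n} {t₀ : ℝ} (ht₀ : t₀ ∈ Ico (0 : ℝ) 1) {p : M}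
    (hp : bumpEmbedding f p = Φ (t₀, z)) :
    ∃ δ > 0, t₀ + δ ≤ 1 ∧ ∀ t ∈ Icc t₀ (t₀ + δ), Φ (t, z) ∈ range (bumpEmbedding f) := by
  have ht₀' : t₀ ∈ timeI := ⟨ht₀.1, ht₀.2.le⟩
  set y₀ := extChartAt (𝓡 n) p p with hy₀
  obtain ⟨r, hr, hball⟩ := Metric.isOpen_iff.1 (isOpen_chart_target (n := n) p) y₀
    (mem_extChartAt_target p)
  let χ : ContDiffBump y₀ :=
    { rIn := r / 3, rOut := r / 2, rIn_pos := by positivity, rIn_lt_rOut := by linarith }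
  set w : ℝ × Euc n → Euc n := fun q => χ q.2 • fieldRep p X q with hw
  have hwf : IsCompactField w := by
    refine ⟨?_, ‖y₀‖ + r / 2, fun t ht y hy => ?_⟩
    · rintro ⟨t, y⟩ ⟨ht, -⟩
      by_cases hy : y ∈ Metric.ball y₀ r
      · have hnhds : timeI ×ˢ (extChartAt (𝓡 n) p).target ∈ 𝓝[timeI ×ˢ univ] (t, y) := by
          rw [nhdsWithin_prod_eq, nhdsWithin_univ]
          exact prod_mem_prod self_mem_nhdsWithin
            ((isOpen_chart_target p).mem_nhds (hball hy))
        have hχ : ContDiffWithinAt ℝ ∞ (fun q : ℝ × Euc n => χ q.2) (timeI ×ˢ univ) (t, y) :=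
          (χ.contDiff.comp contDiff_snd).contDiffAt.contDiffWithinAt
        exact hχ.smul (((hX p) (t, y) ⟨ht, hball hy⟩).mono_of_mem_nhdsWithin hnhds)
      · have h0 : w =ᶠ[𝓝 (t, y)] fun _ => 0 := by
          have hopen : IsOpen {q : ℝ × Euc n | r / 2 < dist q.2 y₀} :=
            isOpen_lt continuous_const (by fun_prop)
          have hmem : (t, y) ∈ {q : ℝ × Euc n | r / 2 < dist q.2 y₀} := by
            have : r ≤ dist y y₀ := not_lt.1 hy
            show r / 2 < dist y y₀
            linarith
          filter_upwards [hopen.mem_nhds hmem] with q hq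
          simp only [hw]
          rw [χ.zero_of_le_dist (le_of_lt hq), zero_smul]
        exact (contDiffAt_const.congr_of_eventuallyEq h0).contDiffWithinAt
    · simp only [hw]
      rw [χ.zero_of_le_dist, zero_smul]
      show r / 2 ≤ dist y y₀
      rw [dist_eq_norm]
      linarith [norm_sub_norm_le y y₀]
  obtain ⟨u, hu0, hu⟩ := hwf.exists_solution ht₀' y₀
  obtain ⟨δ, hδ, hδu⟩ : ∃ δ > 0, ∀ t ∈ timeI, dist t t₀ ≤ δ → u t ∈ Metric.ball y₀ (r / 3) := by
    have hc := (hu t₀ ht₀').continuousWithinAt.preimage_mem_nhdsWithin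
      (Metric.ball_mem_nhds (u t₀) (show 0 < r / 3 by positivity))
    rw [Metric.mem_nhdsWithin_iff] at hc
    obtain ⟨δ, hδ, h⟩ := hc
    refine ⟨δ / 2, by positivity, fun t ht htd => ?_⟩
    rw [← hu0]
    exact h ⟨by rw [Metric.mem_ball]; linarith, ht⟩
  set δ' := min δ (1 - t₀)
  have hδ' : 0 < δ' := lt_min hδ (by linarith [ht₀.2])
  have hle : t₀ + δ' ≤ 1 := by linarith [min_le_right δ (1 - t₀)]
  have hsub : ∀ t ∈ Icc t₀ (t₀ + δ'), t ∈ timeI := fun t ht => ⟨ht₀.1.trans ht.1, ht.2.trans hle⟩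
  have hut : ∀ t ∈ Icc t₀ (t₀ + δ'), u t ∈ Metric.ball y₀ (r / 3) := by
    intro t ht
    refine hδu t (hsub t ht) ?_
    rw [Real.dist_eq, abs_of_nonneg (by linarith [ht.1])]
    linarith [ht.2, min_le_left δ (1 - t₀)]
  have hut' : ∀ t ∈ Icc t₀ (t₀ + δ'), u t ∈ (extChartAt (𝓡 n) p).target := fun t ht =>
    hball (Metric.ball_subset_ball (by linarith) (hut t ht))
  have hder : ∀ t ∈ Ico t₀ (t₀ + δ'), HasDerivWithinAt (fun t => embRep f p (u t))
      (v (t, embRep f p (u t))) (Ici t) t := by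
    intro t ht
    have ht1 : t ∈ Icc t₀ (t₀ + δ') := ⟨ht.1, ht.2.le⟩
    have htI : t ∈ Ico (0 : ℝ) 1 := ⟨(hsub t ht1).1, ht.2.trans_le hle⟩
    have h1 := hasDerivWithinAt_Ici htI (hu t (hsub t ht1))
    have h2 := (hasFDerivAt_embRep f (hut' t ht1)).comp_hasDerivWithinAt t h1
    refine h2.congr_deriv ?_
    have h3 : χ (u t) = 1 := χ.one_of_mem_closedBall (Metric.ball_subset_closedBall (hut t ht1))
    simp only [hw, h3, one_smul]
    refine Eq.trans ?_ (hvX t (hsub t ht1) _).symm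
    exact congrArg (embDeriv f _) (chartSymmDeriv_fieldRep (hut' t ht1) X t)
  have hcont : ContinuousOn (fun t => embRep f p (u t)) (Icc t₀ (t₀ + δ')) :=
    (contDiffOn_embRep f p).continuousOn.comp
      (fun t ht => ((hu t (hsub t ht)).continuousWithinAt).mono hsub) hut'
  have heq := hv.eqOn_of_deriv ht₀.1 hle hcont ((hΦ.continuousOn_slice z).mono hsub) hder
    (fun t ht => hasDerivWithinAt_Ici ⟨ht₀.1.trans ht.1, ht.2.trans_le hle⟩
      (hΦ.deriv z t (hsub t ⟨ht.1, ht.2.le⟩)))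
    (by
      show bumpEmbedding f ((extChartAt (𝓡 n) p).symm (u t₀)) = _
      rw [hu0, ← hp, hy₀, extChartAt_to_inv])
  exact ⟨δ', hδ', hle, fun t ht => ⟨_, heq ht⟩⟩

/-- Continuous induction on [0,1]: the times spent in the embedded manifold form a closed set, since
the image is compact, and membership persists a little to the right. -/
lemma flow_mem_range [CompactSpace M] [T2Space M] (hv : IsCompactField v) (hΦ : IsFlow v Φ)
    (hX : SmoothField X)
    (hvX : ∀ t ∈ timeI, ∀ x, v (t, bumpEmbedding f x) = embDeriv f x (X t x)) (x : M) :
    ∀ t ∈ timeI, Φ (t, bumpEmbedding f x) ∈ range (bumpEmbedding f) := by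
  have hclosed : IsClosed ((fun t => Φ (t, bumpEmbedding f x)) ⁻¹' range (bumpEmbedding f) ∩
      Icc (0 : ℝ) 1) := by
    rw [inter_comm]
    exact (hΦ.continuousOn_slice _).preimage_isClosed_of_isClosed isClosed_Icc
      (isClosedEmbedding_emb f).isClosed_range
  refine hclosed.Icc_subset_of_forall_exists_gt ⟨x, (hΦ.init _).symm⟩ ?_
  rintro t ⟨⟨p, hp⟩, ht⟩ y hy
  obtain ⟨δ, hδ, hle, h⟩ := exists_mem_range_after f hv hΦ hX hvX ht hp
  have hy' : t < y := hy
  refine ⟨min (t + δ) y, h _ ⟨le_min (by linarith) hy'.le, min_le_left _ _⟩,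
    lt_min (by linarith) hy', min_le_right _ _⟩

/-- On a compact manifold, a smooth time-dependent vector field has a smooth flow on `[0,1]`. -/
lemma exists_flow_of_covering [CompactSpace M] [T2Space M] (f : SmoothBumpCovering ι (𝓡 n) M)
    (hX : SmoothField X) :
    (∃ φ : ℝ × M → M, ContMDiffOn (𝓘(ℝ, ℝ).prod (𝓡 n)) (𝓡 n) ∞ φ (timeI ×ˢ univ) ∧
      (∀ x, φ (0, x) = x) ∧ ∀ x, IsFlowLine X fun t => φ (t, x)) ∧
    ∀ u w : ℝ → M, IsFlowLine X u → IsFlowLine X w → u 0 = w 0 → ∀ t ∈ timeI, u t = w t := by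
  obtain ⟨v, hv, hvX⟩ := exists_extended_field f hX
  obtain ⟨Φ, hΦ⟩ := hv.exists_isFlow
  refine ⟨?_, fun u w hu hw h0 t ht => bumpEmbedding_injective f ?_⟩
  swap
  · rw [hu.embedding_eq f hv hΦ hvX t ht, hw.embedding_eq f hv hΦ hvX t ht, h0]
  have hrange := flow_mem_range f hv hΦ hX hvX
  choose ψ hψ using hrange
  classical
  set φ : ℝ × M → M := fun p => if h : p.1 ∈ timeI then ψ p.2 p.1 h else p.2 with hφ
  have hφe : ∀ p ∈ timeI ×ˢ (univ : Set M),
      bumpEmbedding f (φ p) = Φ (p.1, bumpEmbedding f p.2) := by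
    rintro ⟨t, x⟩ ⟨ht, -⟩
    have ht : t ∈ timeI := ht
    simp only [hφ, ht, dif_pos]
    exact hψ x t ht
  have hpair : ContMDiff (𝓘(ℝ, ℝ).prod (𝓡 n)) 𝓘(ℝ, ℝ × EmbTarget ι n) ∞
      (fun p : ℝ × M => (p.1, bumpEmbedding f p.2)) :=
    contMDiff_fst.prodMk_space ((contMDiff_bumpEmbedding f).comp contMDiff_snd)
  have hΦsm : ContMDiffOn (𝓘(ℝ, ℝ).prod (𝓡 n)) 𝓘(ℝ, EmbTarget ι n) ∞
      (fun p : ℝ × M => Φ (p.1, bumpEmbedding f p.2)) (timeI ×ˢ univ) :=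
    (contMDiffOn_iff_contDiffOn.2 (hΦ.contDiffOn hv)).comp hpair.contMDiffOn
      fun p hp => ⟨hp.1, mem_univ _⟩
  -- Continuity comes first: it keeps φ near a given point inside one `embDomain`, where φ is a
  -- chart inverse applied to a smooth function.
  have hφc : ContinuousOn φ (timeI ×ˢ univ) := by
    rw [(isClosedEmbedding_emb f).isInducing.continuousOn_iff]
    exact hΦsm.continuousOn.congr hφe
  have hφsm : ContMDiffOn (𝓘(ℝ, ℝ).prod (𝓡 n)) (𝓡 n) ∞ φ (timeI ×ˢ univ) := by
    intro p hp
    obtain ⟨i, hi⟩ : ∃ i, bumpEmbedding f (φ p) ∈ embDomain f i :=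
      ⟨_, embedding_mem_domain_ind f (φ p)⟩
    have hi' := hi
    rw [hφe p hp] at hi'
    have h1 : ContMDiffWithinAt (𝓘(ℝ, ℝ).prod (𝓡 n)) 𝓘(ℝ, Euc n) ∞
        (fun p : ℝ × M => embCoord i (Φ (p.1, bumpEmbedding f p.2))) (timeI ×ˢ univ) p :=
      ContMDiffAt.comp_contMDiffWithinAt (g := embCoord (n := n) i) p
        (contDiffAt_embCoord hi'.1).contMDiffAt (hΦsm p hp)
    have h2 : ContMDiffAt 𝓘(ℝ, Euc n) (𝓡 n) ∞ (extChartAt (𝓡 n) (f.c i)).symm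
        (embCoord i (Φ (p.1, bumpEmbedding f p.2))) :=
      (contMDiffOn_extChartAt_symm (f.c i)).contMDiffAt
        ((isOpen_chart_target (f.c i)).mem_nhds hi'.2)
    have hval : ∀ q ∈ timeI ×ˢ (univ : Set M), bumpEmbedding f (φ q) ∈ embDomain f i →
        φ q = (extChartAt (𝓡 n) (f.c i)).symm (embCoord i (Φ (q.1, bumpEmbedding f q.2))) := by
      intro q hq hqi
      rw [← hφe q hq, (embCoord_embedding f hqi).2,
        (extChartAt (𝓡 n) (f.c i)).left_inv (embCoord_embedding f hqi).1]
    refine (h2.comp_contMDiffWithinAt p h1).congr_of_eventuallyEq ?_ (hval p hp hi)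
    have hev := ((contMDiff_bumpEmbedding f).continuous.comp_continuousOn hφc p
      hp).preimage_mem_nhdsWithin ((isOpen_embDomain f i).mem_nhds hi)
    filter_upwards [hev, self_mem_nhdsWithin] with q hq hqS
    exact hval q hqS hq
  refine ⟨φ, hφsm, fun x => ?_, fun x t ht => ?_⟩
  · apply bumpEmbedding_injective f
    rw [hφe (0, x) ⟨by simp, mem_univ _⟩, hΦ.init]
  · have hline : ContMDiffOn 𝓘(ℝ, ℝ) (𝓡 n) ∞ (fun t => φ (t, x)) timeI :=
      hφsm.comp (contMDiffOn_id.prodMk contMDiffOn_const) fun t ht => ⟨ht, mem_univ _⟩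
    have h1 := ((hline t ht).mdifferentiableWithinAt (by simp)).hasMFDerivWithinAt
    set L := mfderivWithin 𝓘(ℝ, ℝ) (𝓡 n) (fun t => φ (t, x)) timeI t with hL
    have h2 := hasDerivWithinAt_comp_of_mfderiv (hasMFDerivAt_emb f (φ (t, x))) h1
    have h3 : HasDerivWithinAt (fun t => bumpEmbedding f (φ (t, x))) _ timeI t :=
      (hΦ.deriv (bumpEmbedding f x) t ht).congr
        (fun s hs => hφe (s, x) ⟨hs, mem_univ _⟩) (hφe (t, x) ⟨ht, mem_univ _⟩)
    have h4 := (uniqueDiffOn_timeI t ht).eq_deriv _ h2 h3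
    -- The velocity is identified after embedding; injectivity of the derivative of the embedding
    -- brings the equality back to M.
    have h5 : embDeriv f (φ (t, x)) (L 1) = embDeriv f (φ (t, x)) (X t (φ (t, x))) := by
      rw [← hvX t ht, hφe (t, x) ⟨ht, mem_univ _⟩]
      exact h4
    have h6 := embDeriv_injective f _ h5
    refine h1.congr_mfderiv (clm_ext_one ?_)
    rw [smulRight_one_apply]
    exact h6

/-- Two integral curves with the same starting point coincide. -/
lemma IsFlowLine.eq_of_init [CompactSpace M] [T2Space M] (hX : SmoothField X) {u w : ℝ → M}
    (hu : IsFlowLine X u)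
    (hw : IsFlowLine X w) (h0 : u 0 = w 0) {t : ℝ} (ht : t ∈ timeI) : u t = w t := by
  obtain ⟨ι, f, -⟩ := SmoothBumpCovering.exists_isSubordinate (𝓡 n) (M := M) isClosed_univ
    fun _ _ => univ_mem
  have := f.fintype
  exact (exists_flow_of_covering f hX).2 u w hu hw h0 t ht

lemma exists_flow [CompactSpace M] [T2Space M] (hX : SmoothField X) :
    ∃ φ : ℝ × M → M, ContMDiffOn (𝓘(ℝ, ℝ).prod (𝓡 n)) (𝓡 n) ∞ φ (timeI ×ˢ univ) ∧
      (∀ x, φ (0, x) = x) ∧ ∀ x, IsFlowLine X fun t => φ (t, x) := by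
  obtain ⟨ι, f, -⟩ := SmoothBumpCovering.exists_isSubordinate (𝓡 n) (M := M) isClosed_univ
    fun _ _ => univ_mem
  have := f.fintype
  exact (exists_flow_of_covering f hX).1

end ManifoldFlow

/-! ### Inverses of flow maps by time reversal -/

section Reparametrization

open Set Filter Topology

variable {n : ℕ} {M : Type*} [TopologicalSpace M] [ChartedSpace (Euc n) M]
  [IsManifold (𝓡 n) ∞ M] {X : ℝ → VField n M}

/-- The time-dependent field obtained by the change of time `s ↦ a + b * s`. -/
def affineField (a b : ℝ) (X : ℝ → VField n M) : ℝ → VField n M :=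
  fun s x => b • X (a + b * s) x

omit [IsManifold (𝓡 n) ∞ M] in
lemma SmoothField.affineField (hX : SmoothField X) {a b : ℝ}
    (hab : ∀ s ∈ timeI, a + b * s ∈ timeI) : SmoothField (affineField a b X) := by
  intro c
  have h1 : ContDiff ℝ ∞ (fun p : ℝ × Euc n => (a + b * p.1, p.2)) := by fun_prop
  have h2 : ContDiffOn ℝ ∞ (fun p : ℝ × Euc n => b • fieldRep c X (a + b * p.1, p.2))
      (timeI ×ˢ (extChartAt (𝓡 n) c).target) :=
    ContDiffOn.const_smul b ((hX c).comp h1.contDiffOn fun (p : ℝ × Euc n)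
      (hp : p ∈ timeI ×ˢ (extChartAt (𝓡 n) c).target) => ⟨hab _ hp.1, hp.2⟩)
  refine h2.congr fun p _ => ?_
  exact map_smul (chartDeriv c ((extChartAt (𝓡 n) c).symm p.2)) b _

omit [IsManifold (𝓡 n) ∞ M] in
lemma IsFlowLine.affine {u : ℝ → M} (hu : IsFlowLine X u) {a b : ℝ}
    (hab : ∀ s ∈ timeI, a + b * s ∈ timeI) :
    IsFlowLine (affineField a b X) fun s => u (a + b * s) := by
  intro s hs
  have h1 : HasDerivWithinAt (fun s : ℝ => a + b * s) b timeI s := by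
    simpa using (((hasDerivAt_id s).const_mul b).const_add a).hasDerivWithinAt
  have h2 : HasMFDerivWithinAt 𝓘(ℝ, ℝ) 𝓘(ℝ, ℝ) (fun s : ℝ => a + b * s) timeI s
      ((1 : ℝ →L[ℝ] ℝ).smulRight b) := by
    exact hasMFDerivWithinAt_iff_hasFDerivWithinAt.2 h1.hasFDerivWithinAt
  refine ((hu _ (hab s hs)).comp s h2 (u := timeI) (fun s hs => hab s hs)).congr_mfderiv (clm_ext_one ?_)
  rw [smulRight_one_apply]
  change ((1 : ℝ →L[ℝ] ℝ) (((1 : ℝ →L[ℝ] ℝ).smulRight b) 1)) • X (a + b * s) _ = b • _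
  simp

/-- The maps of a flow are bijective, with smooth inverses. -/
lemma exists_flow_inverse [T2Space M] [CompactSpace M] (hX : SmoothField X) {φ : ℝ × M → M}
    (h0 : ∀ x, φ (0, x) = x) (hφ : ∀ x, IsFlowLine X fun t => φ (t, x)) {T : ℝ} (hT : T ∈ timeI) :
    ∃ ψ : M → M, ContMDiff (𝓡 n) (𝓡 n) ∞ ψ ∧ (∀ x, ψ (φ (T, x)) = x) ∧ ∀ x, φ (T, ψ x) = x := by
  have hT0 : (0 : ℝ) ≤ T := hT.1
  have hT1 : T ≤ 1 := hT.2
  have hb : ∀ s ∈ timeI, T + -T * s ∈ timeI := fun s hs =>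
    ⟨by nlinarith [hs.1, hs.2], by nlinarith [hs.1, hs.2]⟩
  have hf : ∀ s ∈ timeI, 0 + T * s ∈ timeI := fun s hs =>
    ⟨by nlinarith [hs.1, hs.2], by nlinarith [hs.1, hs.2]⟩
  have hr : ∀ s ∈ timeI, (1 : ℝ) + -1 * s ∈ timeI := fun s hs =>
    ⟨by nlinarith [hs.1, hs.2], by nlinarith [hs.1, hs.2]⟩
  have h1 : (1 : ℝ) ∈ timeI := by simp
  -- φ' is the flow of s ↦ -T X(T - Ts), which runs the trajectories of X from time T back to time 0
  -- in unit time.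
  obtain ⟨φ', hφ's, hφ'0, hφ'⟩ := exists_flow (hX.affineField hb)
  refine ⟨fun x => φ' (1, x), ?_, fun x => ?_, fun y => ?_⟩
  · rw [← contMDiffOn_univ]
    exact hφ's.comp (contMDiffOn_const.prodMk contMDiffOn_id) fun x hx => ⟨h1, hx⟩
  · have h := (hφ' (φ (T, x))).eq_of_init (hX.affineField hb) ((hφ x).affine hb)
      (by simp [hφ'0]) h1
    simpa [h0] using h
  -- Reversing the reversed curve s ↦ φ'(s, y) gives an integral curve of s ↦ T X(Ts) from φ'(1, y)
  -- to y; it must agree with the rescaled original trajectory.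
  · have e : affineField 1 (-1) (affineField T (-T) X) = affineField 0 T X := by
      funext s x
      simp only [affineField, smul_smul]
      congr 2
      · ring
      · ring
    have h2 := (hφ' y).affine hr
    rw [e] at h2
    have h := ((hφ (φ' (1, y))).affine hf).eq_of_init (hX.affineField hf) h2
      (by simp [h0]) h1
    simpa [hφ'0] using h

/-- On a compact manifold, a smooth time-dependent vector field generates an isotopy. -/
lemma exists_isotopy [T2Space M] [CompactSpace M] (hX : SmoothField X) :
    ∃ φ : ℝ → M ≃ₘ⟮𝓡 n, 𝓡 n⟯ M, IsIsotopy φ ∧ ∀ x, IsFlowLine X fun t => φ t x := by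
  obtain ⟨φ, hs, h0, hφ⟩ := exists_flow hX
  choose ψ hψs hψl hψr using fun (T : ℝ) (hT : T ∈ timeI) => exists_flow_inverse hX h0 hφ hT
  classical
  let Φ : ℝ → M ≃ₘ⟮𝓡 n, 𝓡 n⟯ M := fun T =>
    if hT : T ∈ timeI then
      { toFun := fun x => φ (T, x)
        invFun := ψ T hT
        left_inv := hψl T hT
        right_inv := hψr T hT
        contMDiff_toFun := by
          change ContMDiff _ _ _ (fun x => φ (T, x))
          rw [← contMDiffOn_univ]
          exact hs.comp (contMDiffOn_const.prodMk contMDiffOn_id) fun x hx => ⟨hT, hx⟩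
        contMDiff_invFun := hψs T hT }
    else Diffeomorph.refl (𝓡 n) M ∞
  have hΦ : ∀ T ∈ timeI, ∀ x, Φ T x = φ (T, x) := by
    intro T hT x
    simp only [Φ, hT, dif_pos]
    rfl
  refine ⟨Φ, ⟨hs.congr fun p hp => hΦ p.1 hp.1 p.2, fun x => ?_⟩, fun x t ht => ?_⟩
  · rw [hΦ 0 (by simp), h0]
  · have h := (hφ x t ht).congr_mono (fun s hs => hΦ s hs x) (hΦ t ht x) subset_rfl
    have e : ∀ z : M, φ (t, x) = z → ((1 : ℝ →L[ℝ] ℝ).smulRight (X t (φ (t, x)) : Euc n)) =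
        (1 : ℝ →L[ℝ] ℝ).smulRight (X t z : Euc n) := by
      rintro z rfl
      rfl
    exact h.congr_mfderiv (e _ (hΦ t ht x).symm)

end Reparametrization

/-! ### Cartan's formula and pullback by a flow on a normed space -/

section FlatForms

open Set Filter Topology

variable {E : Type*} [NormedAddCommGroup E] [NormedSpace ℝ E] {k : ℕ}

lemma extDeriv_apply_fderiv (f : E → E [⋀^Fin k]→L[ℝ] ℝ) (z : E) (W : Fin (k + 1) → E) :
    extDeriv f z W = ∑ i, (-1) ^ i.val • fderiv ℝ f z (W i) (i.removeNth W) := by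
  rw [extDeriv, ContinuousAlternatingMap.alternatizeUncurryFin_apply]

lemma map_update_eq_vecCons (f : E [⋀^Fin (k + 1)]→L[ℝ] ℝ) (W : Fin (k + 1) → E)
    (i : Fin (k + 1)) (u : E) :
    f (Function.update W i u) = (-1) ^ i.val • f (Matrix.vecCons u (i.removeNth W)) := by
  have h := f.toAlternatingMap.map_insertNth i u (i.removeNth W)
  rwa [Fin.insertNth_removeNth] at h

variable (E k) in
/-- The contraction of a form with a vector, as a continuous linear map. -/
def contraction : (E [⋀^Fin (k + 1)]→L[ℝ] ℝ) →L[ℝ] E →L[ℝ] E [⋀^Fin k]→L[ℝ] ℝ :=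
  ContinuousAlternatingMap.curryLeftLI.toContinuousLinearMap

/-- Cartan's formula, for a differential form on a normed space. -/
lemma cartan_formula {f : E → E [⋀^Fin (k + 1)]→L[ℝ] ℝ} {v : E → E} {z : E}
    (hf : DifferentiableAt ℝ f z) (hv : DifferentiableAt ℝ v z) (W : Fin (k + 1) → E) :
    fderiv ℝ f z (v z) W + ∑ i, f z (Function.update W i (fderiv ℝ v z (W i))) =
      extDeriv (fun z => (f z).curryLeft (v z)) z W +
        extDeriv f z (Matrix.vecCons (v z) W) := by
  have hβ : ∀ w, fderiv ℝ (fun z => (f z).curryLeft (v z)) z w =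
      (f z).curryLeft (fderiv ℝ v z w) + (fderiv ℝ f z w).curryLeft (v z) := by
    intro w
    have h := (contraction E k).hasFDerivAt_of_bilinear hf.hasFDerivAt hv.hasFDerivAt
    exact (DFunLike.congr_fun h.fderiv w).trans rfl
  -- In i_v df the zeroth term is the derivative of f along v. The others cancel against the part of
  -- d(i_v f) that differentiates f, leaving only the part that differentiates v.
  have h0 : extDeriv f z (Matrix.vecCons (v z) W) = fderiv ℝ f z (v z) W -
      ∑ i : Fin (k + 1), (-1) ^ i.val • fderiv ℝ f z (W i) (Matrix.vecCons (v z) (i.removeNth W)) := by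
    rw [extDeriv_apply_fderiv, Fin.sum_univ_succ, sub_eq_add_neg, ← Finset.sum_neg_distrib]
    congr 1
    · simp [Matrix.vecCons]
    · refine Finset.sum_congr rfl fun i _ => ?_
      rw [Fin.val_succ, pow_succ, mul_neg_one, neg_smul]
      congr 2
      · congr 1
        ext j
        refine Fin.cases ?_ (fun j => ?_) j <;> simp [Matrix.vecCons, Fin.removeNth]
  rw [h0, extDeriv_apply_fderiv]
  simp only [hβ, ContinuousAlternatingMap.add_apply, ContinuousAlternatingMap.curryLeft_apply_apply,
    smul_add, Finset.sum_add_distrib, map_update_eq_vecCons]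
  ring

/-- The derivative in time of the pullback of a family of forms under a family of maps. -/
lemma hasDerivWithinAt_pullback_flat {θ : ℝ × E → E [⋀^Fin k]→L[ℝ] ℝ} {c : ℝ × E → E} {p : ℝ × E}
    (hp : p ∈ strip E) (hc : SmoothAt c p) (hθ : SmoothAt θ (p.1, c p)) (w : Fin k → E) :
    HasDerivWithinAt (fun t => θ (t, c (t, p.2)) fun i => dx c (t, p.2) (w i))
      (dt θ (p.1, c p) (fun i => dx c p (w i)) +
        dx θ (p.1, c p) (dt c p) (fun i => dx c p (w i)) +
        ∑ i, θ (p.1, c p) (Function.update (fun i => dx c p (w i)) i (dx (dt c) p (w i))))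
      timeI p.1 := by
  have hP : (p.1, c p) ∈ strip E := ⟨hp.1, mem_univ _⟩
  have h1 : HasDerivWithinAt (fun t => (t, c (t, p.2))) ((1 : ℝ), dt c p) timeI p.1 :=
    (hasDerivWithinAt_id _ _).prodMk (hasDerivWithinAt_dt hc.differentiableWithinAt)
  have h2 : HasDerivWithinAt (fun t => θ (t, c (t, p.2)))
      (dt θ (p.1, c p) + dx θ (p.1, c p) (dt c p)) timeI p.1 := by
    have := HasFDerivWithinAt.comp_hasDerivWithinAt (l := θ) (t := strip E) p.1
      (hθ.differentiableWithinAt.hasFDerivWithinAt) h1 (fun s hs => ⟨hs, mem_univ _⟩)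
    refine this.congr_deriv ?_
    rw [fderivWithin_strip_apply hθ.differentiableWithinAt hP, one_smul]
  have h3 : ∀ i, HasDerivWithinAt (fun t => dx c (t, p.2) (w i)) (dx (dt c) p (w i)) timeI p.1 :=
    fun i => (ContinuousLinearMap.apply ℝ E (w i)).hasFDerivAt.comp_hasDerivWithinAt p.1
      (hc.hasDerivWithinAt_dx hp)
  have h4 := (HasFDerivWithinAt.continuousAlternatingMap_apply h2.hasFDerivWithinAt
    (fun i => (h3 i).hasFDerivWithinAt)).hasDerivWithinAt
  refine h4.congr_deriv ?_
  simp

/-- The derivative in time of the pullback of a family of forms under a flow. -/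
lemma hasDerivWithinAt_pullback_flow {θ : ℝ × E → E [⋀^Fin (k + 1)]→L[ℝ] ℝ} {c v : ℝ × E → E}
    {p : ℝ × E} (hp : p ∈ strip E) (hc : SmoothAt c p) (hθ : SmoothAt θ (p.1, c p))
    (hv : SmoothAt v (p.1, c p))
    (hcv : ∀ᶠ y in 𝓝 p.2, dt c (p.1, y) = v (p.1, c (p.1, y))) (w : Fin (k + 1) → E) :
    HasDerivWithinAt (fun t => θ (t, c (t, p.2)) fun i => dx c (t, p.2) (w i))
      (dt θ (p.1, c p) (fun i => dx c p (w i)) +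
        (extDeriv (fun z => (θ (p.1, z)).curryLeft (v (p.1, z))) (c p) (fun i => dx c p (w i)) +
        extDeriv (fun z => θ (p.1, z)) (c p)
          (Matrix.vecCons (v (p.1, c p)) fun i => dx c p (w i)))) timeI p.1 := by
  have hP : (p.1, c p) ∈ strip E := ⟨hp.1, mem_univ _⟩
  refine (hasDerivWithinAt_pullback_flat hp hc hθ w).congr_deriv ?_
  have hθ' := hasFDerivAt_dx hθ.differentiableWithinAt hP
  have hv' := hasFDerivAt_dx hv.differentiableWithinAt hP
  have hc' := hasFDerivAt_dx hc.differentiableWithinAt hp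
  rw [← cartan_formula hθ'.differentiableAt hv'.differentiableAt, hθ'.fderiv, hv'.fderiv]
  -- Differentiating the flow equation in space turns the mixed derivative of c into dv ∘ dc, the
  -- term required by Cartan's formula.
  have h1 : dx (dt c) p = (dx v (p.1, c p)).comp (dx c p) := by
    have : HasFDerivAt (fun y => v (p.1, c (p.1, y))) ((dx v (p.1, c p)).comp (dx c p)) p.2 :=
      HasFDerivAt.comp (g := fun z => v (p.1, z)) p.2 hv' hc'
    exact (this.congr_of_eventuallyEq hcv).fderiv
  have h2 : dt c p = v (p.1, c p) := hcv.self_of_nhds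
  rw [h1, h2, add_assoc]
  rfl

end FlatForms

/-! ### The derivative of a pullback on the manifold -/

section ChartCalculus

open Set Filter Topology

variable {n : ℕ} {M : Type*} [TopologicalSpace M] [ChartedSpace (Euc n) M]
  [IsManifold (𝓡 n) ∞ M] {k : ℕ} {X : ℝ → VField n M} {φ : ℝ → M → M} {a b c x : M}
  {y : Euc n} {t : ℝ}

lemma apply_eq_chartRep (hx : x ∈ (extChartAt (𝓡 n) c).source) (θ : DForm n M k)
    (V : Fin k → TangentSpace (𝓡 n) x) :
    θ x V = chartRep c θ (extChartAt (𝓡 n) c x) (fun i => chartDeriv c x (V i)) := by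
  obtain ⟨y, hy, rfl⟩ := exists_chart_symm_eq hx
  rw [(extChartAt (𝓡 n) c).right_inv hy, chartRep_apply]
  congr 1
  funext i
  exact (chartSymmDeriv_chartDeriv hy (V i)).symm

omit [IsManifold (𝓡 n) ∞ M] in
lemma fieldRep_chart (hx : x ∈ (extChartAt (𝓡 n) c).source) :
    fieldRep c X (t, extChartAt (𝓡 n) c x) = chartDeriv c x (X t x) := by
  obtain ⟨y, hy, rfl⟩ := exists_chart_symm_eq hx
  rw [(extChartAt (𝓡 n) c).right_inv hy]
  rfl

omit [IsManifold (𝓡 n) ∞ M] in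
lemma SmoothFamily.smoothAt {θ : ℝ → DForm n M k} (hθ : SmoothFamily θ) (ht : t ∈ timeI)
    (hy : y ∈ (extChartAt (𝓡 n) c).target) :
    SmoothAt (fun p : ℝ × Euc n => chartRep c (θ p.1) p.2) (t, y) :=
  (contDiffOn_iff_smoothAt (isOpen_chart_target c)).1 (hθ c) (t, y) ⟨ht, hy⟩

omit [IsManifold (𝓡 n) ∞ M] in
lemma SmoothField.smoothAt (hX : SmoothField X) (ht : t ∈ timeI)
    (hy : y ∈ (extChartAt (𝓡 n) c).target) : SmoothAt (fieldRep c X) (t, y) :=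
  (contDiffOn_iff_smoothAt (isOpen_chart_target c)).1 (hX c) (t, y) ⟨ht, hy⟩

omit [IsManifold (𝓡 n) ∞ M] in
lemma extD_apply (θ : DForm n M k) (x : M) (V : Fin (k + 1) → TangentSpace (𝓡 n) x) :
    extD θ x V = extDeriv (chartRep x θ) (extChartAt (𝓡 n) x x) (fun i => chartDeriv x x (V i)) :=
  rfl

omit [IsManifold (𝓡 n) ∞ M] in
lemma interiorProd_apply (Y : VField n M) (θ : DForm n M (k + 1)) (x : M)
    (V : Fin k → TangentSpace (𝓡 n) x) :
    interiorProd Y θ x V = θ x (Matrix.vecCons (Y x) V) := rfl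

lemma chartRep_interiorProd (Y : VField n M) (θ : DForm n M (k + 1))
    (hy : y ∈ (extChartAt (𝓡 n) c).target) :
    chartRep c (interiorProd Y θ) y = (chartRep c θ y).curryLeft
      (chartDeriv c ((extChartAt (𝓡 n) c).symm y) (Y ((extChartAt (𝓡 n) c).symm y))) := by
  ext W
  rw [ContinuousAlternatingMap.curryLeft_apply_apply, chartRep_apply, chartRep_apply,
    interiorProd_apply]
  congr 1
  funext i
  refine Fin.cases ?_ (fun j => rfl) i
  exact (chartSymmDeriv_chartDeriv hy _).symm

/-- The smooth family of maps `φ t`, `t ∈ [0,1]`. -/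
abbrev SmoothMaps (n : ℕ) {M : Type*} [TopologicalSpace M] [ChartedSpace (Euc n) M]
    (φ : ℝ → M → M) : Prop :=
  ContMDiffOn (𝓘(ℝ, ℝ).prod (𝓡 n)) (𝓡 n) ∞ (fun p : ℝ × M => φ p.1 p.2) (timeI ×ˢ univ)

/-- The expression of a family of maps in the preferred charts around `a` and `b`. -/
def localRep (n : ℕ) {M : Type*} [TopologicalSpace M] [ChartedSpace (Euc n) M] (φ : ℝ → M → M)
    (a b : M) (p : ℝ × Euc n) : Euc n :=
  extChartAt (𝓡 n) b (φ p.1 ((extChartAt (𝓡 n) a).symm p.2))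

omit [IsManifold (𝓡 n) ∞ M] in
lemma SmoothMaps.contMDiff (hφ : SmoothMaps n φ) (ht : t ∈ timeI) :
    ContMDiff (𝓡 n) (𝓡 n) ∞ (φ t) := by
  rw [← contMDiffOn_univ]
  exact ContMDiffOn.comp (g := fun p : ℝ × M => φ p.1 p.2) (f := fun x => (t, x)) hφ
    (contMDiffOn_const.prodMk contMDiffOn_id) fun x hx => ⟨ht, hx⟩

omit [IsManifold (𝓡 n) ∞ M] in
lemma SmoothMaps.hasMFDerivAt (hφ : SmoothMaps n φ) (ht : t ∈ timeI) (x : M) :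
    HasMFDerivAt (𝓡 n) (𝓡 n) (φ t) x (mfderiv (𝓡 n) (𝓡 n) (φ t) x) :=
  ((hφ.contMDiff ht x).mdifferentiableAt (by simp)).hasMFDerivAt

lemma SmoothMaps.contMDiffWithinAt_symm (hφ : SmoothMaps n φ) (ht : t ∈ timeI)
    (hy : y ∈ (extChartAt (𝓡 n) a).target) :
    ContMDiffWithinAt 𝓘(ℝ, ℝ × Euc n) (𝓡 n) ∞
      (fun p : ℝ × Euc n => φ p.1 ((extChartAt (𝓡 n) a).symm p.2)) (strip (Euc n)) (t, y) := by
  have h1 : ContMDiffAt 𝓘(ℝ, Euc n) (𝓡 n) ∞ (extChartAt (𝓡 n) a).symm y :=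
    (contMDiffOn_extChartAt_symm a).contMDiffAt ((isOpen_chart_target a).mem_nhds hy)
  have h2 : ContMDiffAt 𝓘(ℝ, ℝ × Euc n) 𝓘(ℝ, Euc n) ∞ (Prod.snd : ℝ × Euc n → Euc n) (t, y) :=
    contDiff_snd.contMDiff _
  have h3 : ContMDiffAt 𝓘(ℝ, ℝ × Euc n) 𝓘(ℝ, ℝ) ∞ (Prod.fst : ℝ × Euc n → ℝ) (t, y) :=
    contDiff_fst.contMDiff _
  have h4 : ContMDiffAt 𝓘(ℝ, ℝ × Euc n) (𝓘(ℝ, ℝ).prod (𝓡 n)) ∞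
      (fun p : ℝ × Euc n => (p.1, (extChartAt (𝓡 n) a).symm p.2)) (t, y) :=
    h3.prodMk (ContMDiffAt.comp (g := (extChartAt (𝓡 n) a).symm) (t, y) h1 h2)
  exact ContMDiffWithinAt.comp (g := fun p : ℝ × M => φ p.1 p.2) (t, y)
    (t := timeI ×ˢ univ) (hφ (t, (extChartAt (𝓡 n) a).symm y) ⟨ht, mem_univ _⟩)
    h4.contMDiffWithinAt fun p hp => ⟨hp.1, mem_univ _⟩

lemma SmoothMaps.eventually_mem_source (hφ : SmoothMaps n φ) (ht : t ∈ timeI)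
    (hy : y ∈ (extChartAt (𝓡 n) a).target)
    (hb : φ t ((extChartAt (𝓡 n) a).symm y) ∈ (extChartAt (𝓡 n) b).source) :
    ∀ᶠ p in 𝓝[strip (Euc n)] (t, y), p.2 ∈ (extChartAt (𝓡 n) a).target ∧
      φ p.1 ((extChartAt (𝓡 n) a).symm p.2) ∈ (extChartAt (𝓡 n) b).source := by
  refine Eventually.and ?_ ?_
  · have : ∀ᶠ p in 𝓝 (t, y), p.2 ∈ (extChartAt (𝓡 n) a).target :=
      continuousAt_snd.eventually_mem ((isOpen_chart_target a).mem_nhds hy)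
    exact this.filter_mono nhdsWithin_le_nhds
  · exact (hφ.contMDiffWithinAt_symm ht hy).continuousWithinAt.eventually_mem
      ((isOpen_extChartAt_source b).mem_nhds hb)

lemma SmoothMaps.smoothAt_localRep (hφ : SmoothMaps n φ) (ht : t ∈ timeI)
    (hy : y ∈ (extChartAt (𝓡 n) a).target)
    (hb : φ t ((extChartAt (𝓡 n) a).symm y) ∈ (extChartAt (𝓡 n) b).source) :
    SmoothAt (localRep n φ a b) (t, y) := by
  rw [SmoothAt, ← contMDiffWithinAt_iff_contDiffWithinAt]
  exact ContMDiffAt.comp_contMDiffWithinAt (g := extChartAt (𝓡 n) b) (t, y)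
    (contMDiffAt_extChartAt' (by simpa using hb)) (hφ.contMDiffWithinAt_symm ht hy)

lemma SmoothMaps.dx_localRep (hφ : SmoothMaps n φ) (ht : t ∈ timeI)
    (hy : y ∈ (extChartAt (𝓡 n) a).target)
    (hb : φ t ((extChartAt (𝓡 n) a).symm y) ∈ (extChartAt (𝓡 n) b).source) (w : Euc n) :
    dx (localRep n φ a b) (t, y) w = chartDeriv b (φ t ((extChartAt (𝓡 n) a).symm y))
      (mfderiv (𝓡 n) (𝓡 n) (φ t) ((extChartAt (𝓡 n) a).symm y) (chartSymmDeriv a y w)) := by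
  have h1 := (hφ.hasMFDerivAt ht ((extChartAt (𝓡 n) a).symm y)).comp y (hasMFDerivAt_chart_symm hy)
  have h2 : HasFDerivAt (fun z => localRep n φ a b (t, z))
      ((chartDeriv b (φ t ((extChartAt (𝓡 n) a).symm y))).comp
        ((mfderiv (𝓡 n) (𝓡 n) (φ t) ((extChartAt (𝓡 n) a).symm y)).comp
          (chartSymmDeriv a y)) : Euc n →L[ℝ] Euc n) y :=
    hasMFDerivAt_iff_hasFDerivAt.1 ((hasMFDerivAt_chart hb).comp y h1)
  exact DFunLike.congr_fun h2.fderiv w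

lemma dt_localRep (hX : ∀ x, IsFlowLine X fun t => φ t x) (ht : t ∈ timeI)
    (hb : φ t ((extChartAt (𝓡 n) a).symm y) ∈ (extChartAt (𝓡 n) b).source) :
    dt (localRep n φ a b) (t, y) = fieldRep b X (t, localRep n φ a b (t, y)) := by
  have h2 := hasDerivWithinAt_comp_of_mfderiv (hasMFDerivAt_chart hb) (hX _ t ht)
  refine (h2.derivWithin (uniqueDiffOn_timeI t ht)).trans ?_
  rw [localRep, fieldRep_chart hb, smulRight_one_apply]

lemma SmoothMaps.pullback_eq (hφ : SmoothMaps n φ) (ht : t ∈ timeI)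
    (hy : y ∈ (extChartAt (𝓡 n) a).target)
    (hb : φ t ((extChartAt (𝓡 n) a).symm y) ∈ (extChartAt (𝓡 n) b).source) (θ : DForm n M k)
    (W : Fin k → TangentSpace (𝓡 n) ((extChartAt (𝓡 n) a).symm y)) :
    pullback (φ t) θ ((extChartAt (𝓡 n) a).symm y) W =
      chartRep b θ (localRep n φ a b (t, y)) fun i => dx (localRep n φ a b) (t, y)
        (chartDeriv a ((extChartAt (𝓡 n) a).symm y) (W i)) := by
  refine (apply_eq_chartRep hb θ _).trans (congrArg (chartRep b θ (localRep n φ a b (t, y))) ?_)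
  funext i
  rw [hφ.dx_localRep ht hy hb, chartSymmDeriv_chartDeriv hy]
  rfl

lemma SmoothFamily.hasDerivWithinAt {θ : ℝ → DForm n M k} (hθ : SmoothFamily θ) (ht : t ∈ timeI)
    (hx : x ∈ (extChartAt (𝓡 n) c).source) (V : Fin k → TangentSpace (𝓡 n) x) :
    HasDerivWithinAt (fun s => θ s x V)
      (dt (fun p : ℝ × Euc n => chartRep c (θ p.1) p.2) (t, extChartAt (𝓡 n) c x)
        (fun i => chartDeriv c x (V i))) timeI t := by
  have h := hasDerivWithinAt_dt
    (hθ.smoothAt ht ((extChartAt (𝓡 n) c).map_source hx)).differentiableWithinAt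
  have h2 := HasFDerivWithinAt.continuousAlternatingMap_apply_const h.hasFDerivWithinAt
    (fun i => chartDeriv c x (V i))
  refine (h2.hasDerivWithinAt.congr_deriv ?_).congr_of_eventuallyEq
    (Eventually.of_forall fun s => apply_eq_chartRep hx (θ s) V) (apply_eq_chartRep hx (θ t) V)
  simp

lemma lieD_apply_chart {θ : DForm n M (k + 1)} (Y : ℝ → VField n M)
    (V : Fin (k + 1) → TangentSpace (𝓡 n) x) :
    lieD (Y t) θ x V =
      extDeriv (fun z => (chartRep x θ z).curryLeft (fieldRep x Y (t, z))) (extChartAt (𝓡 n) x x)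
        (fun i => chartDeriv x x (V i)) +
      extDeriv (chartRep x θ) (extChartAt (𝓡 n) x x)
        (Matrix.vecCons (fieldRep x Y (t, extChartAt (𝓡 n) x x)) fun i => chartDeriv x x (V i)) := by
  rw [lieD, ContinuousAlternatingMap.add_apply, extD_apply, interiorProd_apply, extD_apply]
  congr 1
  · have : chartRep x (interiorProd (Y t) θ) =ᶠ[𝓝 (extChartAt (𝓡 n) x x)]
        fun z => (chartRep x θ z).curryLeft (fieldRep x Y (t, z)) := by
      filter_upwards [(isOpen_chart_target x).mem_nhds (mem_extChartAt_target x)] with z hz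
      exact chartRep_interiorProd _ _ hz
    rw [this.extDeriv_eq]
  · congr 1
    rw [fieldRep_chart (mem_extChartAt_source x)]
    funext i
    exact Fin.cases rfl (fun j => rfl) i

/-- The derivative of the pullback of a family of forms under a flow. -/
theorem hasDerivWithinAt_pullback {θ : ℝ → DForm n M (k + 1)} (hθ : SmoothFamily θ)
    (hX : SmoothField X) (hφ : SmoothMaps n φ) (hφX : ∀ x, IsFlowLine X fun t => φ t x)
    (ht : t ∈ timeI) (x : M) (W : Fin (k + 1) → TangentSpace (𝓡 n) x) {θ' : ℝ}
    (hθ' : HasDerivWithinAt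
      (fun s => θ s (φ t x) fun i => mfderiv (𝓡 n) (𝓡 n) (φ t) x (W i)) θ' timeI t) :
    HasDerivWithinAt (fun s => pullback (φ s) (θ s) x W)
      (θ' + lieD (X t) (θ t) (φ t x) fun i => mfderiv (𝓡 n) (𝓡 n) (φ t) x (W i)) timeI t := by
  obtain ⟨a, ha⟩ : ∃ a : M, x ∈ (extChartAt (𝓡 n) a).source := ⟨x, mem_extChartAt_source x⟩
  obtain ⟨y, hy, rfl⟩ := exists_chart_symm_eq ha
  -- The target chart is the preferred chart at φ t x itself, since that is the chart defining the
  -- exterior derivative there.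
  set b := φ t ((extChartAt (𝓡 n) a).symm y) with hb
  have hbs : b ∈ (extChartAt (𝓡 n) b).source := mem_extChartAt_source b
  have hp : (t, y) ∈ strip (Euc n) := ⟨ht, mem_univ _⟩
  set w : Fin (k + 1) → Euc n := fun i => chartDeriv a ((extChartAt (𝓡 n) a).symm y) (W i) with hw
  have hval : localRep n φ a b (t, y) = extChartAt (𝓡 n) b b := rfl
  have hbt : extChartAt (𝓡 n) b b ∈ (extChartAt (𝓡 n) b).target := mem_extChartAt_target b
  have hc := hφ.smoothAt_localRep ht hy hbs
  have hev := hφ.eventually_mem_source ht hy hbs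
  have hcv : ∀ᶠ z in 𝓝 y, dt (localRep n φ a b) (t, z) =
      fieldRep b X (t, localRep n φ a b (t, z)) := by
    have h1 : Tendsto (fun z => (t, z)) (𝓝 y) (𝓝[strip (Euc n)] (t, y)) :=
      tendsto_nhdsWithin_iff.2 ⟨(Continuous.prodMk_right t).tendsto y, Eventually.of_forall
        fun z => ⟨ht, mem_univ _⟩⟩
    filter_upwards [h1.eventually hev] with z hz
    exact dt_localRep hφX ht hz.2
  have main := hasDerivWithinAt_pullback_flow hp hc (hθ.smoothAt ht hbt) (hX.smoothAt ht hbt) hcv w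
  have hevt : (fun s => pullback (φ s) (θ s) ((extChartAt (𝓡 n) a).symm y) W) =ᶠ[𝓝[timeI] t]
      fun s => chartRep b (θ s) (localRep n φ a b (s, y))
        fun i => dx (localRep n φ a b) (s, y) (w i) := by
    have h1 : Tendsto (fun s => (s, y)) (𝓝[timeI] t) (𝓝[strip (Euc n)] (t, y)) := by
      refine tendsto_nhdsWithin_iff.2 ⟨?_, ?_⟩
      · exact ((Continuous.prodMk_left y).tendsto t).mono_left nhdsWithin_le_nhds
      · filter_upwards [self_mem_nhdsWithin] with s hs using ⟨hs, mem_univ _⟩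
    filter_upwards [h1.eventually hev, self_mem_nhdsWithin] with s hs hsI
    exact hφ.pullback_eq hsI hy hs.2 (θ s) W
  refine (main.congr_of_eventuallyEq hevt (hφ.pullback_eq ht hy hbs (θ t) W)).congr_deriv ?_
  have hdx : ∀ i, dx (localRep n φ a b) (t, y) (w i) =
      chartDeriv b b (mfderiv (𝓡 n) (𝓡 n) (φ t) ((extChartAt (𝓡 n) a).symm y) (W i)) := fun i => by
    rw [hφ.dx_localRep ht hy hbs, chartSymmDeriv_chartDeriv hy]
  simp only [hdx]
  rw [lieD_apply_chart X]
  congr 1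
  -- The derivative θ' freezes the base point and the vectors at time t; by uniqueness it is the
  -- time derivative of the chart expression.
  exact (uniqueDiffOn_timeI t ht).eq_deriv _ (hθ.hasDerivWithinAt ht hbs _) hθ'

end ChartCalculus

/-! ### Exterior and time derivatives of smooth families -/

section FormFamilies

open Set Filter Topology

variable {n : ℕ} {M : Type*} [TopologicalSpace M] [ChartedSpace (Euc n) M]
  [IsManifold (𝓡 n) ∞ M] {k : ℕ} {a b c x : M}
  {y : Euc n} {t : ℝ} {θ : ℝ → DForm n M k}

omit [IsManifold (𝓡 n) ∞ M] in
lemma smoothMaps_id : SmoothMaps n fun (_ : ℝ) (x : M) => x := contMDiffOn_snd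

/-- The exterior derivative can be computed in any chart. -/
lemma chartRep_extD (hθ : SmoothFamily θ) (ht : t ∈ timeI)
    (hy : y ∈ (extChartAt (𝓡 n) c).target) :
    chartRep c (extD (θ t)) y = extDeriv (chartRep c (θ t)) y := by
  set x := (extChartAt (𝓡 n) c).symm y with hx
  have hb : x ∈ (extChartAt (𝓡 n) x).source := mem_extChartAt_source x
  have hid := smoothMaps_id (n := n) (M := M)
  -- The transition map is the local expression of the constant family of identities, so the
  -- calculus of smooth maps applies; naturality of d under τ then gives the result.
  set τ : Euc n → Euc n := fun z => localRep n (fun _ x => x) c x (t, z) with hτ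
  have hτs : ContDiffAt ℝ ∞ τ y := by
    have h := hid.smoothAt_localRep ht hy hb
    exact contDiffWithinAt_univ.1 (ContDiffWithinAt.comp (t := strip (Euc n)) y h
      (contDiff_prodMk_right t).contDiffWithinAt fun z _ => ⟨ht, mem_univ _⟩)
  have hev : chartRep c (θ t) =ᶠ[𝓝 y] fun z =>
      (chartRep x (θ t) (τ z)).compContinuousLinearMap (fderiv ℝ τ z) := by
    have h1 : Tendsto (fun z => (t, z)) (𝓝 y) (𝓝[strip (Euc n)] (t, y)) :=
      tendsto_nhdsWithin_iff.2 ⟨(Continuous.prodMk_right t).tendsto y, Eventually.of_forall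
        fun z => ⟨ht, mem_univ _⟩⟩
    filter_upwards [h1.eventually (hid.eventually_mem_source ht hy hb)] with z hz
    ext W
    have h2 := hid.pullback_eq ht hz.1 hz.2 (θ t) (fun i => chartSymmDeriv c z (W i))
    simp only [chartDeriv_chartSymmDeriv hz.1] at h2
    refine Eq.trans ?_ h2
    simp only [pullback]
    rw [chartRep_apply]
    exact congrArg (θ t _) (funext fun i => by erw [mfderiv_id]; rfl)
  have hθd : DifferentiableAt ℝ (chartRep x (θ t)) (τ y) :=
    (hasFDerivAt_dx (p := (t, extChartAt (𝓡 n) x x)) (hθ.smoothAt ht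
      (mem_extChartAt_target x)).differentiableWithinAt ⟨ht, mem_univ _⟩).differentiableAt
  rw [hev.extDeriv_eq, extDeriv_pullback hθd hτs minSmoothness_two_le]
  ext W
  rw [chartRep_apply, extD_apply]
  have h3 : ∀ w, fderiv ℝ τ y w = chartDeriv x x (chartSymmDeriv c y w) := by
    intro w
    refine (hid.dx_localRep ht hy hb w).trans ?_
    erw [mfderiv_id]
    rfl
  exact congrArg (extDeriv (chartRep x (θ t)) (extChartAt (𝓡 n) x x)) (funext fun i => (h3 _).symm)

omit [IsManifold (𝓡 n) ∞ M] in
lemma eventually_mem_chart {p : ℝ × Euc n} (hp : p.2 ∈ (extChartAt (𝓡 n) c).target) :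
    ∀ᶠ q in 𝓝[strip (Euc n)] p, q ∈ timeI ×ˢ (extChartAt (𝓡 n) c).target := by
  have h3 : ∀ᶠ q in 𝓝 p, q.2 ∈ (extChartAt (𝓡 n) c).target :=
    continuousAt_snd.eventually_mem ((isOpen_chart_target c).mem_nhds hp)
  filter_upwards [h3.filter_mono nhdsWithin_le_nhds, self_mem_nhdsWithin] with q hq hqs
  exact ⟨hqs.1, hq⟩

lemma SmoothFamily.extD (hθ : SmoothFamily θ) : SmoothFamily fun t => extD (θ t) := by
  intro c
  refine (contDiffOn_iff_smoothAt (isOpen_chart_target c)).2 fun p hp => ?_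
  have h1 := (hθ.smoothAt (c := c) hp.1 hp.2).dx ⟨hp.1, mem_univ _⟩
  have h2 : SmoothAt (fun q => ContinuousAlternatingMap.alternatizeUncurryFinCLM ℝ (Euc n) ℝ
      (dx (fun p : ℝ × Euc n => chartRep c (θ p.1) p.2) q)) p :=
    (ContinuousLinearMap.contDiff _).comp_contDiffWithinAt h1
  refine ContDiffWithinAt.congr_of_eventuallyEq h2 ?_ (chartRep_extD hθ hp.1 hp.2)
  filter_upwards [eventually_mem_chart hp.2] with q hq
  exact chartRep_extD hθ hq.1 hq.2

/-- The derivative in time of a family of forms. -/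
def timeD (θ : ℝ → DForm n M k) (t : ℝ) : DForm n M k := fun x =>
  (dt (fun p : ℝ × Euc n => chartRep x (θ p.1) p.2)
    (t, extChartAt (𝓡 n) x x)).compContinuousLinearMap (chartDeriv x x)

lemma SmoothFamily.hasDerivWithinAt_timeD (hθ : SmoothFamily θ) (ht : t ∈ timeI) (x : M)
    (V : Fin k → TangentSpace (𝓡 n) x) :
    HasDerivWithinAt (fun s => θ s x V) (timeD θ t x V) timeI t :=
  hθ.hasDerivWithinAt ht (mem_extChartAt_source x) V

lemma timeD_apply_eq (hθ : SmoothFamily θ) (ht : t ∈ timeI) (x : M)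
    (V : Fin k → TangentSpace (𝓡 n) x) {d : ℝ} (h : HasDerivWithinAt (fun s => θ s x V) d timeI t) :
    timeD θ t x V = d :=
  (uniqueDiffOn_timeI t ht).eq_deriv _ (hθ.hasDerivWithinAt_timeD ht x V) h

lemma chartRep_timeD (hθ : SmoothFamily θ) (ht : t ∈ timeI)
    (hy : y ∈ (extChartAt (𝓡 n) c).target) :
    chartRep c (timeD θ t) y = dt (fun p : ℝ × Euc n => chartRep c (θ p.1) p.2) (t, y) := by
  ext W
  rw [chartRep_apply]
  have h := timeD_apply_eq hθ ht _ _ (hθ.hasDerivWithinAt ht ((extChartAt (𝓡 n) c).map_target hy)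
    fun i => chartSymmDeriv c y (W i))
  rw [h, (extChartAt (𝓡 n) c).right_inv hy]
  exact congrArg _ (funext fun i => chartDeriv_chartSymmDeriv hy _)

lemma SmoothFamily.timeD (hθ : SmoothFamily θ) : SmoothFamily (timeD θ) := by
  intro c
  refine (contDiffOn_iff_smoothAt (isOpen_chart_target c)).2 fun p hp => ?_
  have h1 := (hθ.smoothAt (c := c) hp.1 hp.2).dt ⟨hp.1, mem_univ _⟩
  refine ContDiffWithinAt.congr_of_eventuallyEq h1 ?_ (chartRep_timeD hθ hp.1 hp.2)
  filter_upwards [eventually_mem_chart hp.2] with q hq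
  exact chartRep_timeD hθ hq.1 hq.2

/-- The exterior derivative commutes with the derivative in time. -/
lemma SmoothFamily.timeD_extD (hθ : SmoothFamily θ) (ht : t ∈ timeI) (x : M) :
    ContactSymplectic.timeD (fun t => ContactSymplectic.extD (θ t)) t x =
      ContactSymplectic.extD (ContactSymplectic.timeD θ t) x := by
  ext V
  refine timeD_apply_eq hθ.extD ht x V ?_
  have hx : extChartAt (𝓡 n) x x ∈ (extChartAt (𝓡 n) x).target := mem_extChartAt_target x
  have h1 := (hθ.smoothAt ht hx).hasDerivWithinAt_dx ⟨ht, mem_univ _⟩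
  have h2 : HasDerivWithinAt (fun s => ContinuousAlternatingMap.alternatizeUncurryFinCLM ℝ (Euc n) ℝ
      (dx (fun p : ℝ × Euc n => chartRep x (θ p.1) p.2) (s, extChartAt (𝓡 n) x x))) _ timeI t :=
    (ContinuousAlternatingMap.alternatizeUncurryFinCLM ℝ (Euc n)
      ℝ).hasFDerivAt.comp_hasDerivWithinAt t h1
  have h3 := (HasFDerivWithinAt.continuousAlternatingMap_apply_const h2.hasFDerivWithinAt
    (fun i => chartDeriv x x (V i))).hasDerivWithinAt
  refine h3.congr_deriv ?_
  have h4 : chartRep x (ContactSymplectic.timeD θ t) =ᶠ[𝓝 (extChartAt (𝓡 n) x x)]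
      fun z => dt (fun p : ℝ × Euc n => chartRep x (θ p.1) p.2) (t, z) := by
    filter_upwards [(isOpen_chart_target x).mem_nhds hx] with z hz
    exact chartRep_timeD hθ ht hz
  rw [extD_apply, h4.extDeriv_eq]
  simp
  rfl

end FormFamilies

/-! ### Smooth primitives in time, in a vector space -/

section Primitive

open Set Filter Topology

variable {E F : Type*} [NormedAddCommGroup E] [NormedSpace ℝ E] [FiniteDimensional ℝ E]
  [NormedAddCommGroup F] [NormedSpace ℝ F] [FiniteDimensional ℝ F]

/-- The primitive in time of a compactly supported function is smooth. -/
lemma IsCompactField.exists_primitive {b : ℝ × E → F} (hb : IsCompactField b) :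
    ∃ B : ℝ × E → F, ContDiffOn ℝ ∞ B (timeI ×ˢ univ) ∧ (∀ y, B (0, y) = 0) ∧
      ∀ y, ∀ t ∈ timeI, HasDerivWithinAt (fun t => B (t, y)) (b (t, y)) timeI t := by
  obtain ⟨L, hL⟩ := hb.exists_bound
  obtain ⟨R, hR⟩ := hb.support
  let χ : ContDiffBump (0 : F) :=
    { rIn := L + 1, rOut := L + 2, rIn_pos := by positivity, rIn_lt_rOut := by linarith }
  -- The primitive is the second component of the flow of (0, b) started at (y, 0), so its
  -- smoothness up to the end times is that of flows. The cutoff only bounds the support: on [0,1]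
  -- the second component has norm at most L.
  set v : ℝ × (E × F) → E × F := fun p => (0, χ p.2.2 • b (p.1, p.2.1)) with hv
  have hfield : IsCompactField v := by
    refine ⟨?_, max (L + 2) R, fun t ht z hz => ?_⟩
    · have h1 : ContDiffOn ℝ ∞ (fun p : ℝ × (E × F) => b (p.1, p.2.1)) (timeI ×ˢ univ) :=
        hb.smooth.comp (f := fun p : ℝ × (E × F) => (p.1, p.2.1)) (by fun_prop)
          (fun p hp => ⟨hp.1, mem_univ _⟩)
      have h2 : ContDiffOn ℝ ∞ (fun p : ℝ × (E × F) => χ p.2.2) (timeI ×ˢ univ) :=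
        (χ.contDiff.comp (by fun_prop)).contDiffOn
      exact contDiffOn_const.prodMk (h2.smul h1)
    · simp only [hv]
      rw [Prod.norm_def] at hz
      rcases le_max_iff.1 hz with h | h
      · rw [hR t ht _ ((le_max_right _ _).trans h)]
        simp
      · rw [χ.zero_of_le_dist, zero_smul]
        · rfl
        · simpa using (le_max_left _ _).trans h
  obtain ⟨Φ, hΦ⟩ := hfield.exists_isFlow
  have hfst : ∀ y, ∀ t ∈ timeI, (Φ (t, (y, 0))).1 = y := by
    intro y t ht
    have h := constant_of_has_deriv_right_zero (f := fun t => (Φ (t, (y, (0 : F)))).1) (a := 0) (b := 1)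
      (fun s hs => continuous_fst.continuousAt.comp_continuousWithinAt
        (hΦ.deriv (y, 0) s hs).continuousWithinAt)
      (fun s hs => hasDerivWithinAt_Ici hs
        ((ContinuousLinearMap.fst ℝ E F).hasFDerivAt.comp_hasDerivWithinAt s
          (hΦ.deriv (y, 0) s ⟨hs.1, hs.2.le⟩))) t ht
    simpa [hΦ.init] using h
  have hd : ∀ y, ∀ t ∈ timeI, HasDerivWithinAt (fun t => (Φ (t, (y, (0 : F)))).2)
      (χ (Φ (t, (y, 0))).2 • b (t, y)) timeI t := by
    intro y t ht
    have h := (ContinuousLinearMap.snd ℝ E F).hasFDerivAt.comp_hasDerivWithinAt t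
      (hΦ.deriv (y, 0) t ht)
    refine h.congr_deriv ?_
    simp [hv, hfst y t ht]
  have hbound : ∀ y, ∀ t ∈ timeI, ‖(Φ (t, (y, (0 : F)))).2‖ ≤ L := by
    intro y t ht
    have h := norm_image_sub_le_of_norm_deriv_le_segment' (f := fun t => (Φ (t, (y, (0 : F)))).2)
      (C := L) (hd y) (fun s hs => ?_) t ht
    · simp only [hΦ.init, sub_zero] at h
      refine h.trans ?_
      have h1 : (0 : ℝ) ≤ L := L.2
      nlinarith [ht.2]
    · rw [norm_smul, Real.norm_of_nonneg χ.nonneg]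
      calc χ _ * ‖b (s, y)‖ ≤ 1 * L :=
            mul_le_mul χ.le_one (hL s ⟨hs.1, hs.2.le⟩ y) (norm_nonneg _) zero_le_one
        _ = L := one_mul _
  refine ⟨fun p => (Φ (p.1, (p.2, 0))).2, ?_, fun y => by simp [hΦ.init], fun y t ht => ?_⟩
  · exact contDiff_snd.comp_contDiffOn ((hΦ.contDiffOn hfield).comp
      (f := fun p : ℝ × E => (p.1, (p.2, (0 : F)))) (by fun_prop) fun p hp => ⟨hp.1, mem_univ _⟩)
  · refine (hd y t ht).congr_deriv ?_
    rw [χ.one_of_mem_closedBall, one_smul]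
    simpa using (hbound y t ht).trans (by linarith)

omit [FiniteDimensional ℝ F] in
/-- The product of a bump function and a function defined near the support of the bump function. -/
lemma isCompactField_bump {y₀ : E} (χ : ContDiffBump y₀) {b : ℝ × E → F} {U : Set E}
    (hU : IsOpen U) (hχ : Metric.closedBall y₀ χ.rOut ⊆ U) (hb : ContDiffOn ℝ ∞ b (timeI ×ˢ U)) :
    IsCompactField fun p => χ p.2 • b p := by
  refine ⟨?_, ‖y₀‖ + χ.rOut, fun t ht y hy => ?_⟩
  · rintro ⟨t, y⟩ ⟨ht, -⟩
    by_cases hy : y ∈ U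
    · have hχ : ContDiffWithinAt ℝ ∞ (fun q : ℝ × E => χ q.2) (timeI ×ˢ univ) (t, y) :=
        (χ.contDiff.comp contDiff_snd).contDiffAt.contDiffWithinAt
      exact hχ.smul ((contDiffOn_iff_smoothAt hU).1 hb (t, y) ⟨ht, hy⟩)
    · have h0 : (fun p : ℝ × E => χ p.2 • b p) =ᶠ[𝓝 (t, y)] fun _ => 0 := by
        have hopen : IsOpen {q : ℝ × E | q.2 ∉ Metric.closedBall y₀ χ.rOut} :=
          (Metric.isClosed_closedBall.preimage continuous_snd).isOpen_compl
        filter_upwards [hopen.mem_nhds (fun h => hy (hχ h))] with q hq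
        rw [χ.zero_of_le_dist (not_le.1 hq).le, zero_smul]
      exact (contDiffAt_const.congr_of_eventuallyEq h0).contDiffWithinAt
  · rw [χ.zero_of_le_dist, zero_smul]
    rw [dist_eq_norm]
    linarith [norm_sub_norm_le y y₀]

lemma exists_local_primitive {b : ℝ × E → F} {U : Set E} (hU : IsOpen U)
    (hb : ContDiffOn ℝ ∞ b (timeI ×ˢ U)) {y₀ : E} (hy₀ : y₀ ∈ U) :
    ∃ (B : ℝ × E → F) (V : Set E), IsOpen V ∧ y₀ ∈ V ∧ V ⊆ U ∧
      ContDiffOn ℝ ∞ B (timeI ×ˢ V) ∧ (∀ y, B (0, y) = 0) ∧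
      ∀ y ∈ V, ∀ t ∈ timeI, HasDerivWithinAt (fun t => B (t, y)) (b (t, y)) timeI t := by
  obtain ⟨r, hr, hball⟩ := Metric.isOpen_iff.1 hU y₀ hy₀
  let χ : ContDiffBump y₀ :=
    { rIn := r / 3, rOut := r / 2, rIn_pos := by positivity, rIn_lt_rOut := by linarith }
  have hχ : Metric.closedBall y₀ χ.rOut ⊆ U :=
    (Metric.closedBall_subset_ball (by change r / 2 < r; linarith)).trans hball
  obtain ⟨B, hB, hB0, hBd⟩ := (isCompactField_bump χ hU hχ hb).exists_primitive
  refine ⟨B, Metric.ball y₀ (r / 3), Metric.isOpen_ball, Metric.mem_ball_self (by positivity),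
    (Metric.ball_subset_ball (by linarith)).trans hball,
    hB.mono (prod_mono_right (subset_univ _)), hB0, fun y hy t ht => ?_⟩
  refine (hBd y t ht).congr_deriv ?_
  rw [χ.one_of_mem_closedBall (Metric.ball_subset_closedBall hy), one_smul]

end Primitive

/-! ### Primitives in time of families of one-forms -/

section PrimitiveForms

open Set Filter Topology

variable {n : ℕ} {M : Type*} [TopologicalSpace M] [ChartedSpace (Euc n) M]
  [IsManifold (𝓡 n) ∞ M]

variable (n) in
/-- The identification of linear forms with alternating one-forms. -/
def oneForm : (Euc n →L[ℝ] ℝ) ≃ₗᵢ[ℝ] Euc n [⋀^Fin 1]→L[ℝ] ℝ :=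
  ContinuousAlternatingMap.ofSubsingletonLIE 0

omit [IsManifold (𝓡 n) ∞ M] in
lemma exists_local_primitive_form {β : ℝ → DForm n M 1} (hβ : SmoothFamily β) {c : M} {y₀ : Euc n}
    (hy₀ : y₀ ∈ (extChartAt (𝓡 n) c).target) :
    ∃ (B : ℝ × Euc n → Euc n [⋀^Fin 1]→L[ℝ] ℝ) (V : Set (Euc n)), IsOpen V ∧ y₀ ∈ V ∧
      V ⊆ (extChartAt (𝓡 n) c).target ∧
      ContDiffOn ℝ ∞ B (timeI ×ˢ V) ∧ (∀ y, B (0, y) = 0) ∧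
      ∀ y ∈ V, ∀ t ∈ timeI, HasDerivWithinAt (fun t => B (t, y)) (chartRep c (β t) y) timeI t := by
  have h1 : ContDiffOn ℝ ∞ (fun p : ℝ × Euc n => (oneForm n).symm (chartRep c (β p.1) p.2))
      (timeI ×ˢ (extChartAt (𝓡 n) c).target) :=
    (oneForm n).symm.toContinuousLinearEquiv.contDiff.comp_contDiffOn (hβ c)
  obtain ⟨B, V, hV, hyV, hVU, hB, hB0, hBd⟩ :=
    exists_local_primitive (isOpen_chart_target c) h1 hy₀
  refine ⟨fun p => oneForm n (B p), V, hV, hyV, hVU,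
    (oneForm n).toContinuousLinearEquiv.contDiff.comp_contDiffOn hB, fun y => by simp [hB0],
    fun y hy t ht => ?_⟩
  have h := (oneForm n).toContinuousLinearEquiv.toContinuousLinearMap.hasFDerivAt.comp_hasDerivWithinAt
    t (hBd y hy t ht)
  refine h.congr_deriv ?_
  exact (oneForm n).apply_symm_apply _

/-- A smooth family of one-forms has a primitive in time. -/
lemma SmoothFamily.exists_primitive {β : ℝ → DForm n M 1} (hβ : SmoothFamily β) :
    ∃ γ : ℝ → DForm n M 1, SmoothFamily γ ∧ (∀ x, γ 0 x = 0) ∧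
      ∀ t ∈ timeI, ∀ x V, HasDerivWithinAt (fun s => γ s x V) (β t x V) timeI t := by
  choose B V hV hyV hVU hB hB0 hBd using fun x : M =>
    exists_local_primitive_form hβ (mem_extChartAt_target (I := 𝓡 n) x)
  set γ : ℝ → DForm n M 1 := fun t x =>
    (B x (t, extChartAt (𝓡 n) x x)).compContinuousLinearMap (chartDeriv x x) with hγ
  have hγ0 : ∀ x, γ 0 x = 0 := fun x => by
    simp only [hγ, hB0]
    ext V
    rfl
  have hγd : ∀ t ∈ timeI, ∀ x V, HasDerivWithinAt (fun s => γ s x V) (β t x V) timeI t := by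
    intro t ht x V
    have h := (HasFDerivWithinAt.continuousAlternatingMap_apply_const
      (hBd x _ (hyV x) t ht).hasFDerivWithinAt (fun i => chartDeriv x x (V i))).hasDerivWithinAt
    refine h.congr_deriv ?_
    rw [apply_eq_chartRep (mem_extChartAt_source x)]
    simp
  refine ⟨γ, fun c => (contDiffOn_iff_smoothAt (isOpen_chart_target c)).2 fun p hp => ?_, hγ0, hγd⟩
  obtain ⟨B', V', hV', hyV', hVU', hB', hB0', hBd'⟩ := exists_local_primitive_form hβ hp.2
  -- The value of γ at each point was chosen in that point's own chart. It agrees with a primitive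
  -- smooth in the fixed chart c, as both vanish at time 0 and have the same time derivative.
  have heq : ∀ q ∈ timeI ×ˢ V', chartRep c (γ q.1) q.2 = B' q := by
    rintro ⟨t, y⟩ ⟨ht, hy⟩
    ext W
    have h1 : ∀ s ∈ timeI, HasDerivWithinAt (fun s => chartRep c (γ s) y W - B' (s, y) W) 0
        timeI s := by
      intro s hs
      have h2 := (HasFDerivWithinAt.continuousAlternatingMap_apply_const
        (hBd' y hy s hs).hasFDerivWithinAt W).hasDerivWithinAt
      refine ((hγd s hs _ (fun i => chartSymmDeriv c y (W i))).sub h2).congr_deriv ?_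
      rw [← chartRep_apply]
      simp
    have h3 := constant_of_has_deriv_right_zero (a := 0) (b := 1)
      (fun s hs => (h1 s hs).continuousWithinAt)
      (fun s hs => hasDerivWithinAt_Ici hs (h1 s ⟨hs.1, hs.2.le⟩)) t ht
    have h4 : chartRep c (γ 0) y W = 0 := by
      rw [chartRep_apply, hγ0]
      rfl
    rw [h4, hB0'] at h3
    simpa [sub_eq_zero] using h3
  refine ContDiffWithinAt.congr_of_eventuallyEq
    ((contDiffOn_iff_smoothAt hV').1 hB' p ⟨hp.1, hyV'⟩) ?_ (heq p ⟨hp.1, hyV'⟩)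
  have h5 : ∀ᶠ q in 𝓝 p, q.2 ∈ V' := continuousAt_snd.eventually_mem (hV'.mem_nhds hyV')
  filter_upwards [h5.filter_mono nhdsWithin_le_nhds, self_mem_nhdsWithin] with q hq hqs
  exact heq q ⟨hqs.1, hq⟩

end PrimitiveForms

/-! ### Smoothness of the inverses of a family of maps -/

section InverseFamily

open Set Filter Topology

variable {E : Type*} [NormedAddCommGroup E] [NormedSpace ℝ E] [CompleteSpace E]

omit [CompleteSpace E] in
-- (t, y) ↦ (t, Ψ(t, y)) inverts (t, x) ↦ (t, c(t, x)), whose derivative is block triangular with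
-- invertible diagonal. Inverting the blocks gives the formula.
lemma hasFDerivWithinAt_inverse_family {c Ψ : ℝ × E → E} {u : Set (ℝ × E)}
    (hΨ : ContinuousOn Ψ (strip E ∩ u)) (hc : ∀ p ∈ strip E ∩ u, SmoothAt c (p.1, Ψ p))
    (hinv : ∀ p ∈ strip E ∩ u, ∃ A : E ≃L[ℝ] E, dx c (p.1, Ψ p) = A)
    (heq : ∀ p ∈ strip E ∩ u, c (p.1, Ψ p) = p.2) {p : ℝ × E} (hp : p ∈ strip E ∩ u) :
    HasFDerivWithinAt Ψ ((dx c (p.1, Ψ p)).inverse.comp (ContinuousLinearMap.snd ℝ ℝ E -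
      (ContinuousLinearMap.fst ℝ ℝ E).smulRight (dt c (p.1, Ψ p)))) (strip E ∩ u) p := by
  obtain ⟨A, hA⟩ := hinv p hp
  have hP : (p.1, Ψ p) ∈ strip E := ⟨hp.1.1, mem_univ _⟩
  have hcd := (hc p hp).differentiableWithinAt
  set f' : ℝ × E →L[ℝ] ℝ × E :=
    (ContinuousLinearMap.fst ℝ ℝ E).prod (fderivWithin ℝ c (strip E) (p.1, Ψ p)) with hf'
  set g' : ℝ × E →L[ℝ] E := (dx c (p.1, Ψ p)).inverse.comp (ContinuousLinearMap.snd ℝ ℝ E -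
      (ContinuousLinearMap.fst ℝ ℝ E).smulRight (dt c (p.1, Ψ p))) with hg'
  have hleft : ∀ q, (((ContinuousLinearMap.fst ℝ ℝ E).prod g')) (f' q) = q := by
    rintro ⟨s, w⟩
    have h1 : f' (s, w) = (s, s • dt c (p.1, Ψ p) + A w) := by
      refine Prod.ext rfl ?_
      exact (fderivWithin_strip_apply hcd hP s w).trans (by rw [hA]; rfl)
    rw [h1]
    simp [hg', hA]
  have hf : HasFDerivWithinAt (fun q => (q.1, c q)) f' (strip E) (p.1, Ψ p) :=
    hasFDerivWithinAt_fst.prodMk hcd.hasFDerivWithinAt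
  have hg : Tendsto (fun q => (q.1, Ψ q)) (𝓝[strip E ∩ u] p) (𝓝[strip E] (p.1, Ψ p)) := by
    refine tendsto_nhdsWithin_iff.2 ⟨?_, ?_⟩
    · exact (continuous_fst.continuousAt.mono_left nhdsWithin_le_nhds).prodMk_nhds (hΨ p hp)
    · filter_upwards [self_mem_nhdsWithin] with q hq using ⟨hq.1.1, mem_univ _⟩
  have h := HasFDerivWithinAt.of_comp_of_leftInverse (g := fun q => (q.1, Ψ q))
    (f'symm := (ContinuousLinearMap.fst ℝ ℝ E).prod g') hg hf (hasFDerivWithinAt_id p _)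
    (by
      filter_upwards [self_mem_nhdsWithin] with q hq
      exact Prod.ext rfl (heq q hq)) hleft hp
  have h2 := (ContinuousLinearMap.snd ℝ ℝ E).hasFDerivAt.comp_hasFDerivWithinAt p h
  refine h2.congr_fderiv ?_
  ext <;> simp

/-- The inverses of a smooth family of maps with invertible derivatives form a smooth family. -/
lemma contDiffOn_inverse_family {c Ψ : ℝ × E → E} {u : Set (ℝ × E)} (hu : IsOpen u)
    (hΨ : ContinuousOn Ψ (strip E ∩ u)) (hc : ∀ p ∈ strip E ∩ u, SmoothAt c (p.1, Ψ p))
    (hinv : ∀ p ∈ strip E ∩ u, ∃ A : E ≃L[ℝ] E, dx c (p.1, Ψ p) = A)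
    (heq : ∀ p ∈ strip E ∩ u, c (p.1, Ψ p) = p.2) : ContDiffOn ℝ ∞ Ψ (strip E ∩ u) := by
  rw [contDiffOn_infty]
  intro k
  induction k with
  | zero => exact contDiffOn_zero.2 hΨ
  | succ k ih =>
    push_cast
    rw [contDiffOn_succ_iff_hasFDerivWithinAt_of_uniqueDiffOn (uniqueDiffOn_strip.inter hu)]
    -- The derivative of Ψ is a smooth expression in Ψ itself, so each order of smoothness yields
    -- the next.
    refine ⟨by simp, _, ?_, fun p hp => hasFDerivWithinAt_inverse_family hΨ hc hinv heq hp⟩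
    intro p hp
    have hP : (p.1, Ψ p) ∈ strip E := ⟨hp.1.1, mem_univ _⟩
    have hpair : ContDiffWithinAt ℝ k (fun p : ℝ × E => (p.1, Ψ p)) (strip E ∩ u) p :=
      contDiffWithinAt_fst.prodMk (ih p hp)
    have hm : MapsTo (fun p : ℝ × E => (p.1, Ψ p)) (strip E ∩ u) (strip E) :=
      fun q hq => ⟨hq.1.1, mem_univ _⟩
    have h1 : ContDiffWithinAt ℝ k (dx c) (strip E) (p.1, Ψ p) :=
      ContDiffWithinAt.of_le ((hc p hp).dx hP) (mod_cast le_top)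
    have h2 : ContDiffWithinAt ℝ k (dt c) (strip E) (p.1, Ψ p) :=
      ContDiffWithinAt.of_le ((hc p hp).dt hP) (mod_cast le_top)
    obtain ⟨A, hA⟩ := hinv p hp
    have h3 : ContDiffAt ℝ k ContinuousLinearMap.inverse (dx c (p.1, Ψ p)) := by
      rw [hA]
      exact contDiffAt_map_inverse A
    have h4 := h3.comp_contDiffWithinAt p (h1.comp p hpair hm)
    have h5 : ContDiffWithinAt ℝ k (fun p => dt c (p.1, Ψ p)) (strip E ∩ u) p :=
      ContDiffWithinAt.comp (g := dt c) p h2 hpair hm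
    exact h4.clm_comp (contDiffWithinAt_const.sub (contDiffWithinAt_const.smulRight h5))

end InverseFamily

/-! ### The field generating an isotopy -/

section IsotopyField

open Set Filter Topology

variable {n : ℕ} {M : Type*} [TopologicalSpace M] [ChartedSpace (Euc n) M]
  [IsManifold (𝓡 n) ∞ M] {φ : ℝ → M ≃ₘ⟮𝓡 n, 𝓡 n⟯ M} {x a c : M}
  {t : ℝ} {y : Euc n}

omit [IsManifold (𝓡 n) ∞ M] in
lemma IsIsotopy.smoothMaps (hφ : IsIsotopy φ) : SmoothMaps n fun t x => φ t x := hφ.smooth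

omit [IsManifold (𝓡 n) ∞ M] in
-- The map (t, x) ↦ (t, φ t x) is a continuous bijection of the compact Hausdorff space [0,1] × M,
-- hence a homeomorphism.
lemma IsIsotopy.continuousOn_symm [T2Space M] [CompactSpace M] (hφ : IsIsotopy φ) :
    ContinuousOn (fun p : ℝ × M => (φ p.1).symm p.2) (timeI ×ˢ univ) := by
  let e : ↥timeI × M ≃ ↥timeI × M :=
    { toFun := fun p => (p.1, φ p.1 p.2)
      invFun := fun p => (p.1, (φ p.1).symm p.2)
      left_inv := fun p => by simp
      right_inv := fun p => by simp }
  have he : Continuous e := by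
    refine continuous_fst.prodMk ?_
    exact ContinuousOn.comp_continuous (f := fun p : ↥timeI × M => ((p.1 : ℝ), p.2))
      hφ.smooth.continuousOn (by fun_prop) fun p => ⟨p.1.2, mem_univ _⟩
  have h := (Continuous.homeoOfEquivCompactToT2 he).symm.continuous
  rw [continuousOn_iff_continuous_domRestrict]
  have h2 : Continuous fun p : ↥(timeI ×ˢ (univ : Set M)) =>
      (((⟨p.1.1, p.2.1⟩ : ↥timeI), p.1.2) : ↥timeI × M) := by fun_prop
  exact continuous_snd.comp (h.comp h2)

omit [IsManifold (𝓡 n) ∞ M] in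
lemma mfderiv_diffeo_bijective (φ : ℝ → M ≃ₘ⟮𝓡 n, 𝓡 n⟯ M) (t : ℝ) (x : M) :
    Function.Bijective (mfderiv (𝓡 n) (𝓡 n) (φ t) x) :=
  ((φ t).mfderivToContinuousLinearEquiv (by simp) x).bijective

lemma IsIsotopy.exists_equiv_dx (hφ : IsIsotopy φ) (ht : t ∈ timeI)
    (hy : y ∈ (extChartAt (𝓡 n) a).target)
    (hc : φ t ((extChartAt (𝓡 n) a).symm y) ∈ (extChartAt (𝓡 n) c).source) :
    ∃ A : Euc n ≃L[ℝ] Euc n, dx (localRep n (fun t x => φ t x) a c) (t, y) = A := by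
  have hinj : Function.Injective (dx (localRep n (fun t x => φ t x) a c) (t, y)) := by
    intro v w h
    rw [hφ.smoothMaps.dx_localRep ht hy hc, hφ.smoothMaps.dx_localRep ht hy hc] at h
    have h1 := (mfderiv_diffeo_bijective φ t _).1 (chartDeriv_injective hc h)
    rw [← chartDeriv_chartSymmDeriv hy v, h1, chartDeriv_chartSymmDeriv hy]
  refine ⟨(LinearEquiv.ofInjectiveEndo _ hinj).toContinuousLinearEquiv, ?_⟩
  ext v
  rfl

/-- Continuity of the inverses confines them near (t, y) to one chart around a; there the isotopy
has invertible spatial derivative and the result on inverse families applies. -/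
lemma IsIsotopy.smoothAt_symm [CompactSpace M] [T2Space M] (hφ : IsIsotopy φ) (ht : t ∈ timeI)
    (hy : y ∈ (extChartAt (𝓡 n) c).target)
    (ha : (φ t).symm ((extChartAt (𝓡 n) c).symm y) ∈ (extChartAt (𝓡 n) a).source) :
    SmoothAt (localRep n (fun t x => (φ t).symm x) c a) (t, y) := by
  have hpair : ContinuousOn (fun p : ℝ × Euc n => (p.1, (extChartAt (𝓡 n) c).symm p.2))
      (timeI ×ˢ (extChartAt (𝓡 n) c).target) :=
    continuousOn_fst.prodMk ((continuousOn_extChartAt_symm c).comp continuousOn_snd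
      fun p hp => hp.2)
  have hcont : ContinuousOn (fun p : ℝ × Euc n => (φ p.1).symm ((extChartAt (𝓡 n) c).symm p.2))
      (timeI ×ˢ (extChartAt (𝓡 n) c).target) :=
    ContinuousOn.comp (g := fun p : ℝ × M => (φ p.1).symm p.2) hφ.continuousOn_symm hpair
      fun p hp => ⟨hp.1, mem_univ _⟩
  obtain ⟨u, hu, hus⟩ := (continuousOn_iff'.1 hcont) _ (isOpen_extChartAt_source (I := 𝓡 n) a)
  set u' : Set (ℝ × Euc n) := u ∩ Prod.snd ⁻¹' (extChartAt (𝓡 n) c).target with hu'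
  have hu'o : IsOpen u' := hu.inter ((isOpen_chart_target c).preimage continuous_snd)
  have hmem : ∀ p ∈ strip (Euc n) ∩ u', p ∈ timeI ×ˢ (extChartAt (𝓡 n) c).target ∧
      (φ p.1).symm ((extChartAt (𝓡 n) c).symm p.2) ∈ (extChartAt (𝓡 n) a).source := by
    intro p hp
    have h1 : p ∈ timeI ×ˢ (extChartAt (𝓡 n) c).target := ⟨hp.1.1, hp.2.2⟩
    exact ⟨h1, (hus.symm.subset ⟨hp.2.1, h1⟩).1⟩
  have hp0 : (t, y) ∈ strip (Euc n) ∩ u' := by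
    have h1 : (t, y) ∈ timeI ×ˢ (extChartAt (𝓡 n) c).target := ⟨ht, hy⟩
    exact ⟨⟨ht, mem_univ _⟩, (hus.subset ⟨ha, h1⟩).1, hy⟩
  have hback : ∀ p ∈ strip (Euc n) ∩ u',
      localRep n (fun t x => (φ t).symm x) c a p ∈ (extChartAt (𝓡 n) a).target ∧
      (extChartAt (𝓡 n) a).symm (localRep n (fun t x => (φ t).symm x) c a p) =
        (φ p.1).symm ((extChartAt (𝓡 n) c).symm p.2) := fun p hp =>
    ⟨(extChartAt (𝓡 n) a).map_source (hmem p hp).2, (extChartAt (𝓡 n) a).left_inv (hmem p hp).2⟩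
  have hsrc : ∀ p ∈ strip (Euc n) ∩ u', φ p.1 ((extChartAt (𝓡 n) a).symm
      (localRep n (fun t x => (φ t).symm x) c a p)) = (extChartAt (𝓡 n) c).symm p.2 := by
    intro p hp
    rw [(hback p hp).2, Diffeomorph.apply_symm_apply]
  have hsrc' : ∀ p ∈ strip (Euc n) ∩ u', φ p.1 ((extChartAt (𝓡 n) a).symm
      (localRep n (fun t x => (φ t).symm x) c a p)) ∈ (extChartAt (𝓡 n) c).source := by
    intro p hp
    rw [hsrc p hp]
    exact (extChartAt (𝓡 n) c).map_target (hmem p hp).1.2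
  have hmain := contDiffOn_inverse_family (c := localRep n (fun t x => φ t x) a c)
    (Ψ := localRep n (fun t x => (φ t).symm x) c a) hu'o ?_
    (fun p hp => hφ.smoothMaps.smoothAt_localRep hp.1.1 (hback p hp).1 (hsrc' p hp))
    (fun p hp => hφ.exists_equiv_dx hp.1.1 (hback p hp).1 (hsrc' p hp)) ?_
  · exact (hmain (t, y) hp0).mono_of_mem_nhdsWithin
      (inter_mem self_mem_nhdsWithin (mem_nhdsWithin_of_mem_nhds (hu'o.mem_nhds hp0.2)))
  · exact (continuousOn_extChartAt a).comp (hcont.mono fun p hp => (hmem p hp).1)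
      fun p hp => (hmem p hp).2
  · intro p hp
    change extChartAt (𝓡 n) c (φ p.1 ((extChartAt (𝓡 n) a).symm
      (localRep n (fun t x => (φ t).symm x) c a p))) = p.2
    rw [hsrc p hp, (extChartAt (𝓡 n) c).right_inv (hmem p hp).1.2]

/-- An isotopy is the flow of a smooth time-dependent vector field. -/
lemma IsIsotopy.exists_field [CompactSpace M] [T2Space M] (hφ : IsIsotopy φ) :
    ∃ X : ℝ → VField n M, SmoothField X ∧ ∀ x, IsFlowLine X fun t => φ t x := by
  -- X t x is the velocity at time t of the trajectory passing through x at that time.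
  set X : ℝ → VField n M := fun t x =>
    (mfderivWithin 𝓘(ℝ, ℝ) (𝓡 n) (fun s => φ s ((φ t).symm x)) timeI t 1 : Euc n) with hX
  have hline : ∀ x, IsFlowLine X fun t => φ t x := by
    intro x t ht
    have h1 : ContMDiffOn 𝓘(ℝ, ℝ) (𝓡 n) ∞ (fun t => φ t x) timeI :=
      ContMDiffOn.comp (g := fun p : ℝ × M => φ p.1 p.2) (f := fun t => (t, x)) hφ.smooth
        (contMDiffOn_id.prodMk contMDiffOn_const) fun t ht => ⟨ht, mem_univ _⟩
    have h2 := ((h1 t ht).mdifferentiableWithinAt (by simp)).hasMFDerivWithinAt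
    refine h2.congr_mfderiv (clm_ext_one ?_)
    rw [smulRight_one_apply]
    have e : ∀ z, z = x → (mfderivWithin 𝓘(ℝ, ℝ) (𝓡 n) (fun s => φ s x) timeI t 1 : Euc n) =
        mfderivWithin 𝓘(ℝ, ℝ) (𝓡 n) (fun s => φ s z) timeI t 1 := by
      rintro z rfl
      rfl
    exact e _ ((φ t).symm_apply_apply x)
  refine ⟨X, fun c => (contDiffOn_iff_smoothAt (isOpen_chart_target c)).2 ?_, hline⟩
  rintro ⟨t, y⟩ ⟨ht, hy⟩
  set a := (φ t).symm ((extChartAt (𝓡 n) c).symm y) with ha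
  have has : a ∈ (extChartAt (𝓡 n) a).source := mem_extChartAt_source a
  have hψ := hφ.smoothAt_symm ht hy has
  have hat : localRep n (fun t x => (φ t).symm x) c a (t, y) ∈ (extChartAt (𝓡 n) a).target :=
    (extChartAt (𝓡 n) a).map_source has
  have hback : (extChartAt (𝓡 n) a).symm (localRep n (fun t x => (φ t).symm x) c a (t, y)) = a :=
    (extChartAt (𝓡 n) a).left_inv has
  have hφa : φ t a = (extChartAt (𝓡 n) c).symm y := (φ t).apply_symm_apply _
  have hsrc : φ t ((extChartAt (𝓡 n) a).symm (localRep n (fun t x => (φ t).symm x) c a (t, y))) ∈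
      (extChartAt (𝓡 n) c).source := by
    rw [hback, hφa]
    exact (extChartAt (𝓡 n) c).map_target hy
  have hc := (hφ.smoothMaps.smoothAt_localRep ht hat hsrc).dt ⟨ht, mem_univ _⟩
  have hcomp : SmoothAt (fun p => dt (localRep n (fun t x => φ t x) a c)
      (p.1, localRep n (fun t x => (φ t).symm x) c a p)) (t, y) :=
    ContDiffWithinAt.comp (g := dt (localRep n (fun t x => φ t x) a c))
      (f := fun p => (p.1, localRep n (fun t x => (φ t).symm x) c a p))
      (t := strip (Euc n)) (t, y) hc (contDiffWithinAt_fst.prodMk hψ)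
      fun p hp => ⟨hp.1, mem_univ _⟩
  -- In charts the field is the time derivative of φ composed with the inverse isotopy, so it is as
  -- smooth as these two.
  have hev : ∀ᶠ p in 𝓝[strip (Euc n)] (t, y), fieldRep c X p =
      dt (localRep n (fun t x => φ t x) a c)
        (p.1, localRep n (fun t x => (φ t).symm x) c a p) := by
    have hcont : ContinuousWithinAt (fun p : ℝ × Euc n =>
        (φ p.1).symm ((extChartAt (𝓡 n) c).symm p.2)) (strip (Euc n)) (t, y) := by
      have h1 : ContinuousAt (extChartAt (𝓡 n) c).symm y := continuousAt_extChartAt_symm'' hy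
      exact ContinuousWithinAt.comp (g := fun p : ℝ × M => (φ p.1).symm p.2)
        (f := fun p : ℝ × Euc n => (p.1, (extChartAt (𝓡 n) c).symm p.2)) (t := timeI ×ˢ univ)
        (hφ.continuousOn_symm _ ⟨ht, mem_univ _⟩)
        (continuousWithinAt_fst.prodMk
          (ContinuousAt.comp (x := (t, y)) h1 continuousAt_snd).continuousWithinAt)
        fun p hp => ⟨hp.1, mem_univ _⟩
    filter_upwards [eventually_mem_chart (p := (t, y)) hy,
      hcont.eventually_mem ((isOpen_extChartAt_source a).mem_nhds has)] with p hp hpa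
    have e1 : (extChartAt (𝓡 n) a).symm (localRep n (fun t x => (φ t).symm x) c a p) =
        (φ p.1).symm ((extChartAt (𝓡 n) c).symm p.2) := (extChartAt (𝓡 n) a).left_inv hpa
    have e2 : φ p.1 ((extChartAt (𝓡 n) a).symm (localRep n (fun t x => (φ t).symm x) c a p)) =
        (extChartAt (𝓡 n) c).symm p.2 := by
      rw [e1, Diffeomorph.apply_symm_apply]
    rw [dt_localRep hline hp.1 (by rw [e2]; exact (extChartAt (𝓡 n) c).map_target hp.2)]
    congr 1
    refine Prod.ext rfl ?_
    change p.2 = extChartAt (𝓡 n) c (φ p.1 ((extChartAt (𝓡 n) a).symm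
      (localRep n (fun t x => (φ t).symm x) c a p)))
    rw [e2, (extChartAt (𝓡 n) c).right_inv hp.2]
  exact ContDiffWithinAt.congr_of_eventuallyEq_of_mem hcomp hev ⟨ht, mem_univ _⟩

end IsotopyField

/-! ### From the isotopy to the constant basic class -/

section ClassOfIsotopy

open Set Filter Topology

variable {n : ℕ} {M : Type*} [TopologicalSpace M] [ChartedSpace (Euc n) M]
  [IsManifold (𝓡 n) ∞ M] {k : ℕ} {t : ℝ} {x : M}

lemma eq_of_hasDerivWithinAt_zero {f : ℝ → ℝ}
    (hf : ∀ t ∈ timeI, HasDerivWithinAt f 0 timeI t) (ht : t ∈ timeI) : f t = f 0 :=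
  constant_of_has_deriv_right_zero (fun s hs => (hf s hs).continuousWithinAt)
    (fun s hs => hasDerivWithinAt_Ici hs (hf s ⟨hs.1, hs.2.le⟩)) t ht

lemma form_zero_apply {V : Type*} [AddCommGroup V] [Module ℝ V] [TopologicalSpace V]
    (v : Fin k → V) : (0 : V [⋀^Fin k]→L[ℝ] ℝ) v = 0 := rfl

lemma zero_mem_timeI : (0 : ℝ) ∈ timeI := by simp

omit [IsManifold (𝓡 n) ∞ M] in
lemma SmoothFamily.neg {θ : ℝ → DForm n M k} (hθ : SmoothFamily θ) :
    SmoothFamily fun t => -θ t := fun c => (hθ c).neg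

omit [IsManifold (𝓡 n) ∞ M] in
lemma extD_neg (θ : DForm n M k) (x : M) : extD (-θ) x = -extD θ x := by
  have h : extDeriv (chartRep x (-θ)) (extChartAt (𝓡 n) x x) =
      -extDeriv (chartRep x θ) (extChartAt (𝓡 n) x x) := by
    ext W
    rw [ContinuousAlternatingMap.neg_apply, extDeriv_apply_fderiv, extDeriv_apply_fderiv,
      show chartRep x (-θ) = fun y => -chartRep x θ y from rfl, fderiv_fun_neg]
    simp [Finset.sum_neg_distrib]
  ext V
  rw [ContinuousAlternatingMap.neg_apply, extD_apply, extD_apply, h]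
  rfl

omit [IsManifold (𝓡 n) ∞ M] in
lemma extD_zero (x : M) : extD (0 : DForm n M k) x = 0 := by
  have e : chartRep x (0 : DForm n M k) = 0 := by
    funext y
    ext w
    rfl
  ext V
  rw [extD_apply, e]
  simp [extDeriv_apply_fderiv]

lemma SmoothFamily.interiorProd {θ : ℝ → DForm n M (k + 1)} (hθ : SmoothFamily θ)
    {X : ℝ → VField n M} (hX : SmoothField X) :
    SmoothFamily fun t => interiorProd (X t) (θ t) := by
  intro c
  have h : ContDiffOn ℝ ∞ (fun p : ℝ × Euc n =>
      contraction (Euc n) k (chartRep c (θ p.1) p.2) (fieldRep c X p))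
      (timeI ×ˢ (extChartAt (𝓡 n) c).target) :=
    ContDiff.comp₂_contDiffOn (g := fun q => contraction (Euc n) k q.1 q.2)
      (contraction (Euc n) k).isBoundedBilinearMap.contDiff (hθ c) (hX c)
  exact h.congr fun p hp => chartRep_interiorProd _ _ hp.2

/-- If an isotopy generated by the field `X` preserves the family of closed forms `η t`, the
derivative of the family is minus the differential of its contraction with `X`. -/
lemma timeD_eq_of_pullback_eq {η : ℝ → DForm n M (k + 1)} (hη : SmoothFamily η)
    (hcl : ∀ t ∈ timeI, ∀ x, extD (η t) x = 0) {φ : ℝ → M ≃ₘ⟮𝓡 n, 𝓡 n⟯ M} (hφ : IsIsotopy φ)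
    {X : ℝ → VField n M} (hX : SmoothField X) (hφX : ∀ x, IsFlowLine X fun t => φ t x)
    (hpull : ∀ t ∈ timeI, ∀ x, pullback (φ t) (η t) x = η 0 x) (ht : t ∈ timeI) (x : M) :
    timeD η t x = -extD (interiorProd (X t) (η t)) x := by
  obtain ⟨x, rfl⟩ : ∃ x₀, φ t x₀ = x := ⟨(φ t).symm x, (φ t).apply_symm_apply x⟩
  ext V
  choose W hW using fun i => (mfderiv_diffeo_bijective φ t x).2 (V i)
  obtain rfl : (fun i => mfderiv (𝓡 n) (𝓡 n) (φ t) x (W i)) = V := funext hW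
  have h1 := hasDerivWithinAt_pullback hη hX hφ.smoothMaps hφX ht x W
    (hη.hasDerivWithinAt_timeD ht (φ t x) _)
  have h2 : HasDerivWithinAt (fun s => pullback (φ s) (η s) x W) 0 timeI t :=
    (hasDerivWithinAt_const t timeI (η 0 x W)).congr (fun s hs => by rw [hpull s hs])
      (by rw [hpull t ht])
  have h3 := (uniqueDiffOn_timeI t ht).eq_deriv _ h1 h2
  rw [lieD, ContinuousAlternatingMap.add_apply, interiorProd_apply, hcl t ht,
    form_zero_apply, add_zero] at h3
  exact eq_neg_of_add_eq_zero_left h3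

omit [IsManifold (𝓡 n) ∞ M] in
lemma interiorProd_eq_zero_iff {Y : VField n M} {γ : DForm n M 1} :
    interiorProd Y γ x = 0 ↔ γ x ![Y x] = 0 := by
  constructor
  · intro h
    exact DFunLike.congr_fun h ![]
  · intro h
    ext V
    rw [interiorProd_apply, Subsingleton.elim V ![]]
    exact h

/-- The basic class of a family of closed forms moved by an isotopy is constant. -/
theorem hasConstantBasicClass_of_isotopy [T2Space M] [CompactSpace M] {η : ℝ → DForm n M 2}
    {F : Distrib n M}
    (hη : SmoothFamily η) (hcl : ∀ t ∈ timeI, ∀ x, extD (η t) x = 0)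
    (hF : ∀ t ∈ timeI, ∀ x, kernel (η t x).toAlternatingMap = F x)
    {φ : ℝ → M ≃ₘ⟮𝓡 n, 𝓡 n⟯ M} (hφ : IsIsotopy φ)
    (hpull : ∀ t ∈ timeI, ∀ x, pullback (φ t) (η t) x = η 0 x) : HasConstantBasicClass F η := by
  obtain ⟨X, hX, hφX⟩ := hφ.exists_field
  have hβ : SmoothFamily fun t => -interiorProd (X t) (η t) := (hη.interiorProd hX).neg
  obtain ⟨γ, hγ, hγ0, hγd⟩ := hβ.exists_primitive
  have hγt : ∀ t ∈ timeI, timeD γ t = -interiorProd (X t) (η t) := by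
    intro t ht
    funext x
    ext V
    exact timeD_apply_eq hγ ht x V (hγd t ht x V)
  have hd : ∀ t ∈ timeI, ∀ x, η t x - η 0 x = extD (γ t) x := by
    intro t ht x
    ext V
    -- Both η_s and dγ_s have time derivative -d(i_X η_s), so their difference keeps its initial
    -- value η_0.
    have h1 := eq_of_hasDerivWithinAt_zero (f := fun s => η s x V - extD (γ s) x V)
      (fun s hs => by
        refine ((hη.hasDerivWithinAt_timeD hs x V).sub
          (hγ.extD.hasDerivWithinAt_timeD hs x V)).congr_deriv ?_
        rw [hγ.timeD_extD hs, hγt s hs, extD_neg,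
          timeD_eq_of_pullback_eq hη hcl hφ hX hφX hpull hs, sub_self]) ht
    have h0 : extD (γ 0) x = 0 := by
      rw [show γ 0 = 0 from funext hγ0, extD_zero]
    simp only [h0, form_zero_apply, sub_zero] at h1
    rw [ContinuousAlternatingMap.sub_apply, ← h1]
    ring
  refine ⟨γ, hγ, fun t ht => ⟨fun Y hY => ?_, hd t ht⟩⟩
  have hi : ∀ x, interiorProd Y (γ t) x = 0 := by
    intro x
    rw [interiorProd_eq_zero_iff]
    have h1 := eq_of_hasDerivWithinAt_zero (f := fun s => γ s x ![Y x])
      (fun s hs => by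
        refine (hγd s hs x _).congr_deriv ?_
        have hk : Y x ∈ kernel (η s x).toAlternatingMap := by
          rw [hF s hs x]
          exact hY.2 x
        change -(η s x ![X s x, Y x]) = 0
        rw [neg_eq_zero]
        exact apply_eq_zero_of_mem_kernel (a := (η s x).toAlternatingMap) (w := ![X s x, Y x])
          (i := 1) hk) ht
    rw [h1, hγ0]
    rfl
  refine ⟨hi, fun x => ?_⟩
  have h0 : extD (interiorProd Y (γ t)) x = 0 := by
    rw [show interiorProd Y (γ t) = 0 from funext hi, extD_zero]
  ext V
  rw [lieD, h0, ContinuousAlternatingMap.add_apply, form_zero_apply, zero_add,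
    interiorProd_apply, ← hd t ht, ContinuousAlternatingMap.sub_apply]
  -- As γ_t(Y) = 0, the Lie derivative is i_Y dγ_t = i_Y η_t - i_Y η_0, and Y lies in both kernels.
  have hk : ∀ s ∈ timeI, η s x (Matrix.vecCons (Y x) V) = 0 := by
    intro s hs
    refine apply_eq_zero_of_mem_kernel (a := (η s x).toAlternatingMap) (i := 0) ?_
    rw [hF s hs x]
    exact hY.2 x
  rw [hk t ht, hk 0 zero_mem_timeI, sub_zero]

end ClassOfIsotopy

/-! ### Reeb vector and contact component as solutions of linear equations -/

namespace IsLinearPair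

variable {V : Type*} [AddCommGroup V] [Module ℝ V] [FiniteDimensional ℝ V] {h k : ℕ}
  {a : V [⋀^Fin 1]→ₗ[ℝ] ℝ} {κ η : V [⋀^Fin 2]→ₗ[ℝ] ℝ} {v v' : V}

lemma eq_of_forall (H : IsLinearPair h k a κ η)
    (hv : ∀ w, κ ![v, w] + a ![v] * a ![w] + η ![v, w] =
      κ ![v', w] + a ![v'] * a ![w] + η ![v', w]) : v = v' := by
  refine sub_eq_zero.1 (H.nondegenerate fun w => ?_)
  have e1 : κ ![v - v', w] = κ ![v, w] - κ ![v', w] := 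
    DFunLike.congr_fun (map_sub (bilin κ) v v') w
  have e2 : η ![v - v', w] = η ![v, w] - η ![v', w] := 
    DFunLike.congr_fun (map_sub (bilin η) v v') w
  have e3 : a ![v - v'] = a ![v] - a ![v'] := map_sub (lin a) v v'
  rw [e1, e2, e3]
  linear_combination hv w

/-- The Reeb vector solves this equation and the form is nondegenerate. Characterised in this way,
it inherits smoothness from the coefficients. -/
lemma reeb_of_forall (H : IsLinearPair h k a κ η)
    (hv : ∀ w, κ ![v, w] + a ![v] * a ![w] + η ![v, w] = a ![w]) :
    a ![v] = 1 ∧ v ∈ kernel κ ∧ v ∈ kernel η := by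
  obtain ⟨R, hR, hκ, hη⟩ := H.exists_reeb
  have : v = R := H.eq_of_forall fun w => by
    rw [hv, hR, mem_kernel_two.1 hκ, mem_kernel_two.1 hη]
    ring
  exact this ▸ ⟨hR, hκ, hη⟩

/-- The component along the contact kernel of a vector, in terms of the nondegenerate form. -/
lemma sub_mem_kernel (H : IsLinearPair h k a κ η)
    (hv : ∀ w, κ ![v, w] + a ![v] * a ![w] + η ![v, w] = η ![v', w]) :
    v' - v ∈ kernel η ∧ (v' ∈ kernel η → v = 0) := by
  obtain ⟨g, hg, f, hf, rfl⟩ := H.exists_add v'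
  have hg' := hg
  rw [H.contact_eq] at hg'
  have e : ∀ w, η ![g + f, w] = η ![g, w] := fun w => by
    have : η ![g + f, w] = η ![g, w] + η ![f, w] := 
      DFunLike.congr_fun (map_add (bilin η) g f) w
    rw [this, mem_kernel_two.1 hf, add_zero]
  have : v = g := H.eq_of_forall fun w => by
    rw [hv, e, mem_kernel_two.1 hg'.2, mem_kernel_one.1 hg'.1]
    ring
  subst this
  refine ⟨by simpa using hf, fun hvf => ?_⟩
  exact H.nondegenerate fun w => by rw [hv, mem_kernel_two.1 hvf]

end IsLinearPair

/-! ### Smooth solutions of nondegenerate linear equations -/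

section Solve

open Set Filter Topology

variable {n : ℕ} {M : Type*} [TopologicalSpace M] [ChartedSpace (Euc n) M]
  [IsManifold (𝓡 n) ∞ M] {k : ℕ} {t : ℝ} {x c : M} {y : Euc n}

omit [IsManifold (𝓡 n) ∞ M] in
lemma chartRep_apply_one (c : M) (θ : DForm n M 1) (y w : Euc n) :
    chartRep c θ y ![w] = θ ((extChartAt (𝓡 n) c).symm y) ![chartSymmDeriv c y w] := by
  rw [chartRep_apply]
  congr 1
  funext i
  fin_cases i
  rfl

omit [IsManifold (𝓡 n) ∞ M] in
lemma chartRep_apply_two (c : M) (θ : DForm n M 2) (y v w : Euc n) :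
    chartRep c θ y ![v, w] =
      θ ((extChartAt (𝓡 n) c).symm y) ![chartSymmDeriv c y v, chartSymmDeriv c y w] := by
  rw [chartRep_apply]
  congr 1
  funext i
  fin_cases i <;> rfl

variable (n) in
/-- The identification of one-forms with vectors. -/
def oneFormDual : (Euc n [⋀^Fin 1]→L[ℝ] ℝ) ≃L[ℝ] Euc n :=
  (oneForm n).symm.toContinuousLinearEquiv.trans
    (InnerProductSpace.toDual ℝ (Euc n)).symm.toContinuousLinearEquiv

/-- The map `v ↦ i_v κ + a(v) a + i_v η`, as an endomorphism of the Euclidean space. -/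
def momentMap (a : Euc n [⋀^Fin 1]→L[ℝ] ℝ) (κ η : Euc n [⋀^Fin 2]→L[ℝ] ℝ) : Euc n →L[ℝ] Euc n :=
  (oneFormDual n).toContinuousLinearMap.comp (contraction (Euc n) 1 κ +
    ((oneForm n).symm a).smulRight a + contraction (Euc n) 1 η)

lemma momentMap_eq_iff {a : Euc n [⋀^Fin 1]→L[ℝ] ℝ} {κ η : Euc n [⋀^Fin 2]→L[ℝ] ℝ} {v : Euc n}
    {μ : Euc n [⋀^Fin 1]→L[ℝ] ℝ} : momentMap a κ η v = oneFormDual n μ ↔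
      ∀ w, κ ![v, w] + a ![v] * a ![w] + η ![v, w] = μ ![w] := by
  have ha : (oneForm n).symm a v = a ![v] := by
    change a (fun _ => v) = a ![v]
    congr 1
    funext i
    fin_cases i
    rfl
  have h1 : momentMap a κ η v = oneFormDual n μ ↔
      contraction (Euc n) 1 κ v + (oneForm n).symm a v • a + contraction (Euc n) 1 η v = μ :=
    (oneFormDual n).injective.eq_iff
  rw [h1, ha]
  constructor
  · rintro rfl w
    rfl
  · intro h
    ext w
    obtain ⟨w, rfl⟩ : ∃ u, w = ![u] := ⟨w 0, by funext i; fin_cases i; rfl⟩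
    exact h w

lemma contDiff_momentMap : ContDiff ℝ ∞ fun q : (Euc n [⋀^Fin 1]→L[ℝ] ℝ) ×
    (Euc n [⋀^Fin 2]→L[ℝ] ℝ) × (Euc n [⋀^Fin 2]→L[ℝ] ℝ) => momentMap q.1 q.2.1 q.2.2 := by
  have hc : ContDiff ℝ ∞ (contraction (Euc n) 1) := by
    apply ContinuousLinearMap.contDiff
  have hs : ContDiff ℝ ∞ (oneForm n).symm := (oneForm n).symm.toContinuousLinearEquiv.contDiff
  unfold momentMap
  refine contDiff_const.clm_comp (((hc.comp (by fun_prop)).add ?_).add (hc.comp (by fun_prop)))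
  exact (hs.comp contDiff_fst).smulRight contDiff_fst

/-- Given smooth families of one-forms `α t` and of two-forms `κ t`, `η t` such that the form
`κ + α ⊗ α + η` is nondegenerate, smooth families of one-forms are represented by smooth fields. -/
lemma exists_field_solution {α μ : ℝ → DForm n M 1} {κ η : ℝ → DForm n M 2} (hα : SmoothFamily α)
    (hκ : SmoothFamily κ) (hη : SmoothFamily η) (hμ : SmoothFamily μ)
    (hnd : ∀ t ∈ timeI, ∀ x v, (∀ w, κ t x ![v, w] + α t x ![v] * α t x ![w] + η t x ![v, w] = 0) →
      v = 0) :
    ∃ X : ℝ → VField n M, SmoothField X ∧ ∀ t ∈ timeI, ∀ x w,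
      κ t x ![X t x, w] + α t x ![X t x] * α t x ![w] + η t x ![X t x, w] = μ t x ![w] := by
  set T : M → ℝ × Euc n → Euc n →L[ℝ] Euc n := fun c p =>
    momentMap (chartRep c (α p.1) p.2) (chartRep c (κ p.1) p.2) (chartRep c (η p.1) p.2) with hT
  have key : ∀ c, ∀ y ∈ (extChartAt (𝓡 n) c).target, ∀ t (V : Euc n) (ν : DForm n M 1),
      T c (t, y) V = oneFormDual n (chartRep c ν y) ↔
      ∀ w, κ t ((extChartAt (𝓡 n) c).symm y) ![chartSymmDeriv c y V, w] +
        α t ((extChartAt (𝓡 n) c).symm y) ![chartSymmDeriv c y V] *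
          α t ((extChartAt (𝓡 n) c).symm y) ![w] +
        η t ((extChartAt (𝓡 n) c).symm y) ![chartSymmDeriv c y V, w] =
        ν ((extChartAt (𝓡 n) c).symm y) ![w] := by
    intro c y hy t V ν
    simp only [hT]
    rw [momentMap_eq_iff]
    simp only [chartRep_apply_one, chartRep_apply_two]
    constructor
    · intro h w
      have := h (chartDeriv c _ w)
      rwa [chartSymmDeriv_chartDeriv hy] at this
    · exact fun h w => h _
  have hinv : ∀ c, ∀ p ∈ timeI ×ˢ (extChartAt (𝓡 n) c).target,
      ∃ A : Euc n ≃L[ℝ] Euc n, T c p = A := by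
    rintro c ⟨t, y⟩ ⟨ht, hy⟩
    have hinj : Function.Injective (T c (t, y)) := by
      rw [injective_iff_map_eq_zero]
      intro V hV
      have h0 : T c (t, y) V = oneFormDual n (chartRep c (0 : DForm n M 1) y) := by
        rw [hV, show chartRep c (0 : DForm n M 1) y = 0 by ext; rfl, map_zero]
      have h1 := hnd t ht _ _ ((key c y hy t V 0).1 h0)
      rw [← chartDeriv_chartSymmDeriv hy V, h1, map_zero]
    refine ⟨(LinearEquiv.ofInjectiveEndo _ hinj).toContinuousLinearEquiv, ?_⟩
    ext v
    rfl
  have hex : ∀ t x, ∃ v, t ∈ timeI → ∀ w,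
      κ t x ![v, w] + α t x ![v] * α t x ![w] + η t x ![v, w] = μ t x ![w] := by
    intro t x
    by_cases ht : t ∈ timeI
    · obtain ⟨a, ha⟩ : ∃ a : M, x ∈ (extChartAt (𝓡 n) a).source := ⟨x, mem_extChartAt_source x⟩
      obtain ⟨y, hy, rfl⟩ := exists_chart_symm_eq ha
      obtain ⟨A, hA⟩ := hinv a (t, y) ⟨ht, hy⟩
      refine ⟨chartSymmDeriv a y (A.symm (oneFormDual n (chartRep a (μ t) y))), fun _ => ?_⟩
      refine (key a y hy t _ (μ t)).1 ?_
      rw [hA]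
      simp
    · exact ⟨0, fun h => absurd h ht⟩
  choose X hX using hex
  refine ⟨X, fun c => ?_, fun t ht x => hX t x ht⟩
  -- In a chart the pointwise solution is the inverse endomorphism applied to the right-hand side;
  -- inversion is smooth at invertible maps.
  have heq : ∀ p ∈ timeI ×ˢ (extChartAt (𝓡 n) c).target, fieldRep c X p =
      (T c p).inverse (oneFormDual n (chartRep c (μ p.1) p.2)) := by
    rintro ⟨t, y⟩ ⟨ht, hy⟩
    obtain ⟨A, hA⟩ := hinv c (t, y) ⟨ht, hy⟩
    have h1 : T c (t, y) (fieldRep c X (t, y)) = oneFormDual n (chartRep c (μ t) y) := by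
      rw [key c y hy]
      rw [chartSymmDeriv_fieldRep hy]
      exact hX t _ ht
    simp only
    rw [← h1, hA]
    simp
  refine ContDiffOn.congr (fun p hp => ?_) heq
  have hTs : ContDiffWithinAt ℝ ∞ (T c) (timeI ×ˢ (extChartAt (𝓡 n) c).target) p :=
    contDiff_momentMap.contDiffAt.comp_contDiffWithinAt (f := fun p : ℝ × Euc n =>
      (chartRep c (α p.1) p.2, chartRep c (κ p.1) p.2, chartRep c (η p.1) p.2)) p
      ((hα c p hp).prodMk ((hκ c p hp).prodMk (hη c p hp)))
  obtain ⟨A, hA⟩ := hinv c p hp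
  have h3 : ContDiffAt ℝ ∞ ContinuousLinearMap.inverse (T c p) := by
    rw [hA]
    exact contDiffAt_map_inverse A
  exact (h3.comp_contDiffWithinAt p hTs).clm_apply
    ((oneFormDual n).contDiff.contDiffAt.comp_contDiffWithinAt p (hμ c p hp))

end Solve

/-! ### Extending kernel vectors to smooth tangent fields -/

section TangentFields

open Set Filter Topology

variable {n : ℕ} {M : Type*} [TopologicalSpace M] [ChartedSpace (Euc n) M]
  [IsManifold (𝓡 n) ∞ M] {k : ℕ} {t : ℝ} {x c : M} {y : Euc n}

instance (x : M) : FiniteDimensional ℝ (TangentSpace (𝓡 n) x) :=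
  inferInstanceAs (FiniteDimensional ℝ (Euc n))

lemma SmoothField.contMDiff {X : ℝ → VField n M} (hX : SmoothField X) (ht : t ∈ timeI) :
    ContMDiff (𝓡 n) (𝓡 n).tangent ∞ (fun x => (⟨x, X t x⟩ : TangentBundle (𝓡 n) M)) := by
  intro c
  rw [Bundle.contMDiffAt_section]
  have h1 : ContMDiffAt (𝓡 n) 𝓘(ℝ, Euc n) ∞
      (fun x => fieldRep c X (t, extChartAt (𝓡 n) c x)) c := by
    have h2 : ContDiffAt ℝ ∞ (fun y => fieldRep c X (t, y)) (extChartAt (𝓡 n) c c) :=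
      contDiffWithinAt_univ.1 (ContDiffWithinAt.comp (t := strip (Euc n)) _
        (hX.smoothAt ht (mem_extChartAt_target c)) (contDiff_prodMk_right t).contDiffWithinAt
        fun z _ => ⟨ht, mem_univ _⟩)
    exact ContMDiffAt.comp (g := fun y => fieldRep c X (t, y)) c h2.contMDiffAt contMDiffAt_extChartAt
  refine h1.congr_of_eventuallyEq ?_
  filter_upwards [(isOpen_extChartAt_source (I := 𝓡 n) c).mem_nhds (mem_extChartAt_source c)]
    with x hx
  rw [fieldRep_chart hx]
  have hx' : x ∈ (chartAt (Euc n) c).source := by rwa [extChartAt_source] at hx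
  have h3 := TangentBundle.continuousLinearMapAt_trivializationAt (I := 𝓡 n) hx'
  have h4 : x ∈ (trivializationAt (Euc n) (TangentSpace (𝓡 n)) c).baseSet := by
    simpa using hx'
  rw [← Bundle.Trivialization.continuousLinearMapAt_apply_of_mem ℝ _ h4]
  exact DFunLike.congr_fun h3 _

/-- The derivative of a function at a point. -/
def fnDeriv (f : M → ℝ) (x : M) : TangentSpace (𝓡 n) x →L[ℝ] ℝ := mfderiv (𝓡 n) 𝓘(ℝ, ℝ) f x

/-- The differential of a function. -/
def differential (f : M → ℝ) : DForm n M 1 := fun x =>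
  ContinuousAlternatingMap.ofSubsingleton ℝ (TangentSpace (𝓡 n) x) ℝ 0 (fnDeriv f x)

lemma smoothFamily_differential {f : M → ℝ} (hf : ContMDiff (𝓡 n) 𝓘(ℝ, ℝ) ∞ f) :
    SmoothFamily (n := n) fun _ : ℝ => differential f := by
  intro c
  have h1 : ContDiffOn ℝ ∞ (f ∘ (extChartAt (𝓡 n) c).symm) (extChartAt (𝓡 n) c).target := by
    rw [← contMDiffOn_iff_contDiffOn]
    exact hf.comp_contMDiffOn (contMDiffOn_extChartAt_symm c)
  have h2 : ContDiffOn ℝ ∞ (fun y => oneForm n (fderiv ℝ (f ∘ (extChartAt (𝓡 n) c).symm) y))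
      (extChartAt (𝓡 n) c).target :=
    (oneForm n).toContinuousLinearEquiv.contDiff.comp_contDiffOn
      (h1.fderiv_of_isOpen (isOpen_chart_target c) (by simp))
  have h3 : ∀ y ∈ (extChartAt (𝓡 n) c).target, chartRep c (differential f) y =
      oneForm n (fderiv ℝ (f ∘ (extChartAt (𝓡 n) c).symm) y) := by
    intro y hy
    have h4 : HasFDerivAt (f ∘ (extChartAt (𝓡 n) c).symm)
        ((fnDeriv f ((extChartAt (𝓡 n) c).symm y)).comp (chartSymmDeriv c y)) y :=
      hasMFDerivAt_iff_hasFDerivAt.1 (HasMFDerivAt.comp y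
        ((hf _).mdifferentiableAt (by simp)).hasMFDerivAt (hasMFDerivAt_chart_symm hy))
    rw [h4.fderiv]
    rfl
  exact (h2.comp contDiffOn_snd fun p hp => hp.2).congr fun p hp => h3 p.2 hp.2

/-- Take the linear form in the preferred chart at x, cut off by a bump function; the derivative of
that chart at x is the identity. -/
lemma exists_differential_eq [T2Space M] (x : M) (ℓ : TangentSpace (𝓡 n) x →ₗ[ℝ] ℝ) :
    ∃ f : M → ℝ, ContMDiff (𝓡 n) 𝓘(ℝ, ℝ) ∞ f ∧ ∀ w, differential (n := n) f x ![w] = ℓ w := by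
  obtain ⟨χ⟩ : Nonempty (SmoothBumpFunction (𝓡 n) x) := inferInstance
  let ℓ' : Euc n →L[ℝ] ℝ := LinearMap.toContinuousLinearMap (ℓ : Euc n →ₗ[ℝ] ℝ)
  refine ⟨fun z => χ z • ℓ' (extChartAt (𝓡 n) x z), χ.contMDiff_smul ?_, fun w => ?_⟩
  · exact ℓ'.contMDiff.comp_contMDiffOn contMDiffOn_extChartAt
  · have h1 : HasMFDerivAt (𝓡 n) 𝓘(ℝ, ℝ) (fun z => ℓ' (extChartAt (𝓡 n) x z)) x
        (ℓ'.comp (chartDeriv x x)) :=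
      HasMFDerivAt.comp x ℓ'.hasMFDerivAt (hasMFDerivAt_chart (mem_extChartAt_source x))
    have h2 : (fun z => χ z • ℓ' (extChartAt (𝓡 n) x z)) =ᶠ[𝓝 x]
        fun z => ℓ' (extChartAt (𝓡 n) x z) := by
      filter_upwards [χ.eventuallyEq_one] with z hz
      rw [hz, Pi.one_apply, one_smul]
    have h3 := (h1.congr_of_eventuallyEq h2).mfderiv
    have h4 : chartDeriv (n := n) x x w = w := by
      have h5 := mfderiv_extChartAt_self (I := 𝓡 n) (x := x)
      exact congrArg (fun L => L w) h5
    refine (DFunLike.congr_fun h3 w).trans ?_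
    change ℓ' (chartDeriv x x w) = ℓ w
    rw [h4]
    rfl

variable {h k : ℕ} {α : ℝ → DForm n M 1} {η : ℝ → DForm n M 2}

omit [IsManifold (𝓡 n) ∞ M] in
/-- The pointwise linear data of a contact-symplectic pair. -/
lemma IsContactSymplecticPair.isLinearPair {α : DForm n M 1} {η : DForm n M 2}
    (H : IsContactSymplecticPair h k α η) (x : M) :
    IsLinearPair h k (α x).toAlternatingMap (extD α x).toAlternatingMap
      (η x).toAlternatingMap where
  dim_eq := (finrank_euclideanSpace_fin (𝕜 := ℝ) (n := n)).trans H.dim_eq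
  volume_ne_zero := H.volume_ne_zero x
  κ_pow := H.dα_pow x
  η_pow := H.η_pow x

omit [IsManifold (𝓡 n) ∞ M] in
lemma SmoothField.sub {X Y : ℝ → VField n M} (hX : SmoothField X) (hY : SmoothField Y) :
    SmoothField fun t => X t - Y t := by
  intro c
  refine ((hX c).sub (hY c)).congr fun p _ => ?_
  exact map_sub (chartDeriv c ((extChartAt (𝓡 n) c).symm p.2)) _ _

/-- Each vector in the kernel of `η` extends to a smooth vector field tangent to the kernel. -/
lemma exists_tangent_field [T2Space M] (hα : SmoothFamily α) (hη : SmoothFamily η)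
    (hpair : ∀ t ∈ timeI, IsContactSymplecticPair h k (α t) (η t)) {F : Distrib n M}
    (ht : t ∈ timeI) (hF : ∀ x, kernel (η t x).toAlternatingMap = F x)
    {x : M} {v : TangentSpace (𝓡 n) x} (hv : v ∈ F x) :
    ∃ Y : VField n M, IsSmoothTangentField F Y ∧ Y x = v := by
  have hnd : ∀ t ∈ timeI, ∀ x v, (∀ w, extD (α t) x ![v, w] + α t x ![v] * α t x ![w] +
      η t x ![v, w] = 0) → v = 0 := fun t ht x v => ((hpair t ht).isLinearPair x).nondegenerate
  have H := fun x => (hpair t ht).isLinearPair x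
  -- Extend to a global one-form df the covector that v represents under dα + α⊗α + η; solving back
  -- gives a smooth field Z with Z(x) = v.
  obtain ⟨f, hf, hfx⟩ := exists_differential_eq x
    (bilin (extD (α t) x).toAlternatingMap v + (α t x ![v]) • lin (α t x).toAlternatingMap +
      bilin (η t x).toAlternatingMap v)
  obtain ⟨Z, hZ, hZe⟩ := exists_field_solution hα hα.extD hη (smoothFamily_differential hf) hnd
  -- g is the component of Z along the contact kernel, obtained by solving with right-hand side i_Z
  -- η. Then Z - g is tangent to F, and g(x) = 0 because v is already in F.
  obtain ⟨g, hg, hge⟩ := exists_field_solution hα hα.extD hη (hη.interiorProd hZ) hnd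
  have hsub := fun x => (H x).sub_mem_kernel (v := g t x) (v' := Z t x) fun w => hge t ht x w
  have hZx : Z t x = v := (H x).eq_of_forall fun w => (hZe t ht x w).trans (hfx w)
  have hgx : g t x = 0 := (hsub x).2 (by rw [hZx, hF]; exact hv)
  refine ⟨fun x => Z t x - g t x, ⟨(hZ.sub hg).contMDiff ht, fun x => ?_⟩, ?_⟩
  · rw [← hF]
    exact (hsub x).1
  · simp only [hZx, hgx, sub_zero]

end TangentFields

/-! ### Smooth functions built from forms, and a linear equation in time -/

section IsotopyOfClass

open Set Filter Topology

variable {n : ℕ} {M : Type*} [TopologicalSpace M] [ChartedSpace (Euc n) M]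
  [IsManifold (𝓡 n) ∞ M] {h k : ℕ} {t : ℝ} {x c : M} {y : Euc n}

omit [IsManifold (𝓡 n) ∞ M] in
lemma SmoothFamily.add {θ ζ : ℝ → DForm n M k} (hθ : SmoothFamily θ) (hζ : SmoothFamily ζ) :
    SmoothFamily fun t => θ t + ζ t := fun c => (hθ c).add (hζ c)

/-- The family of functions `g t` is smooth on `[0,1] × M`, in terms of charts. -/
def SmoothInCharts (n : ℕ) {M : Type*} [TopologicalSpace M] [ChartedSpace (Euc n) M]
    (g : ℝ → M → ℝ) : Prop :=
  ∀ c : M, ∀ t ∈ timeI, ∀ y ∈ (extChartAt (𝓡 n) c).target,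
    SmoothAt (fun p : ℝ × Euc n => g p.1 ((extChartAt (𝓡 n) c).symm p.2)) (t, y)

omit [IsManifold (𝓡 n) ∞ M] in
lemma SmoothFamily.smul {g : ℝ → M → ℝ} (hg : SmoothInCharts n g) {θ : ℝ → DForm n M k}
    (hθ : SmoothFamily θ) : SmoothFamily fun t x => g t x • θ t x := by
  intro c
  have h1 := (contDiffOn_iff_smoothAt (isOpen_chart_target c)).2
    fun p (hp : p ∈ timeI ×ˢ (extChartAt (𝓡 n) c).target) => hg c p.1 hp.1 p.2 hp.2
  exact h1.smul (hθ c)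

lemma contDiffWithinAt_eval_one {E : Type*} [NormedAddCommGroup E] [NormedSpace ℝ E] {s : Set E}
    {b : E → Euc n [⋀^Fin 1]→L[ℝ] ℝ} {v : E → Euc n} {z : E} (hb : ContDiffWithinAt ℝ ∞ b s z)
    (hv : ContDiffWithinAt ℝ ∞ v s z) : ContDiffWithinAt ℝ ∞ (fun p => b p ![v p]) s z := by
  have h1 := ((oneForm n).symm.toContinuousLinearEquiv.contDiff.contDiffAt.comp_contDiffWithinAt z
    hb).clm_apply hv
  refine h1.congr_of_eventuallyEq (Eventually.of_forall fun p => ?_) ?_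
  all_goals
    refine congrArg (b _) ?_
    funext i
    fin_cases i
    rfl

lemma SmoothFamily.smoothInCharts {β : ℝ → DForm n M 1} (hβ : SmoothFamily β)
    {R : ℝ → VField n M} (hR : SmoothField R) : SmoothInCharts n fun t x => β t x ![R t x] := by
  intro c t ht y hy
  have h1 : SmoothAt (fun p : ℝ × Euc n => chartRep c (β p.1) p.2 ![fieldRep c R p]) (t, y) :=
    contDiffWithinAt_eval_one (hβ.smoothAt ht hy) (hR.smoothAt ht hy)
  have h2 : ∀ p ∈ timeI ×ˢ (extChartAt (𝓡 n) c).target,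
      β p.1 ((extChartAt (𝓡 n) c).symm p.2) ![R p.1 ((extChartAt (𝓡 n) c).symm p.2)] =
        chartRep c (β p.1) p.2 ![fieldRep c R p] := by
    rintro ⟨t, y⟩ ⟨-, hy⟩
    rw [chartRep_apply_one, chartSymmDeriv_fieldRep hy]
  refine ContDiffWithinAt.congr_of_eventuallyEq h1 ?_ (h2 _ ⟨ht, hy⟩)
  filter_upwards [eventually_mem_chart (p := (t, y)) hy] with p hp using h2 p hp

omit [IsManifold (𝓡 n) ∞ M] in
lemma SmoothInCharts.smoothFunctionFamily {g : ℝ → M → ℝ} (hg : SmoothInCharts n g) :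
    SmoothFunctionFamily n g := by
  rintro ⟨t, x⟩ ⟨ht, -⟩
  have hx := mem_extChartAt_source (I := 𝓡 n) x
  have h1 := (hg x t ht _ ((extChartAt (𝓡 n) x).map_source hx)).contMDiffWithinAt
  have h2 : ContMDiffAt (𝓘(ℝ, ℝ).prod (𝓡 n)) 𝓘(ℝ, ℝ × Euc n) ∞
      (fun p : ℝ × M => (p.1, extChartAt (𝓡 n) x p.2)) (t, x) :=
    contMDiffAt_fst.prodMk_space (ContMDiffAt.comp (g := extChartAt (𝓡 n) x) (t, x)
      contMDiffAt_extChartAt contMDiffAt_snd)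
  have h3 := ContMDiffWithinAt.comp (t, x) (f := fun p : ℝ × M => (p.1, extChartAt (𝓡 n) x p.2))
    (s := timeI ×ˢ univ) h1 h2.contMDiffWithinAt (fun p hp => ⟨hp.1, mem_univ _⟩)
  have h4 : ∀ᶠ p in 𝓝[timeI ×ˢ univ] (t, x), p.2 ∈ (extChartAt (𝓡 n) x).source :=
    (continuousAt_snd.eventually_mem ((isOpen_extChartAt_source x).mem_nhds hx)).filter_mono
      nhdsWithin_le_nhds
  refine h3.congr_of_eventuallyEq ?_ ?_
  · filter_upwards [h4] with p hp
    exact congrArg (g p.1) ((extChartAt (𝓡 n) x).left_inv hp).symm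
  · exact congrArg (g t) ((extChartAt (𝓡 n) x).left_inv hx).symm

lemma SmoothMaps.smoothInCharts_pullback {φ : ℝ → M → M} (hφ : SmoothMaps n φ)
    {β : ℝ → DForm n M 1} (hβ : SmoothFamily β) {R : ℝ → VField n M} (hR : SmoothField R) :
    SmoothInCharts n fun t x => pullback (φ t) (β t) x ![R t x] := by
  intro a t ht y hy
  set b := φ t ((extChartAt (𝓡 n) a).symm y) with hb
  have hbs : b ∈ (extChartAt (𝓡 n) b).source := mem_extChartAt_source b
  have hc := hφ.smoothAt_localRep ht hy hbs
  have h1 : SmoothAt (fun p : ℝ × Euc n => chartRep b (β p.1) (localRep n φ a b p)) (t, y) :=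
    ContDiffWithinAt.comp (g := fun p : ℝ × Euc n => chartRep b (β p.1) p.2)
      (f := fun p : ℝ × Euc n => (p.1, localRep n φ a b p)) (t := strip (Euc n)) (t, y)
      (hβ.smoothAt ht (mem_extChartAt_target b)) (contDiffWithinAt_fst.prodMk hc)
      fun p hp => ⟨hp.1, mem_univ _⟩
  have h2 : SmoothAt (fun p : ℝ × Euc n => dx (localRep n φ a b) p (fieldRep a R p)) (t, y) :=
    ContDiffWithinAt.clm_apply (hc.dx ⟨ht, mem_univ _⟩) (hR.smoothAt ht hy)
  have h3 := contDiffWithinAt_eval_one h1 h2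
  have hev := hφ.eventually_mem_source ht hy hbs
  refine ContDiffWithinAt.congr_of_eventuallyEq_of_mem h3 ?_ ⟨ht, mem_univ _⟩
  filter_upwards [hev, self_mem_nhdsWithin] with p hp hpS
  refine (hφ.pullback_eq hpS.1 hp.1 hp.2 (β p.1) _).trans ?_
  refine congrArg (chartRep b (β p.1) (localRep n φ a b p)) ?_
  funext i
  fin_cases i
  rfl

omit [IsManifold (𝓡 n) ∞ M] in
lemma pullback_zero_eq {φ : ℝ → M ≃ₘ⟮𝓡 n, 𝓡 n⟯ M} (hφ : IsIsotopy φ) (θ : DForm n M k) (x : M) :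
    pullback (φ 0) θ x = θ x := by
  have e : ((φ 0 : M ≃ₘ⟮𝓡 n, 𝓡 n⟯ M) : M → M) = id := funext hφ.zero
  have e2 : pullback (id : M → M) θ x = θ x := by
    ext V
    simp only [pullback]
    refine congrArg (θ x) (funext fun i => ?_)
    erw [mfderiv_id]
    rfl
  rw [e]
  exact e2

lemma eq_zero_of_linear_ode {q g : ℝ → ℝ} (hg : ContinuousOn g timeI)
    (hq : ∀ t ∈ timeI, HasDerivWithinAt q (g t * q t) timeI t) (h0 : q 0 = 0) (ht : t ∈ timeI) :
    q t = 0 := by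
  obtain ⟨K, hK⟩ := isCompact_Icc.exists_bound_of_continuousOn hg
  refine eq_zero_of_abs_deriv_le_mul_abs_self_of_eq_zero_right (K := K)
    (fun s hs => (hq s hs).continuousWithinAt)
    (fun s hs => hasDerivWithinAt_Ici hs (hq s ⟨hs.1, hs.2.le⟩)) h0 (fun s hs => ?_) t ht
  rw [norm_mul]
  exact mul_le_mul_of_nonneg_right (hK s ⟨hs.1, hs.2.le⟩) (norm_nonneg _)

end IsotopyOfClass

/-! ### Moser's method: from the constant basic class to the isotopy -/

section MoserMethod

open Set Filter Topology

variable {n : ℕ} {M : Type*} [TopologicalSpace M] [ChartedSpace (Euc n) M]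
  [IsManifold (𝓡 n) ∞ M] {h k : ℕ} {t : ℝ} {x : M}
  {α : ℝ → DForm n M 1} {η : ℝ → DForm n M 2} {F G : Distrib n M}

omit [IsManifold (𝓡 n) ∞ M] in
lemma SmoothField.const {X : ℝ → VField n M} (hX : SmoothField X) (ht : t ∈ timeI) :
    SmoothField fun _ => X t := by
  intro c
  have h1 : ContDiff ℝ ∞ (fun p : ℝ × Euc n => (t, p.2)) := by fun_prop
  exact (hX c).comp h1.contDiffOn fun (p : ℝ × Euc n)
    (hp : p ∈ timeI ×ˢ (extChartAt (𝓡 n) c).target) => ⟨ht, hp.2⟩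

lemma timeD_eq_zero {θ : ℝ → DForm n M k} (hθ : SmoothFamily θ) (ht : t ∈ timeI)
    {V : Fin k → TangentSpace (𝓡 n) x} (h : ∀ s ∈ timeI, θ s x V = 0) : timeD θ t x V = 0 :=
  timeD_apply_eq hθ ht x V ((hasDerivWithinAt_const t timeI 0).congr h (h t ht))

/-- The Reeb fields of a smooth family of contact-symplectic pairs. -/
lemma exists_reeb_field (hα : SmoothFamily α) (hη : SmoothFamily η)
    (hpair : ∀ t ∈ timeI, IsContactSymplecticPair h k (α t) (η t)) :
    ∃ R : ℝ → VField n M, SmoothField R ∧ ∀ t ∈ timeI, ∀ x, α t x ![R t x] = 1 ∧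
      R t x ∈ kernel (extD (α t) x).toAlternatingMap ∧
      R t x ∈ kernel (η t x).toAlternatingMap := by
  obtain ⟨R, hR, hRe⟩ := exists_field_solution hα hα.extD hη hα fun t ht x v =>
    ((hpair t ht).isLinearPair x).nondegenerate
  exact ⟨R, hR, fun t ht x => ((hpair t ht).isLinearPair x).reeb_of_forall (hRe t ht x)⟩

/-- The vector field of the Moser method. -/
lemma exists_moser_field [T2Space M] (hα : SmoothFamily α) (hη : SmoothFamily η)
    (hpair : ∀ t ∈ timeI, IsContactSymplecticPair h k (α t) (η t))
    (hF : ∀ t ∈ timeI, ∀ x, kernel (η t x).toAlternatingMap = F x)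
    (hG : ∀ t ∈ timeI, ∀ x, kernel (contactForm (α t) h x) = G x)
    {γ : ℝ → DForm n M 1} (hγ : SmoothFamily γ) (hγb : ∀ t ∈ timeI, IsBasic F (γ t)) :
    ∃ (X : ℝ → VField n M) (g : ℝ → M → ℝ), SmoothField X ∧ SmoothInCharts n g ∧
      ∀ t ∈ timeI, ∀ x, α t x ![X t x] = 0 ∧
        (∀ w, η t x ![X t x, w] = -timeD γ t x ![w]) ∧
        ∀ w, extD (α t) x ![X t x, w] = -timeD α t x ![w] + g t x * α t x ![w] := by
  obtain ⟨R, hR, hRp⟩ := exists_reeb_field hα hη hpair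
  have hg : SmoothInCharts n fun t x => timeD α t x ![R t x] := hα.timeD.smoothInCharts hR
  -- The right-hand side is -γ̇ - α̇ + α̇(R)α; the last term makes it vanish at R.
  obtain ⟨X, hX, hXe⟩ := exists_field_solution hα hα.extD hη
    ((hγ.timeD.neg.add hα.timeD.neg).add (hα.smul hg)) fun t ht x v =>
      ((hpair t ht).isLinearPair x).nondegenerate
  refine ⟨X, fun t x => timeD α t x ![R t x], hX, hg, fun t ht x => ?_⟩
  have H := (hpair t ht).isLinearPair x
  obtain ⟨hR1, hR2, hR3⟩ := hRp t ht x
  refine H.moser (b := lin (timeD α t x).toAlternatingMap)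
    (c := lin (timeD γ t x).toAlternatingMap) hR1 hR2 hR3 (fun v hv => ?_) (fun v hv => ?_)
    fun w => (hXe t ht x w).trans ?_
  -- A vector of G lies in ker α_s for every s, since G is independent of s; so α̇ vanishes on it.
  · refine timeD_eq_zero hα ht fun s hs => ?_
    have h1 : v ∈ kernel (contactForm (α s) h x) := by
      rw [hG s hs, ← hG t ht]
      exact hv
    rw [contactForm, ((hpair s hs).isLinearPair x).contact_eq] at h1
    exact mem_kernel_one.1 h1.1
  · refine timeD_eq_zero hγ ht fun s hs => ?_
    -- Basicness is tested on smooth fields only, so the vector is first extended to a field tangent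
    -- to F.
    obtain ⟨Y, hY, rfl⟩ := exists_tangent_field hα hη hpair ht (hF t ht) (v := v)
      (by rw [← hF t ht]; exact hv)
    exact interiorProd_eq_zero_iff.1 ((hγb s hs Y hY).1 x)
  · change -timeD γ t x ![w] + -timeD α t x ![w] + timeD α t x ![R t x] * α t x ![w] = _
    simp only [lin_apply]
    change _ = -timeD γ t x ![w] - timeD α t x ![w] + timeD α t x ![R t x] * α t x ![w]
    ring

omit [IsManifold (𝓡 n) ∞ M] in
lemma lieD_eq_of_interiorProd {Y : VField n M} {θ : DForm n M (k + 1)} {ζ : DForm n M k}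
    (h : interiorProd Y θ = ζ) (x : M) :
    lieD Y θ x = extD ζ x + interiorProd Y (extD θ) x := by
  rw [lieD, h]

/-- The flow of the Moser field preserves the closed forms. -/
lemma pullback_eq_of_moser {γ : ℝ → DForm n M k} {θ : ℝ → DForm n M (k + 1)}
    (hθ : SmoothFamily θ) (hγ : SmoothFamily γ) (hcl : ∀ t ∈ timeI, ∀ x, extD (θ t) x = 0)
    (hd : ∀ t ∈ timeI, ∀ x, θ t x - θ 0 x = extD (γ t) x)
    {φ : ℝ → M ≃ₘ⟮𝓡 n, 𝓡 n⟯ M} (hφ : IsIsotopy φ) {X : ℝ → VField n M} (hX : SmoothField X)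
    (hφX : ∀ x, IsFlowLine X fun t => φ t x)
    (hXθ : ∀ t ∈ timeI, ∀ x, interiorProd (X t) (θ t) x = -timeD γ t x) (ht : t ∈ timeI) (x : M) :
    pullback (φ t) (θ t) x = θ 0 x := by
  ext W
  rw [← pullback_zero_eq hφ (θ 0) x]
  refine eq_of_hasDerivWithinAt_zero (f := fun s => pullback (φ s) (θ s) x W) (fun s hs => ?_) ht
  -- Since η_r = η_0 + dγ_r, the time derivative is dγ̇; it cancels L_X η = d(i_X η) = -dγ̇.
  have h1 : ∀ V, HasDerivWithinAt (fun r => θ r (φ s x) V)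
      (extD (timeD γ s) (φ s x) V) timeI s := by
    intro V
    have h2 : ∀ r ∈ timeI, θ r (φ s x) V = θ 0 (φ s x) V + extD (γ r) (φ s x) V := by
      intro r hr
      rw [← hd r hr, ContinuousAlternatingMap.sub_apply]
      ring
    rw [← hγ.timeD_extD hs]
    exact ((hγ.extD.hasDerivWithinAt_timeD hs (φ s x) V).const_add _).congr h2 (h2 s hs)
  refine (hasDerivWithinAt_pullback hθ hX hφ.smoothMaps hφX hs x W (h1 _)).congr_deriv ?_
  rw [lieD_eq_of_interiorProd (ζ := -timeD γ s) (funext (hXθ s hs)), extD_neg,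
    ContinuousAlternatingMap.add_apply, ContinuousAlternatingMap.neg_apply, interiorProd_apply,
    hcl s hs, form_zero_apply]
  ring

/-- The flow of the Moser field rescales the one-forms. -/
lemma pullback_eq_smul_of_moser (hα : SmoothFamily α)
    {φ : ℝ → M ≃ₘ⟮𝓡 n, 𝓡 n⟯ M} (hφ : IsIsotopy φ) {X : ℝ → VField n M} (hX : SmoothField X)
    (hφX : ∀ x, IsFlowLine X fun t => φ t x) {g : ℝ → M → ℝ} (hg : SmoothInCharts n g)
    (hXα : ∀ t ∈ timeI, ∀ x, α t x ![X t x] = 0)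
    (hXκ : ∀ t ∈ timeI, ∀ x w,
      extD (α t) x ![X t x, w] = -timeD α t x ![w] + g t x * α t x ![w])
    {R : TangentSpace (𝓡 n) x} (hR : α 0 x ![R] = 1) (ht : t ∈ timeI) :
    pullback (φ t) (α t) x = pullback (φ t) (α t) x ![R] • α 0 x := by
  have hgc : ContinuousOn (fun s => g s (φ s x)) timeI := by
    refine ContinuousOn.comp (g := fun p : ℝ × M => g p.1 p.2) (t := timeI ×ˢ univ)
      hg.smoothFunctionFamily.continuousOn (continuousOn_id.prodMk fun s hs => ?_)
      fun s hs => ⟨hs, mem_univ _⟩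
    exact (hφX x s hs).continuousWithinAt
  have hq : ∀ s ∈ timeI, ∀ W, HasDerivWithinAt (fun s => pullback (φ s) (α s) x W)
      (g s (φ s x) * pullback (φ s) (α s) x W) timeI s := by
    intro s hs W
    refine (hasDerivWithinAt_pullback hα hX hφ.smoothMaps hφX hs x W
      (hα.hasDerivWithinAt_timeD hs _ _)).congr_deriv ?_
    -- As α(X) = 0, only i_X dα remains, and it combines with α̇ to g·α.
    have hL : lieD (X s) (α s) (φ s x) = interiorProd (X s) (extD (α s)) (φ s x) := by
      rw [lieD_eq_of_interiorProd (ζ := 0)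
        (funext fun x => interiorProd_eq_zero_iff.2 (hXα s hs x)), extD_zero]
      exact zero_add _
    rw [hL, interiorProd_apply]
    obtain ⟨w, rfl⟩ : ∃ w, W = ![w] := ⟨W 0, by funext i; fin_cases i; rfl⟩
    have e : (fun i => mfderiv (𝓡 n) (𝓡 n) (φ s) x ((![w] : Fin 1 → _) i)) =
        ![mfderiv (𝓡 n) (𝓡 n) (φ s) x w] := by
      funext i
      fin_cases i
      rfl
    have e2 : pullback (φ s) (α s) x ![w] = α s (φ s x) ![mfderiv (𝓡 n) (𝓡 n) (φ s) x w] :=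
      congrArg (α s (φ s x)) e
    rw [e2, e, hXκ s hs]
    ring
  ext W
  obtain ⟨w, rfl⟩ : ∃ w, W = ![w] := ⟨W 0, by funext i; fin_cases i; rfl⟩
  -- All values of φ_s^*α_s at x obey one scalar linear equation. The combination φ_s^*α_s(w) -
  -- α_0(w) φ_s^*α_s(R) vanishes at s = 0, because α_0(R) = 1, hence always.
  have h0 := eq_zero_of_linear_ode
    (q := fun s => pullback (φ s) (α s) x ![w] - α 0 x ![w] * pullback (φ s) (α s) x ![R]) hgc
    (fun s hs => ((hq s hs ![w]).sub ((hq s hs ![R]).const_mul (α 0 x ![w]))).congr_deriv (by ring))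
    (by simp only [pullback_zero_eq hφ, hR]; ring) ht
  change _ = pullback (φ t) (α t) x ![R] * α 0 x ![w]
  linear_combination h0

omit [IsManifold (𝓡 n) ∞ M] in
lemma pullback_ne_zero {β : DForm n M 1} (φ : ℝ → M ≃ₘ⟮𝓡 n, 𝓡 n⟯ M)
    {v : TangentSpace (𝓡 n) (φ t x)} (hv : β (φ t x) ![v] ≠ 0) : pullback (φ t) β x ≠ 0 := by
  intro h
  obtain ⟨w, rfl⟩ := (mfderiv_diffeo_bijective φ t x).2 v
  refine hv (Eq.trans ?_ (DFunLike.congr_fun h ![w]))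
  refine congrArg (β (φ t x)) ?_
  funext i
  fin_cases i
  rfl

/-- If the basic class is constant, the pairs are related by an isotopy. -/
theorem exists_isotopy_of_hasConstantBasicClass [CompactSpace M] [T2Space M] (hα : SmoothFamily α)
    (hη : SmoothFamily η)
    (hpair : ∀ t ∈ timeI, IsContactSymplecticPair h k (α t) (η t))
    (hF : ∀ t ∈ timeI, ∀ x, kernel (η t x).toAlternatingMap = F x)
    (hG : ∀ t ∈ timeI, ∀ x, kernel (contactForm (α t) h x) = G x)
    (hc : HasConstantBasicClass F η) :
    ∃ (φ : ℝ → M ≃ₘ⟮𝓡 n, 𝓡 n⟯ M) (f : ℝ → M → ℝ),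
      IsIsotopy φ ∧ SmoothFunctionFamily n f ∧
      ∀ t ∈ timeI, ∀ x, f t x ≠ 0 ∧ pullback (φ t) (η t) x = η 0 x ∧
        pullback (φ t) (α t) x = f t x • α 0 x := by
  obtain ⟨γ, hγ, hγb⟩ := hc
  obtain ⟨X, g, hX, hg, hXp⟩ := exists_moser_field hα hη hpair hF hG hγ fun t ht => (hγb t ht).1
  obtain ⟨φ, hφ, hφX⟩ := exists_isotopy hX
  obtain ⟨R, hR, hRp⟩ := exists_reeb_field hα hη hpair
  have hpull : ∀ t ∈ timeI, ∀ x,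
      pullback (φ t) (α t) x = pullback (φ t) (α t) x ![R 0 x] • α 0 x := fun t ht x =>
    pullback_eq_smul_of_moser hα hφ hX hφX hg (fun t ht x => (hXp t ht x).1)
      (fun t ht x => (hXp t ht x).2.2) (hRp 0 zero_mem_timeI x).1 ht
  -- As α_0(R_0) = 1, the factor is forced: f_t = (φ_t^*α_t)(R_0). If it vanished at a point,
  -- φ_t^*α_t would vanish there, contradicting α_t(R_t) = 1.
  refine ⟨φ, fun t x => pullback (φ t) (α t) x ![R 0 x], hφ,
    (hφ.smoothMaps.smoothInCharts_pullback hα (hR.const zero_mem_timeI)).smoothFunctionFamily,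
    fun t ht x => ⟨fun h0 => ?_, ?_, hpull t ht x⟩⟩
  · refine pullback_ne_zero φ (v := R t (φ t x)) (β := α t) ?_ ((hpull t ht x).trans ?_)
    · rw [(hRp t ht _).1]
      exact one_ne_zero
    · rw [show pullback (φ t) (α t) x ![R 0 x] = 0 from h0, zero_smul]
  · refine pullback_eq_of_moser hη hγ (fun t ht => (hpair t ht).closed)
      (fun t ht => (hγb t ht).2) hφ hX hφX (fun t ht x => ?_) ht x
    ext W
    obtain ⟨w, rfl⟩ : ∃ w, W = ![w] := ⟨W 0, by funext i; fin_cases i; rfl⟩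
    exact (hXp t ht x).2.1 w

end MoserMethod

end ContactSymplectic

end

open ContactSymplectic in
theorem theorem4 {n : ℕ} {M : Type*} [TopologicalSpace M]
    [ChartedSpace (EuclideanSpace ℝ (Fin n)) M] [IsManifold (𝓡 n) ∞ M]
    [T2Space M] [CompactSpace M]
    (h k : ℕ) (α : ℝ → DForm n M 1) (η : ℝ → DForm n M 2) (F G : Distrib n M)
    (hα : SmoothFamily α) (hη : SmoothFamily η)
    (hpair : ∀ t ∈ Set.Icc (0 : ℝ) 1, IsContactSymplecticPair h k (α t) (η t))
    (hF : ∀ t ∈ Set.Icc (0 : ℝ) 1, ∀ x, kernel (η t x).toAlternatingMap = F x)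
    (hG : ∀ t ∈ Set.Icc (0 : ℝ) 1, ∀ x, kernel (contactForm (α t) h x) = G x) :
    (∃ (φ : ℝ → M ≃ₘ⟮𝓡 n, 𝓡 n⟯ M) (f : ℝ → M → ℝ),
      IsIsotopy φ ∧ SmoothFunctionFamily n f ∧
      ∀ t ∈ Set.Icc (0 : ℝ) 1, ∀ x,
        f t x ≠ 0 ∧
        pullback (φ t) (η t) x = η 0 x ∧
        pullback (φ t) (α t) x = f t x • α 0 x) ↔
    HasConstantBasicClass F η := by
  constructor
  · rintro ⟨φ, _, hφ, -, H⟩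
    exact hasConstantBasicClass_of_isotopy hη (fun t ht => (hpair t ht).closed) hF hφ
      fun t ht x => (H t ht x).2.1
  · exact exists_isotopy_of_hasConstantBasicClass hα hη hpair hF hG
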